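/- Let $H$ be a finite-dimensional Hopf algebra over $\mathbb{C}$, with coproduct $\Delta$, counit $\varepsilon$ and (automatically invertible) antipode $S$. Let $\mathcal{C}=\mathrm{Rep}(H)$ be the tensor category of finite-dimensional representations of $H$, where $a\in H$ acts on $V\otimes W$ through $\Delta(a)$, and let $Z(\mathcal{C})$ be its Drinfeld center, with braiding $\beta_{X,Y}\colon X\otimes Y\to Y\otimes X$. Write $\beta^2_{X,Y}=\beta_{Y,X}\circ\beta_{X,Y}\in\mathrm{End}(X\otimes Y)$. The quasi-exponent $\mathrm{qexp}(\mathcal{C})$ is the smallest positive integer $N$ such that $(\beta^2_{X,Y})^N$ is unipotent (that is, $(\beta^2_{X,Y})^N-\mathrm{id}$ is nilpotent) for all $X,Y\in Z(\mathcal{C})$. Let $D(H)=H\otimes H^{*\mathrm{cop}}$ be the Drinfeld double of $H$, which contains $H$ and $H^{*\mathrm{cop}}$ as Hopf subalgebras, with universal $R$-matrix $R=\sum_i h_i\otimes h_i^*$, where $(h_i)$ and $(h_i^*)$ are dual bases of $H$ and $H^*$, and let $u=\sum_i S_{D(H)}(h_i^*)\,h_i\in D(H)$ be its Drinfeld element,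 where $S_{D(H)}$ is the antipode of $D(H)$. The quasi-exponent $\mathrm{qexp}(H)$ of $H$, in the sense of Etingof and Gelaki, is the smallest positive integer $n$ such that $u^n$ is unipotent (that is, $u^n-1$ is nilpotent in $D(H)$). Then both quasi-exponents exist, and $\mathrm{qexp}(\mathcal{C})=\mathrm{qexp}(H)$. -/

import Mathlib

universe u v w

set_option linter.unusedSectionVars false
set_option linter.unusedSimpArgs false

namespace HopfQuasi

section Antipode

open TensorProduct Coalgebra HopfAlgebra WithConv LinearMap

variable {K : Type v} {H : Type u} [Field K] [Ring H] [HopfAlgebra K H]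

theorem conv_comp_antipode_mul {B : Type w} [Ring B] [Algebra K B] (i : H →ₐ[K] B) :
    toConv (i.toLinearMap ∘ₗ antipode K) * toConv i.toLinearMap = 1 := by
  have := LinearMap.algHom_comp_convMul_distrib i (toConv (antipode K (A := H))) (toConv LinearMap.id)
  rw [LinearMap.antipode_mul_id] at this
  apply WithConv.ofConv_injective
  simp only [LinearMap.comp_id] at this
  rw [← this]
  ext x; simp

theorem conv_mul_comp_antipode {B : Type w} [Ring B] [Algebra K B] (i : H →ₐ[K] B) :
    toConv i.toLinearMap * toConv (i.toLinearMap ∘ₗ antipode K) = 1 := by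
  have := LinearMap.algHom_comp_convMul_distrib i (toConv LinearMap.id) (toConv (antipode K (A := H)))
  rw [LinearMap.id_mul_antipode] at this
  apply WithConv.ofConv_injective
  simp only [LinearMap.comp_id] at this
  rw [← this]
  ext x; simp

theorem conv_includeLeft_mul_includeRight :
    toConv (Algebra.TensorProduct.includeLeft (R := K) (S := K) (A := H) (B := H)).toLinearMap *
      toConv (Algebra.TensorProduct.includeRight (R := K) (A := H) (B := H)).toLinearMap =
    toConv (comul (R := K) (A := H)) := by
  ext a
  simp only [convMul_apply]
  induction comul (R := K) a <;> simp_all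

theorem conv_comul_antipode_mul_includeLeft :
    toConv (comul (R := K) (A := H) ∘ₗ antipode K) *
      toConv (Algebra.TensorProduct.includeLeft (R := K) (S := K) (A := H) (B := H)).toLinearMap =
    toConv ((Algebra.TensorProduct.includeRight (R := K) (A := H) (B := H)).toLinearMap ∘ₗ
      antipode K) := by
  have h1 := conv_comp_antipode_mul (Bialgebra.comulAlgHom K H)
  have h2 := conv_mul_comp_antipode (K := K)
    (Algebra.TensorProduct.includeRight (R := K) (A := H) (B := H))
  rw [Bialgebra.toLinearMap_comulAlgHom] at h1
  rw [← conv_includeLeft_mul_includeRight, ← mul_assoc] at h1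
  exact left_inv_eq_right_inv h1 h2

theorem comul_antipode (a : H) : comul (R := K) (antipode K a) =
    TensorProduct.map (antipode K) (antipode K) (TensorProduct.comm K H H (comul a)) := by
  have h1 := conv_comul_antipode_mul_includeLeft (K := K) (H := H)
  have h2 := conv_mul_comp_antipode (K := K)
    (Algebra.TensorProduct.includeLeft (R := K) (S := K) (A := H) (B := H))
  replace h1 := congrArg (· * toConv ((Algebra.TensorProduct.includeLeft (R := K) (S := K)
    (A := H) (B := H)).toLinearMap ∘ₗ antipode K)) h1
  simp only [mul_assoc, h2, mul_one] at h1
  have h3 := congrArg (fun f => f.ofConv a) h1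
  simp only [convMul_apply, LinearMap.comp_apply] at h3
  rw [h3]
  induction comul (R := K) a <;> simp_all


theorem comul_shift (x h : H) :
    LinearMap.mul' K (H ⊗[K] H) (TensorProduct.map
      (comul ∘ₗ mulLeft K x ∘ₗ antipode K)
      (Algebra.TensorProduct.includeLeft (R := K) (S := K) (A := H) (B := H)).toLinearMap
      (comul h)) = comul x * (1 ⊗ₜ antipode K h) := by
  have h3 := congrArg (fun f => comul (R := K) x * f.ofConv h)
    (conv_comul_antipode_mul_includeLeft (K := K) (H := H))
  simp only [convMul_apply, LinearMap.comp_apply] at h3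
  refine Eq.trans ?_ h3
  induction comul (R := K) h with
  | zero => simp
  | tmul a b => simp [mul_assoc]
  | add a b ha hb => rw [map_add, map_add, ha, hb, map_add, map_add, mul_add]

theorem integral_ker (l : H →ₗ[K] K)
    (hl : ∀ x, TensorProduct.rid K H (l.lTensor H (comul x)) = l x • 1) (h : H)
    (hh : ∀ x, l (x * antipode K h) = 0) (x : H) :
    TensorProduct.lid K H ((l ∘ₗ mulLeft K x ∘ₗ antipode K).rTensor H (comul h)) = 0 := by
  have h1 := congrArg (fun t => TensorProduct.rid K H (l.lTensor H t)) (comul_shift (K := K) x h)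
  have h2 : TensorProduct.rid K H (l.lTensor H (comul x * (1 ⊗ₜ antipode K h))) = 0 := by
    induction comul (R := K) x with
    | zero => simp
    | tmul a b => simp [hh]
    | add a b ha hb => simp only [add_mul, map_add, ha, hb, add_zero]
  rw [h2] at h1
  refine Eq.trans ?_ h1
  have key : ∀ (s : H ⊗[K] H) (d : H), TensorProduct.rid K H (l.lTensor H (s * (d ⊗ₜ 1))) =
      TensorProduct.rid K H (l.lTensor H s) * d := by
    intro s d
    induction s with
    | zero => simp
    | tmul a b => simp
    | add a b ha hb => simp only [add_mul, map_add, ha, hb]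
  induction comul (R := K) h with
  | zero => simp
  | tmul a b => simp [key, hl, -Bialgebra.comul_mul]
  | add a b ha hb => simp only [map_add, ha, hb]

theorem integral_apply_smul (l : H →ₗ[K] K)
    (hl : ∀ x, TensorProduct.rid K H (l.lTensor H (comul x)) = l x • 1) (h : H)
    (hh : ∀ x, l (x * antipode K h) = 0) (z : H) : l z • h = 0 := by
  classical
  -- `c ⊗ d ↦ ∑ l (z S²(d₁) S(c)) d₂`
  let Γ : H ⊗[K] (H ⊗[K] H) →ₗ[K] H :=
    (TensorProduct.lid K H).toLinearMap ∘ₗ (l ∘ₗ mulLeft K z ∘ₗ LinearMap.mul' K H ∘ₗ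
      TensorProduct.map (antipode K ∘ₗ antipode K) (antipode K) ∘ₗ
        (TensorProduct.comm K H H).toLinearMap).rTensor H ∘ₗ
      (TensorProduct.assoc K H H H).symm.toLinearMap
  have hΓ : ∀ c d e : H, Γ (c ⊗ₜ (d ⊗ₜ e)) =
      l (z * (antipode K (antipode K d) * antipode K c)) • e := by
    intro c d e; simp [Γ]
  have h1 : Γ (comul.lTensor H (comul h)) = 0 := by
    obtain ⟨t, ht⟩ := TensorProduct.eq_repr_basis_right (Module.Basis.ofVectorSpace K H)
      (comul (R := K) h)
    have hz := integral_ker l hl h hh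
    have ht0 : ∀ j x, l (x * antipode K (t j)) = 0 := by
      intro j x
      have := hz x
      rw [← ht, Finsupp.sum, map_sum, map_sum] at this
      simp only [rTensor_tmul, lid_tmul, LinearMap.comp_apply, mulLeft_apply] at this
      by_cases hj : j ∈ t.support
      · exact linearIndependent_iff'.1 (Module.Basis.ofVectorSpace K H).linearIndependent _ _ this j hj
      · simp [Finsupp.notMem_support_iff.1 hj]
    rw [← ht, Finsupp.sum, map_sum, map_sum]
    refine Finset.sum_eq_zero fun j _ => ?_
    rw [lTensor_tmul]
    induction comul (R := K) (Module.Basis.ofVectorSpace K H j) with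
    | zero => simp
    | tmul a b => rw [hΓ, ← mul_assoc, ht0, zero_smul]
    | add a b ha hb => rw [tmul_add, map_add, ha, hb, add_zero]
  rw [← coassoc_apply] at h1
  have h2 : ∀ c e : H, Γ (TensorProduct.assoc K H H H (comul c ⊗ₜ e)) = l z • counit (R := K) c • e := by
    intro c e
    have h3 : l (z * antipode K (mul' K H ((antipode K).lTensor H (comul c)))) • e =
        l z • counit (R := K) c • e := by
      rw [mul_antipode_lTensor_comul_apply, Algebra.algebraMap_eq_smul_one, map_smul,
        antipode_one, mul_smul_comm, mul_one, map_smul, smul_eq_mul, mul_comm, mul_smul]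
    rw [← h3]
    induction comul (R := K) c with
    | zero => simp
    | tmul a b => simp [hΓ, antipode_mul_antidistrib]
    | add a b ha hb => simp only [add_tmul, map_add, ha, hb, mul_add, add_smul]
  have h4 : ∀ s : H ⊗[K] H, Γ (TensorProduct.assoc K H H H (comul.rTensor H s)) =
      l z • TensorProduct.lid K H (counit.rTensor H s) := by
    intro s
    induction s with
    | zero => simp
    | tmul a b => rw [rTensor_tmul, h2]; simp
    | add a b ha hb => simp only [map_add, ha, hb, smul_add]
  rw [h4] at h1
  simpa using h1

/-- The dual algebra `H^*`: linear functionals with the convolution product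
`(f * g)(x) = ∑ f(x₁) g(x₂)` and unit `ε`. -/
abbrev HopfDual (K : Type v) (H : Type u) [Field K] [Ring H] [HopfAlgebra K H] :=
  WithConv (Module.Dual K H)

/-- The map `(p, h) ↦ p(? S(h))`. -/
noncomputable def antipodeShift : HopfDual K H →ₗ[K] H →ₗ[K] HopfDual K H :=
  LinearMap.mk₂ K (fun p h => toConv (p.ofConv ∘ₗ mulRight K (antipode K h)))
    (by intros; ext; simp) (by intros; ext; simp)
    (by intros; ext; simp [mul_add]) (by intros; ext; simp)

theorem antipodeShift_apply (p : HopfDual K H) (h x : H) :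
    antipodeShift p h x = p (x * antipode K h) := rfl

theorem antipodeShift_mul (p : HopfDual K H) (a b : H) :
    antipodeShift (antipodeShift p a) b = antipodeShift p (a * b) := by
  ext x; simp [antipodeShift_apply, antipode_mul_antidistrib, mul_assoc]

/-- The map `(p, h) ↦ p(? h)`. -/
noncomputable def rTrans : HopfDual K H →ₗ[K] H →ₗ[K] HopfDual K H :=
  LinearMap.mk₂ K (fun p h => toConv (p.ofConv ∘ₗ mulRight K h))
    (by intros; ext; simp) (by intros; ext; simp)
    (by intros; ext; simp [mul_add]) (by intros; ext; simp)

theorem mul_antipodeShift (q p : HopfDual K H) (h : H) :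
    q * antipodeShift p h = TensorProduct.lift ((antipodeShift ∘ₗ mulRight K p ∘ₗ rTrans q).flip)
      (comul h) := by
  ext x
  have h1 := congrArg (fun t => mul' K K (TensorProduct.map q.ofConv p.ofConv t))
    (comul_shift (K := K) x h)
  have h2 : mul' K K (TensorProduct.map q.ofConv p.ofConv (comul x * (1 ⊗ₜ antipode K h))) =
      (q * antipodeShift p h) x := by
    rw [convMul_apply]
    induction comul (R := K) x with
    | zero => simp
    | tmul a b => simp [antipodeShift]
    | add a b ha hb => simp only [add_mul, map_add, ha, hb]
  refine (h2.symm.trans h1.symm).trans ?_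
  induction comul (R := K) h with
  | zero => simp
  | tmul a b =>
    simp only [antipodeShift, rTrans, map_tmul, lift.tmul, LinearMap.comp_apply, mul'_apply,
      mulLeft_apply, mulRight_apply, flip_apply, mk₂_apply, convMul_apply,
      AlgHom.toLinearMap_apply, Algebra.TensorProduct.includeLeft_apply]
    induction comul (R := K) (x * antipode K a) with
    | zero => simp
    | tmul a b => simp [rTrans]
    | add a b ha hb => simp only [add_mul, map_add, ha, hb]
  | add a b ha hb => simp only [map_add, ha, hb]; rfl


variable [FiniteDimensional K H]

/-- The basis of `H^*` dual to `Module.finBasis K H`. -/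
noncomputable def cobasis (i : Fin (Module.finrank K H)) : HopfDual K H :=
  toConv ((Module.finBasis K H).coord i)

theorem sum_apply_cobasis (f : HopfDual K H) :
    ∑ k, f (Module.finBasis K H k) • cobasis k = f := by
  apply WithConv.ofConv_injective
  apply (Module.finBasis K H).ext
  intro j
  simp [cobasis, Finsupp.single_apply]

theorem sum_comul (a : H) : comul (R := K) a = ∑ i, ∑ j,
    (cobasis i * cobasis j) a • (Module.finBasis K H i ⊗ₜ Module.finBasis K H j) := by
  have h1 := ((Module.finBasis K H).tensorProduct (Module.finBasis K H)).sum_repr (comul (R := K) a)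
  rw [Fintype.sum_prod_type] at h1
  refine h1.symm.trans ?_
  refine Finset.sum_congr rfl fun i _ => Finset.sum_congr rfl fun j _ => ?_
  rw [Module.Basis.tensorProduct_apply, convMul_apply]
  congr 1
  induction comul (R := K) a with
  | zero => simp
  | tmul a b => simp [cobasis, mul_comm]
  | add a b ha hb => simp only [map_add, Finsupp.add_apply, ha, hb]

theorem contraction {Z : Type w} [AddCommGroup Z] [Module K Z]
    (G : HopfDual K H →ₗ[K] H →ₗ[K] H →ₗ[K] Z) :
    ∑ k, TensorProduct.lift (G (cobasis k)) (comul (Module.finBasis K H k)) =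
      ∑ i, ∑ j, G (cobasis i * cobasis j) (Module.finBasis K H i) (Module.finBasis K H j) := by
  simp only [sum_comul, map_sum, map_smul, lift.tmul]
  rw [Finset.sum_comm]
  refine Finset.sum_congr rfl fun i _ => ?_
  rw [Finset.sum_comm]
  refine Finset.sum_congr rfl fun j _ => ?_
  conv_rhs => rw [← sum_apply_cobasis (cobasis i * cobasis j)]
  simp only [map_sum, map_smul, LinearMap.sum_apply, LinearMap.smul_apply]

/-- The projection `p ↦ ∑ₖ (eᵏ * p)(? S²(eₖ))` of `H^*` onto integrals. -/
noncomputable def intProj (p : HopfDual K H) : HopfDual K H :=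
  ∑ k, antipodeShift (cobasis k * p) (antipode K (Module.finBasis K H k))

theorem sum_rTrans_antipode_mul (q : HopfDual K H) :
    ∑ i, rTrans q (antipode K (Module.finBasis K H i)) * cobasis i = q 1 • 1 := by
  ext x
  have h1 : ∀ s : H ⊗[K] H, ∑ i, mul' K K (TensorProduct.map
      (rTrans q (antipode K (Module.finBasis K H i))).ofConv (cobasis (K := K) i).ofConv s) =
      q (mul' K H ((antipode K).lTensor H s)) := by
    intro s
    induction s with
    | zero => simp
    | tmul a b =>
      have h : q (a * antipode K b) = ∑ i, (Module.finBasis K H).repr b i *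
          q (a * antipode K (Module.finBasis K H i)) := by
        conv_lhs => rw [← (Module.finBasis K H).sum_repr b]
        simp only [map_sum, map_smul, Finset.mul_sum, mul_smul_comm, smul_eq_mul]
      simp [rTrans, cobasis, mul_comm, h]
    | add a b ha hb => simp only [map_add, Finset.sum_add_distrib, ha, hb]
  have h2 := h1 (comul x)
  rw [mul_antipode_lTensor_comul_apply, Algebra.algebraMap_eq_smul_one] at h2
  simp only [ofConv_sum, LinearMap.sum_apply, convMul_apply]
  rw [h2]
  simp [mul_comm]

theorem mul_intProj (q p : HopfDual K H) : q * intProj p = q 1 • intProj p := by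
  -- `G f c d = ((q (? S(c))) * f * p) · S d`
  let G : HopfDual K H →ₗ[K] H →ₗ[K] H →ₗ[K] HopfDual K H :=
    LinearMap.mk₂ K (fun f c => antipodeShift (rTrans q (antipode K c) * (f * p)) ∘ₗ antipode K)
      (by intros; ext; simp [add_mul, mul_add])
      (by intros; rw [smul_mul_assoc, mul_smul_comm, map_smul, LinearMap.smul_comp])
      (by intros; ext; simp [add_mul]) (by intros; ext; simp)
  have hG : ∀ f c d, G f c d =
    antipodeShift (rTrans q (antipode K c) * (f * p)) (antipode K d) := fun _ _ _ => rfl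
  have h1 : q * intProj p =
      ∑ k, TensorProduct.lift (G (cobasis k)) (comul (Module.finBasis K H k)) := by
    rw [intProj, Finset.mul_sum]
    refine Finset.sum_congr rfl fun k _ => ?_
    rw [mul_antipodeShift, comul_antipode]
    induction comul (R := K) (Module.finBasis K H k) with
    | zero => simp
    | tmul a b => simp [hG, mul_assoc]
    | add a b ha hb => simp only [map_add, ha, hb]
  rw [h1, contraction, Finset.sum_comm, intProj, Finset.smul_sum]
  refine Finset.sum_congr rfl fun j _ => ?_
  simp only [hG]
  rw [← LinearMap.sum_apply, ← map_sum]
  simp only [mul_assoc]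
  simp only [← mul_assoc (rTrans _ _)]
  rw [← Finset.sum_mul, sum_rTrans_antipode_mul, smul_mul_assoc, one_mul, map_smul,
    LinearMap.smul_apply]

theorem sum_intProj (p : HopfDual K H) :
    ∑ k, antipodeShift (intProj (cobasis k * p)) (Module.finBasis K H k) = p := by
  -- `G f c d = (f * p) · (S(c) d)`
  let G : HopfDual K H →ₗ[K] H →ₗ[K] H →ₗ[K] HopfDual K H :=
    LinearMap.mk₂ K (fun f c => antipodeShift (f * p) ∘ₗ mulLeft K (antipode K c))
      (by intros; ext; simp [add_mul]) (by intros; ext; simp [smul_mul_assoc])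
      (by intros; ext; simp [add_mul]) (by intros; ext; simp [smul_mul_assoc])
  have hG : ∀ f c d, G f c d = antipodeShift (f * p) (antipode K c * d) := fun _ _ _ => rfl
  have h1 := contraction G
  have h2 : ∀ k, TensorProduct.lift (G (cobasis k)) (comul (Module.finBasis K H k)) =
      (1 : HopfDual K H) (Module.finBasis K H k) • cobasis k * p := by
    intro k
    have h3 : antipodeShift (cobasis k * p) (mul' K H ((antipode K).rTensor H
        (comul (Module.finBasis K H k)))) =
        (1 : HopfDual K H) (Module.finBasis K H k) • cobasis k * p := by
      rw [mul_antipode_rTensor_comul_apply, Algebra.algebraMap_eq_smul_one, map_smul,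
        smul_mul_assoc]
      congr 1
      ext x
      simp [antipodeShift_apply]
    rw [← h3]
    induction comul (R := K) (Module.finBasis K H k) with
    | zero => simp
    | tmul a b => simp [hG]
    | add a b ha hb => simp only [map_add, ha, hb]
  simp only [h2] at h1
  rw [← Finset.sum_mul, sum_apply_cobasis, one_mul] at h1
  refine Eq.trans ?_ h1.symm
  rw [Finset.sum_comm]
  refine Finset.sum_congr rfl fun i _ => ?_
  rw [intProj, map_sum, LinearMap.sum_apply]
  refine Finset.sum_congr rfl fun k _ => ?_
  rw [antipodeShift_mul, hG, mul_assoc]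

theorem exists_integral : ∃ l : H →ₗ[K] K, l ≠ 0 ∧
    ∀ x, TensorProduct.rid K H (l.lTensor H (comul x)) = l x • 1 := by
  obtain ⟨p, hp⟩ : ∃ p : HopfDual K H, intProj p ≠ 0 := by
    by_contra! h0
    have h1 := sum_intProj (1 : HopfDual K H)
    simp only [h0, map_zero, LinearMap.zero_apply, Finset.sum_const_zero] at h1
    have h2 := congrArg (fun f : HopfDual K H => f 1) h1
    simp at h2
  refine ⟨(intProj p).ofConv, by simpa using hp, fun x => ?_⟩
  rw [← sub_eq_zero, ← Module.forall_dual_apply_eq_zero_iff K]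
  intro q
  have h1 := congrArg (fun f : HopfDual K H => f x) (mul_intProj (toConv q) p)
  have h2 : ∀ s : H ⊗[K] H, q (TensorProduct.rid K H ((intProj p).ofConv.lTensor H s)) =
    mul' K K (TensorProduct.map q (intProj p).ofConv s) := by
    intro s
    induction s with
    | zero => simp
    | tmul a b => simp [mul_comm]
    | add a b ha hb => simp only [map_add, ha, hb]
  rw [map_sub, h2]
  simp only [convMul_apply] at h1
  rw [h1]
  simp [mul_comm]

theorem antipode_injective : Function.Injective (antipode K (A := H)) := by
  obtain ⟨l, hl, hl'⟩ := exists_integral (K := K) (H := H)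
  rw [injective_iff_map_eq_zero]
  intro h hh
  obtain ⟨z, hz⟩ := DFunLike.ne_iff.1 hl
  exact (smul_eq_zero.1 (integral_apply_smul l hl' h (by simp [hh]) z)).resolve_left hz

theorem antipode_bijective : Function.Bijective (antipode K (A := H)) :=
  ⟨antipode_injective, LinearMap.injective_iff_surjective.1 antipode_injective⟩

variable (K H) in
/-- The antipode of a finite-dimensional Hopf algebra as a linear equivalence. -/
noncomputable def antipodeEquiv : H ≃ₗ[K] H := LinearEquiv.ofBijective (antipode K) antipode_bijective

variable (K) in
/-- The inverse `S⁻¹` of the antipode under composition. -/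
noncomputable def antipodeInv : H →ₗ[K] H := (antipodeEquiv K H).symm.toLinearMap

@[simp] theorem antipode_antipodeInv (a : H) : antipode K (antipodeInv K a) = a :=
  (antipodeEquiv K H).apply_symm_apply a

@[simp] theorem antipodeInv_antipode (a : H) : antipodeInv K (antipode K a) = a :=
  (antipodeEquiv K H).symm_apply_apply a

theorem antipodeInv_one : antipodeInv K (1 : H) = 1 :=
  antipode_injective (K := K) (by rw [antipode_antipodeInv, antipode_one])

theorem antipodeInv_mul (a b : H) :
    antipodeInv K (a * b) = antipodeInv K b * antipodeInv K a :=
  antipode_injective (K := K) (by simp only [antipode_mul_antidistrib, antipode_antipodeInv])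

theorem comul_antipodeInv (a : H) : comul (R := K) (antipodeInv K a) =
    TensorProduct.map (antipodeInv K) (antipodeInv K) (TensorProduct.comm K H H (comul a)) := by
  conv_rhs => rw [← antipode_antipodeInv (K := K) a, comul_antipode]
  induction comul (R := K) (antipodeInv K a) with
  | zero => simp
  | tmul x y => simp only [comm_tmul, map_tmul, antipodeInv_antipode]
  | add x y hx hy => simp only [map_add, ← hx, ← hy]

theorem counit_antipodeInv (a : H) : counit (R := K) (antipodeInv K a) = counit (R := K) a := by
  conv_rhs => rw [← antipode_antipodeInv (K := K) a, counit_antipode]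

theorem coassoc_four (a : H) :
    TensorProduct.assoc K H H (H ⊗[K] H) (TensorProduct.map comul comul (comul (R := K) a)) =
      lTensor H (TensorProduct.assoc K H H H).toLinearMap
        (lTensor H (rTensor H comul) (lTensor H comul (comul a))) := by
  have : (TensorProduct.assoc K H H (H ⊗[K] H)).toLinearMap ∘ₗ
        (TensorProduct.map comul comul) ∘ₗ comul (R := K) (A := H) =
      lTensor H (TensorProduct.assoc K H H H).toLinearMap ∘ₗ lTensor H (rTensor H comul) ∘ₗ
        lTensor H comul ∘ₗ comul := by
    simp only [coassoc_simps]
  exact LinearMap.congr_fun this a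

end Antipode

section Double

open TensorProduct Coalgebra HopfAlgebra WithConv LinearMap

variable {K : Type v} {H : Type u} [Field K] [Ring H] [HopfAlgebra K H] [FiniteDimensional K H]

variable (K H)

/-- `a` acts on `H^*` by `f ↦ f(? a)`. -/
noncomputable def dualRightTranslation : H →ₐ[K] Module.End K (HopfDual K H) :=
  AlgHom.ofLinearMap (LinearMap.flip (LinearMap.mk₂ K
    (fun (f : HopfDual K H) (a : H) => toConv (f.ofConv ∘ₗ mulRight K a))
    (by intros; ext; simp) (by intros; ext; simp)
    (by intros; ext; simp [mul_add]) (by intros; ext; simp)))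
  (by ext; simp) (by intros; ext; simp [mul_assoc])

/-- `a` acts on `H^*` by `f ↦ f(S⁻¹(a) ?)`. -/
noncomputable def dualLeftTranslation : H →ₐ[K] Module.End K (HopfDual K H) :=
  AlgHom.ofLinearMap (LinearMap.flip (LinearMap.mk₂ K
    (fun (f : HopfDual K H) (a : H) => toConv (f.ofConv ∘ₗ mulLeft K (antipodeInv K a)))
    (by intros; ext; simp) (by intros; ext; simp)
    (by intros; ext; simp only [map_add, add_mul, LinearMap.comp_apply, mulLeft_apply, LinearMap.add_apply, WithConv.ofConv_add])
    (by intros; ext; simp only [map_smul, smul_mul_assoc, LinearMap.comp_apply, mulLeft_apply, LinearMap.smul_apply, WithConv.ofConv_smul])))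
  (by ext; simp [antipodeInv_one])
  (by intros; ext; simp [mul_assoc, antipodeInv_mul])

variable {K H}

@[simp] theorem dualRightTranslation_apply (a x : H) (f : HopfDual K H) :
    dualRightTranslation K H a f x = f (x * a) := rfl

@[simp] theorem dualLeftTranslation_apply (a x : H) (f : HopfDual K H) :
    dualLeftTranslation K H a f x = f (antipodeInv K a * x) := rfl

theorem dualTranslation_commute (a b : H) :
    Commute (dualRightTranslation K H a) (dualLeftTranslation K H b) := by
  ext f x
  simp [mul_assoc]

variable (K H)

/-- `X(a)`: `f ⊗ b ↦ f(? a) ⊗ b`. -/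
noncomputable def doubleX : H →ₐ[K] Module.End K (HopfDual K H ⊗[K] H) :=
  (Module.End.rTensorAlgHom K (HopfDual K H) H).comp (dualRightTranslation K H)

/-- `Y(a)`: `f ⊗ b ↦ f(S⁻¹(a) ?) ⊗ b`. -/
noncomputable def doubleY : H →ₐ[K] Module.End K (HopfDual K H ⊗[K] H) :=
  (Module.End.rTensorAlgHom K (HopfDual K H) H).comp (dualLeftTranslation K H)

/-- `Z(a)`: `f ⊗ b ↦ f ⊗ a b`. -/
noncomputable def doubleZ : H →ₐ[K] Module.End K (HopfDual K H ⊗[K] H) :=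
  (Module.End.lTensorAlgHom K H (HopfDual K H)).comp (Algebra.lmul K H)

variable {K H}

@[simp] theorem doubleX_tmul (a b : H) (f : HopfDual K H) :
    doubleX K H a (f ⊗ₜ b) = dualRightTranslation K H a f ⊗ₜ b := rfl

@[simp] theorem doubleY_tmul (a b : H) (f : HopfDual K H) :
    doubleY K H a (f ⊗ₜ b) = dualLeftTranslation K H a f ⊗ₜ b := rfl

@[simp] theorem doubleZ_tmul (a b : H) (f : HopfDual K H) :
    doubleZ K H a (f ⊗ₜ b) = f ⊗ₜ (a * b) := rfl

theorem doubleZ_commute_doubleY (a b : H) : Commute (doubleZ K H a) (doubleY K H b) :=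
  TensorProduct.ext' fun _ _ => rfl

theorem doubleX_commute_doubleZ (a b : H) : Commute (doubleX K H a) (doubleZ K H b) :=
  TensorProduct.ext' fun _ _ => rfl

theorem doubleX_commute_doubleY (a b : H) : Commute (doubleX K H a) (doubleY K H b) :=
  TensorProduct.ext' fun f c => congrArg (· ⊗ₜ[K] c)
    (LinearMap.congr_fun (dualTranslation_commute a b) f)

variable (K H)

/-- The action `a ↦ ∑ Z(a₁) Y(a₂)` of `H` on `H^* ⊗ H`. -/
noncomputable def doubleZY : H →ₐ[K] Module.End K (HopfDual K H ⊗[K] H) :=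
  (Algebra.TensorProduct.lift (doubleZ K H) (doubleY K H) doubleZ_commute_doubleY).comp
    (Bialgebra.comulAlgHom K H)

variable {K H}

theorem doubleZY_apply (a : H) : doubleZY K H a =
    Algebra.TensorProduct.lift (doubleZ K H) (doubleY K H) doubleZ_commute_doubleY (comul a) := rfl

theorem doubleX_commute_doubleZY (a b : H) : Commute (doubleX K H a) (doubleZY K H b) := by
  rw [doubleZY_apply]
  induction comul (R := K) b with
  | zero => simp
  | tmul c d =>
    rw [Algebra.TensorProduct.lift_tmul]
    exact (doubleX_commute_doubleZ a c).mul_right (doubleX_commute_doubleY a d)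
  | add c d hc hd => rw [map_add]; exact hc.add_right hd

variable (K H)

/-- The action `a ↦ ∑ X(a₁) Z(a₂) Y(a₃)` of `H` on `H^* ⊗ H`, that is,
`a · (g ⊗ b) = ∑ g(S⁻¹(a₃) ? a₁) ⊗ a₂ b`. -/
noncomputable def doubleXZY : H →ₐ[K] Module.End K (HopfDual K H ⊗[K] H) :=
  (Algebra.TensorProduct.lift (doubleX K H) (doubleZY K H) doubleX_commute_doubleZY).comp
    (Bialgebra.comulAlgHom K H)

/-- `F(f)`: `g ⊗ b ↦ (f * g) ⊗ b`. -/
noncomputable def doubleF : HopfDual K H →ₐ[K] Module.End K (HopfDual K H ⊗[K] H) :=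
  (Module.End.rTensorAlgHom K (HopfDual K H) H).comp (Algebra.lmul K (HopfDual K H))

/-- The multiplication of the Drinfeld double on `H^* ⊗ H`:
`(f ⊗ a) (g ⊗ b) = ∑ f * g(S⁻¹(a₃) ? a₁) ⊗ a₂ b`. -/
noncomputable def doubleMul : HopfDual K H ⊗[K] H →ₗ[K] Module.End K (HopfDual K H ⊗[K] H) :=
  LinearMap.mul' K _ ∘ₗ TensorProduct.map (doubleF K H).toLinearMap (doubleXZY K H).toLinearMap

variable {K H}

theorem doubleXZY_apply (a : H) : doubleXZY K H a =
    Algebra.TensorProduct.lift (doubleX K H) (doubleZY K H) doubleX_commute_doubleZY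
      (comul a) := rfl

@[simp] theorem doubleF_tmul (a : H) (f g : HopfDual K H) :
    doubleF K H f (g ⊗ₜ a) = (f * g) ⊗ₜ a := rfl

@[simp] theorem doubleMul_tmul (f : HopfDual K H) (a : H) :
    doubleMul K H (f ⊗ₜ a) = doubleF K H f * doubleXZY K H a := rfl

theorem dualRightTranslation_mul (a : H) (f g : HopfDual K H) :
    dualRightTranslation K H a (f * g) = mul' K _ (TensorProduct.map
      ((dualRightTranslation K H).toLinearMap.flip f) ((dualRightTranslation K H).toLinearMap.flip g) (comul a)) := by
  ext x
  simp only [dualRightTranslation_apply, convMul_apply, Bialgebra.comul_mul]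
  induction comul (R := K) a with
  | zero => simp
  | tmul b c =>
    simp only [map_tmul, mul'_apply, convMul_apply]
    induction comul (R := K) x with
    | zero => simp
    | tmul y z => simp
    | add y z hy hz => simp only [add_mul, map_add, hy, hz]
  | add b c hb hc => simp only [mul_add, map_add, hb, hc, WithConv.ofConv_add, LinearMap.add_apply]

theorem dualLeftTranslation_mul (a : H) (f g : HopfDual K H) :
    dualLeftTranslation K H a (f * g) = mul' K _ (TensorProduct.map
      ((dualLeftTranslation K H).toLinearMap.flip f) ((dualLeftTranslation K H).toLinearMap.flip g)
      (TensorProduct.comm K H H (comul a))) := by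
  ext x
  simp only [dualLeftTranslation_apply, convMul_apply, Bialgebra.comul_mul, comul_antipodeInv]
  induction comul (R := K) a with
  | zero => simp
  | tmul b c =>
    simp only [map_tmul, mul'_apply, convMul_apply, comm_tmul]
    induction comul (R := K) x with
    | zero => simp
    | tmul y z => simp
    | add y z hy hz => simp only [mul_add, map_add, hy, hz]
  | add b c hb hc => simp only [add_mul, map_add, hb, hc, WithConv.ofConv_add, LinearMap.add_apply]

/-- The map `(g, z) ↦ g(S⁻¹(z) ?)`. -/
noncomputable def dlT : HopfDual K H →ₗ[K] H →ₗ[K] HopfDual K H := (dualLeftTranslation K H).toLinearMap.flip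
/-- The map `(g, x) ↦ g(? x)`. -/
noncomputable def drT : HopfDual K H →ₗ[K] H →ₗ[K] HopfDual K H := (dualRightTranslation K H).toLinearMap.flip

theorem doubleX_mul_doubleF (a : H) (g : HopfDual K H) :
    doubleX K H a * doubleF K H g = mul' K _ (TensorProduct.map
      ((doubleF K H).toLinearMap ∘ₗ drT g) (doubleX K H).toLinearMap (comul a)) := by
  refine TensorProduct.ext' fun f b => ?_
  simp only [Module.End.mul_apply, doubleF_tmul, doubleX_tmul, dualRightTranslation_mul]
  induction comul (R := K) a with
  | zero => simp
  | tmul c d => simp [drT]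
  | add c d hc hd => simp only [map_add, add_tmul, LinearMap.add_apply, hc, hd]

theorem doubleY_mul_doubleF (a : H) (g : HopfDual K H) :
    doubleY K H a * doubleF K H g = mul' K _ (TensorProduct.map
      ((doubleF K H).toLinearMap ∘ₗ dlT g) (doubleY K H).toLinearMap
        (TensorProduct.comm K H H (comul a))) := by
  refine TensorProduct.ext' fun f b => ?_
  simp only [Module.End.mul_apply, doubleF_tmul, doubleY_tmul, dualLeftTranslation_mul]
  induction comul (R := K) a with
  | zero => simp
  | tmul c d => simp [dlT]
  | add c d hc hd => simp only [map_add, add_tmul, LinearMap.add_apply, hc, hd]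

theorem doubleZ_commute_doubleF (a : H) (g : HopfDual K H) :
    Commute (doubleZ K H a) (doubleF K H g) :=
  TensorProduct.ext' fun _ _ => rfl

set_option maxHeartbeats 800000 in
theorem doubleZY_mul_doubleF (a : H) (g : HopfDual K H) :
    doubleZY K H a * doubleF K H g = mul' K _ (TensorProduct.map
      ((doubleF K H).toLinearMap ∘ₗ dlT g) (doubleZY K H).toLinearMap
        (TensorProduct.comm K H H (comul a))) := by
  -- `x ⊗ (y ⊗ z) ↦ F (g(S⁻¹(z) ?)) Z(x) Y(y)`
  let Q : H ⊗[K] (H ⊗[K] H) →ₗ[K] Module.End K (HopfDual K H ⊗[K] H) :=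
    mul' K _ ∘ₗ TensorProduct.map ((doubleF K H).toLinearMap ∘ₗ dlT g)
      (mul' K _ ∘ₗ TensorProduct.map (doubleZ K H).toLinearMap (doubleY K H).toLinearMap) ∘ₗ
      (TensorProduct.comm K (H ⊗[K] H) H).toLinearMap ∘ₗ
      (TensorProduct.assoc K H H H).symm.toLinearMap
  have hQ : ∀ x y z, Q (x ⊗ₜ (y ⊗ₜ z)) =
    doubleF K H (dlT g z) * (doubleZ K H x * doubleY K H y) := fun x y z => rfl
  have h1 : Q (comul.lTensor H (comul a)) = doubleZY K H a * doubleF K H g := by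
    rw [doubleZY_apply]
    induction comul (R := K) a with
    | zero => simp
    | tmul c d =>
      rw [Algebra.TensorProduct.lift_tmul, mul_assoc, doubleY_mul_doubleF, lTensor_tmul]
      induction comul (R := K) d with
      | zero => simp
      | tmul x y =>
        simp only [hQ, map_tmul, mul'_apply, comm_tmul, LinearMap.comp_apply,
          AlgHom.toLinearMap_apply, ← mul_assoc, (doubleZ_commute_doubleF c _).eq]
      | add x y hx hy => simp only [tmul_add, map_add, mul_add, hx, hy]
    | add c d hc hd => simp only [map_add, add_mul, hc, hd]
  rw [← h1, ← coassoc_apply]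
  induction comul (R := K) a with
  | zero => simp
  | tmul c d =>
    simp only [rTensor_tmul, comm_tmul, map_tmul, mul'_apply, LinearMap.comp_apply,
      AlgHom.toLinearMap_apply, doubleZY_apply]
    induction comul (R := K) c with
    | zero => simp
    | tmul x y => simp [hQ]
    | add x y hx hy => simp only [add_tmul, map_add, mul_add, hx, hy]
  | add c d hc hd => simp only [map_add, hc, hd]

theorem doubleXZY_tmul (a b : H) (g : HopfDual K H) :
    doubleXZY K H a (g ⊗ₜ b) = lTensor _ (mulRight K b) (doubleXZY K H a (g ⊗ₜ 1)) := by
  rw [doubleXZY_apply]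
  induction comul (R := K) a with
  | zero => simp
  | tmul c d =>
    simp only [Algebra.TensorProduct.lift_tmul, doubleZY_apply]
    induction comul (R := K) d with
    | zero => simp
    | tmul x y => simp
    | add x y hx hy => simp only [map_add, mul_add, LinearMap.add_apply, hx, hy]
  | add c d hc hd => simp only [map_add, LinearMap.add_apply, hc, hd]

set_option maxHeartbeats 800000 in
theorem doubleXZY_mul_doubleF (a : H) (g : HopfDual K H) :
    doubleXZY K H a * doubleF K H g = doubleMul K H (doubleXZY K H a (g ⊗ₜ 1)) := by
  let Q : H ⊗[K] (H ⊗[K] (H ⊗[K] H)) →ₗ[K] Module.End K (HopfDual K H ⊗[K] H) :=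
    TensorProduct.lift (LinearMap.mk₂ K (fun x t =>
      mul' K _ (TensorProduct.map ((doubleF K H).toLinearMap ∘ₗ dualRightTranslation K H x ∘ₗ dlT g)
        (mul' K _ ∘ₗ TensorProduct.map (doubleX K H).toLinearMap (doubleZY K H).toLinearMap)
        (TensorProduct.comm K (H ⊗[K] H) H ((TensorProduct.assoc K H H H).symm t))))
      (by intros; simp [LinearMap.comp_add, LinearMap.add_comp, TensorProduct.map_add_left])
      (by intros; simp [LinearMap.comp_smul, LinearMap.smul_comp, TensorProduct.map_smul_left])
      (by intros; simp) (by intros; simp))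
  have hQ : ∀ x y z w, Q (x ⊗ₜ (y ⊗ₜ (z ⊗ₜ w))) =
    doubleF K H (dualRightTranslation K H x (dlT g w)) * (doubleX K H y * doubleZY K H z) :=
    fun x y z w => rfl
  have h1 : doubleXZY K H a * doubleF K H g =
      Q (TensorProduct.assoc K H H (H ⊗[K] H) (TensorProduct.map comul comul (comul a))) := by
    rw [doubleXZY_apply]
    induction comul (R := K) a with
    | zero => simp
    | tmul c d =>
      rw [Algebra.TensorProduct.lift_tmul, mul_assoc, doubleZY_mul_doubleF, map_tmul]
      induction comul (R := K) d with
      | zero => simp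
      | tmul z w =>
        simp only [comm_tmul, map_tmul, mul'_apply, LinearMap.comp_apply,
          AlgHom.toLinearMap_apply, ← mul_assoc, doubleX_mul_doubleF]
        induction comul (R := K) c with
        | zero => simp
        | tmul x y => simp [hQ, drT, mul_assoc]
        | add x y hx hy => simp only [add_tmul, map_add, add_mul, hx, hy]
      | add x y hx hy => simp only [tmul_add, map_add, mul_add, hx, hy]
    | add c d hc hd => simp only [map_add, add_mul, hc, hd]
  rw [h1, coassoc_four, doubleXZY_apply]
  induction comul (R := K) a with
  | zero => simp
  | tmul x d =>
    simp only [lTensor_tmul, Algebra.TensorProduct.lift_tmul, doubleZY_apply]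
    induction comul (R := K) d with
    | zero => simp
    | tmul c w =>
      simp only [rTensor_tmul, Algebra.TensorProduct.lift_tmul, Module.End.mul_apply,
        doubleY_tmul, doubleZ_tmul, doubleX_tmul, doubleMul_tmul, mul_one, doubleXZY_apply]
      induction comul (R := K) c with
      | zero => simp
      | tmul y z => simp [hQ, dlT]
      | add y z hy hz => simp only [add_tmul, tmul_add, map_add, mul_add, hy, hz]
    | add y z hy hz => simp only [tmul_add, map_add, mul_add, LinearMap.add_apply, hy, hz]
  | add c d hc hd => simp only [map_add, LinearMap.add_apply, hc, hd]

theorem doubleMul_doubleF (f : HopfDual K H) (v : HopfDual K H ⊗[K] H) :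
    doubleMul K H (doubleF K H f v) = doubleF K H f * doubleMul K H v := by
  induction v with
  | zero => simp
  | tmul g b => simp [mul_assoc]
  | add v w hv hw => simp only [map_add, mul_add, hv, hw]

theorem doubleMul_mulRight (b : H) (v : HopfDual K H ⊗[K] H) :
    doubleMul K H (lTensor _ (mulRight K b) v) = doubleMul K H v * doubleXZY K H b := by
  induction v with
  | zero => simp
  | tmul g c => simp [mul_assoc]
  | add v w hv hw => simp only [map_add, add_mul, hv, hw]

theorem doubleMul_doubleMul (v w : HopfDual K H ⊗[K] H) :
    doubleMul K H (doubleMul K H v w) = doubleMul K H v * doubleMul K H w := by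
  induction v with
  | zero => simp
  | tmul f a =>
    induction w with
    | zero => simp
    | tmul g b =>
      rw [doubleMul_tmul, doubleMul_tmul, Module.End.mul_apply, doubleMul_doubleF,
        doubleXZY_tmul, doubleMul_mulRight, ← doubleXZY_mul_doubleF]
      simp only [mul_assoc]
    | add v w hv hw => simp only [map_add, mul_add, hv, hw]
  | add v w hv hw => simp only [map_add, add_mul, LinearMap.add_apply, hv, hw]

theorem doubleMul_one : doubleMul K H (1 ⊗ₜ 1) = 1 := by simp

theorem doubleMul_apply_one (v : HopfDual K H ⊗[K] H) : doubleMul K H v (1 ⊗ₜ 1) = v := by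
  have hX : ∀ a : H, dualRightTranslation K H a 1 = counit (R := K) a • 1 := by
    intro a; ext x; simp [mul_comm]
  have hY : ∀ a : H, dualLeftTranslation K H a 1 = counit (R := K) a • 1 := by
    intro a; ext x; simp [counit_antipodeInv]
  have h : ∀ a : H, doubleXZY K H a (1 ⊗ₜ 1) = 1 ⊗ₜ a := by
    intro a
    have hzy : ∀ d : H, doubleZY K H d (1 ⊗ₜ 1) = 1 ⊗ₜ d := by
      intro d
      conv_rhs => rw [← (TensorProduct.rid K H).apply_symm_apply d, rid_symm_apply,
        ← lTensor_counit_comul]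
      rw [doubleZY_apply]
      induction comul (R := K) d with
      | zero => simp
      | tmul x y => simp [hY, smul_tmul]
      | add x y hx hy => simp only [map_add, tmul_add, LinearMap.add_apply, hx, hy]
    conv_rhs => rw [← (TensorProduct.lid K H).apply_symm_apply a, lid_symm_apply,
        ← rTensor_counit_comul]
    rw [doubleXZY_apply]
    induction comul (R := K) a with
    | zero => simp
    | tmul x y => simp [hX, hzy, smul_tmul]
    | add x y hx hy => simp only [map_add, tmul_add, LinearMap.add_apply, hx, hy]
  induction v with
  | zero => simp
  | tmul f a => simp [h]
  | add v w hv hw => simp only [map_add, LinearMap.add_apply, hv, hw]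

/-- The multiplication of the double in Sweedler notation. -/
theorem doubleMul_tmul_tmul {ι κ : Type*} (f g : HopfDual K H) (a b : H)
    (r : Coalgebra.Repr K a ι) (s : ∀ i, Coalgebra.Repr K (r.right i) κ) :
    doubleMul K H (f ⊗ₜ a) (g ⊗ₜ b) = ∑ i ∈ r.index, ∑ j ∈ (s i).index,
      (f * toConv (g.ofConv ∘ₗ mulLeft K (antipodeInv K ((s i).right j)) ∘ₗ
        mulRight K (r.left i))) ⊗ₜ ((s i).left j * b) := by
  rw [doubleMul_tmul, Module.End.mul_apply, doubleXZY_apply, ← r.eq]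
  simp only [map_sum, LinearMap.sum_apply, Algebra.TensorProduct.lift_tmul, doubleZY_apply]
  refine Finset.sum_congr rfl fun i _ => ?_
  rw [← (s i).eq]
  simp only [map_sum, LinearMap.sum_apply, Algebra.TensorProduct.lift_tmul, Finset.mul_sum]
  rfl

variable (K H) in
/-- The Drinfeld double `D(H)` of a finite-dimensional Hopf algebra `H`. Its underlying space is
`H^* ⊗ H`, where `f ⊗ a` stands for the product `f a`, and `H^*` and `H` are subalgebras; as a
coalgebra it would be `H^{*cop} ⊗ H`. -/
def DrinfeldDouble : Type (max u v) := HopfDual K H ⊗[K] H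

namespace DrinfeldDouble

noncomputable instance : AddCommGroup (DrinfeldDouble K H) :=
  inferInstanceAs (AddCommGroup (HopfDual K H ⊗[K] H))

noncomputable instance : Module K (DrinfeldDouble K H) :=
  inferInstanceAs (Module K (HopfDual K H ⊗[K] H))

variable (K H) in
/-- The identification of `D(H)` with `H^* ⊗ H` as vector spaces. -/
noncomputable def equivTensor : DrinfeldDouble K H ≃ₗ[K] HopfDual K H ⊗[K] H :=
  LinearEquiv.refl K (HopfDual K H ⊗[K] H)

noncomputable instance : Ring (DrinfeldDouble K H) where
  mul v w := (equivTensor K H).symm (doubleMul K H (equivTensor K H v) (equivTensor K H w))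
  one := (equivTensor K H).symm (1 ⊗ₜ 1)
  mul_assoc u v w := LinearMap.congr_fun
    (doubleMul_doubleMul (equivTensor K H u) (equivTensor K H v)) (equivTensor K H w)
  one_mul v := LinearMap.congr_fun (doubleMul_one (K := K) (H := H)) (equivTensor K H v)
  mul_one v := doubleMul_apply_one (equivTensor K H v)
  left_distrib u v w := (doubleMul K H (equivTensor K H u)).map_add _ _
  right_distrib u v w := LinearMap.congr_fun
    ((doubleMul K H).map_add (equivTensor K H u) (equivTensor K H v)) (equivTensor K H w)
  zero_mul v := LinearMap.congr_fun (doubleMul K H).map_zero (equivTensor K H v)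
  mul_zero v := (doubleMul K H (equivTensor K H v)).map_zero
  zsmul := zsmulRec
  neg_add_cancel := neg_add_cancel

theorem mul_def (v w : DrinfeldDouble K H) : v * w =
    (equivTensor K H).symm (doubleMul K H (equivTensor K H v) (equivTensor K H w)) := rfl

theorem one_def : (1 : DrinfeldDouble K H) = (equivTensor K H).symm (1 ⊗ₜ 1) := rfl

noncomputable instance : Algebra K (DrinfeldDouble K H) :=
  Algebra.ofModule
    (fun r v w => LinearMap.congr_fun ((doubleMul K H).map_smul r v) (equivTensor K H w))
    (fun r v w => (doubleMul K H (equivTensor K H v)).map_smul r w)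

variable (K H) in
/-- The inclusion of `H` into `D(H)`. -/
noncomputable def ofHopf : H →ₗ[K] DrinfeldDouble K H :=
  (equivTensor K H).symm.toLinearMap ∘ₗ TensorProduct.mk K (HopfDual K H) H 1

variable (K H) in
/-- The inclusion of `H^*` into `D(H)`. -/
noncomputable def ofDual : HopfDual K H →ₗ[K] DrinfeldDouble K H :=
  (equivTensor K H).symm.toLinearMap ∘ₗ (TensorProduct.mk K (HopfDual K H) H).flip 1

theorem ofDual_mul_ofHopf (f : HopfDual K H) (a : H) :
    ofDual K H f * ofHopf K H a = (equivTensor K H).symm (f ⊗ₜ a) := by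
  change doubleMul K H (f ⊗ₜ 1) (1 ⊗ₜ a) = f ⊗ₜ a
  simp

variable (K H) in
/-- The antipode of `H^{*cop}`, `f ↦ f ∘ S⁻¹`. -/
noncomputable def dualAntipodeInv : HopfDual K H →ₗ[K] HopfDual K H where
  toFun f := toConv (f.ofConv ∘ₗ antipodeInv K)
  map_add' _ _ := rfl
  map_smul' _ _ := rfl

variable (K H) in
/-- The antipode of `D(H)`: the antimultiplicative map given by `S` on `H` and by
`f ↦ f ∘ S⁻¹` on `H^{*cop}`, so that `f a ↦ S(a) (f ∘ S⁻¹)`. -/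
noncomputable def antipode : DrinfeldDouble K H →ₗ[K] DrinfeldDouble K H :=
  LinearMap.mul' K (DrinfeldDouble K H) ∘ₗ
    TensorProduct.map (ofHopf K H ∘ₗ HopfAlgebra.antipode K) (ofDual K H ∘ₗ dualAntipodeInv K H) ∘ₗ
    (TensorProduct.comm K (HopfDual K H) H).toLinearMap ∘ₗ (equivTensor K H).toLinearMap

theorem antipode_ofDual_mul_ofHopf (f : HopfDual K H) (a : H) :
    antipode K H (ofDual K H f * ofHopf K H a) =
      ofHopf K H (HopfAlgebra.antipode K a) * ofDual K H (dualAntipodeInv K H f) := by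
  rw [ofDual_mul_ofHopf]; rfl

variable (K H) in
/-- The universal `R`-matrix `R = ∑ hᵢ ⊗ hᵢ^*` of `D(H)`, where `hᵢ` and `hᵢ^*` are dual bases
of `H` and `H^*`. -/
noncomputable def rMatrix : DrinfeldDouble K H ⊗[K] DrinfeldDouble K H :=
  ∑ i, ofHopf K H (Module.finBasis K H i) ⊗ₜ ofDual K H (cobasis i)

variable (K H) in
/-- The Drinfeld element `u = ∑ S(bᵢ) aᵢ` of `D(H)`, where `R = ∑ aᵢ ⊗ bᵢ`. -/
noncomputable def drinfeldElement : DrinfeldDouble K H :=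
  LinearMap.mul' K (DrinfeldDouble K H) (TensorProduct.map (antipode K H) LinearMap.id
    (TensorProduct.comm K _ _ (rMatrix K H)))

theorem drinfeldElement_eq : drinfeldElement K H =
    ∑ i, antipode K H (ofDual K H (cobasis i)) * ofHopf K H (Module.finBasis K H i) := by
  simp [drinfeldElement, rMatrix]

end DrinfeldDouble

end Double

section Rep

open TensorProduct Coalgebra LinearMap CategoryTheory MonoidalCategory

section Action

variable {K : Type v} {H : Type u} [Field K] [Ring H] [Bialgebra K H]
  {U V W V' W' : Type v} [AddCommGroup U] [Module K U] [AddCommGroup V] [Module K V]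
  [AddCommGroup W] [Module K W] [AddCommGroup V'] [Module K V'] [AddCommGroup W'] [Module K W']
  (ρU : H →ₐ[K] Module.End K U) (ρV : H →ₐ[K] Module.End K V) (ρW : H →ₐ[K] Module.End K W)
  (ρV' : H →ₐ[K] Module.End K V') (ρW' : H →ₐ[K] Module.End K W')

/-- The action of `H ⊗ H` on `V ⊗ W`. -/
noncomputable def tensorAct : H ⊗[K] H →ₐ[K] Module.End K (V ⊗[K] W) :=
  (Module.endTensorEndAlgHom (R := K) (S := K) (A := K)).comp
    (Algebra.TensorProduct.map ρV ρW)

@[simp] theorem tensorAct_tmul (b c : H) :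
    tensorAct ρV ρW (b ⊗ₜ c) = TensorProduct.map (ρV b) (ρW c) := rfl

/-- The action of `H` on `V ⊗ W`: `a` acts by `∑ a₁ ⊗ a₂`. -/
noncomputable def tensorAction : H →ₐ[K] Module.End K (V ⊗[K] W) :=
  (tensorAct ρV ρW).comp (Bialgebra.comulAlgHom K H)

theorem tensorAction_apply (a : H) : tensorAction ρV ρW a = tensorAct ρV ρW (comul a) := rfl

variable (K H) in
/-- The trivial action of `H` on `K`: `a` acts by the scalar `ε(a)`. -/
noncomputable def trivialAction : H →ₐ[K] Module.End K K :=
  (Algebra.ofId K (Module.End K K)).comp (Bialgebra.counitAlgHom K H)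

theorem trivialAction_apply (a : H) (x : K) :
    trivialAction K H a x = counit (R := K) a * x := rfl

variable {ρV ρW ρV' ρW'} in
theorem map_comp_tensorAction {f : V →ₗ[K] V'} {g : W →ₗ[K] W'}
    (hf : ∀ a, f ∘ₗ ρV a = ρV' a ∘ₗ f) (hg : ∀ a, g ∘ₗ ρW a = ρW' a ∘ₗ g) (a : H) :
    TensorProduct.map f g ∘ₗ tensorAction ρV ρW a =
      tensorAction ρV' ρW' a ∘ₗ TensorProduct.map f g := by
  rw [tensorAction_apply, tensorAction_apply]
  induction comul (R := K) a with
  | zero => simp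
  | tmul b c =>
    rw [tensorAct_tmul, tensorAct_tmul, ← TensorProduct.map_comp, ← TensorProduct.map_comp,
      hf, hg]
  | add b c hb hc => simp only [map_add, comp_add, add_comp, hb, hc]

theorem assoc_tensorAction (a : H) (x : (U ⊗[K] V) ⊗[K] W) :
    TensorProduct.assoc K U V W (tensorAction (tensorAction ρU ρV) ρW a x) =
      tensorAction ρU (tensorAction ρV ρW) a (TensorProduct.assoc K U V W x) := by
  -- the action of `H ⊗ (H ⊗ H)` on `U ⊗ (V ⊗ W)`
  let Q : H ⊗[K] (H ⊗[K] H) →ₐ[K] Module.End K (U ⊗[K] (V ⊗[K] W)) :=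
    (Module.endTensorEndAlgHom (R := K) (S := K) (A := K)).comp
      (Algebra.TensorProduct.map ρU (tensorAct ρV ρW))
  have h2 : tensorAction ρU (tensorAction ρV ρW) a = Q (comul.lTensor H (comul a)) := by
    rw [tensorAction_apply]
    induction comul (R := K) a with
    | zero => simp
    | tmul b c => rfl
    | add b c hb hc => simp only [map_add, hb, hc]
  have h3 : (TensorProduct.assoc K U V W).toLinearMap ∘ₗ
      tensorAction (tensorAction ρU ρV) ρW a =
      Q (TensorProduct.assoc K _ _ _ (comul.rTensor H (comul a))) ∘ₗ
        (TensorProduct.assoc K U V W).toLinearMap := by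
    rw [tensorAction_apply]
    induction comul (R := K) a with
    | zero => simp
    | tmul b d =>
      rw [rTensor_tmul, tensorAct_tmul, tensorAction_apply]
      induction comul (R := K) b with
      | zero => simp
      | tmul b c => exact TensorProduct.ext_threefold fun u v w => rfl
      | add b c hb hc =>
        simp only [add_tmul, map_add, TensorProduct.map_add_left, comp_add, add_comp, hb, hc]
    | add b c hb hc => simp only [map_add, comp_add, add_comp, hb, hc]
  rw [h2, ← coassoc_apply]
  exact LinearMap.congr_fun h3 x

theorem lid_tensorAction (a : H) (x : K ⊗[K] V) :
    TensorProduct.lid K V (tensorAction (trivialAction K H) ρV a x) =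
      ρV a (TensorProduct.lid K V x) := by
  have h : (TensorProduct.lid K V).toLinearMap ∘ₗ tensorAction (trivialAction K H) ρV a =
      ρV (TensorProduct.lid K H (counit.rTensor H (comul a))) ∘ₗ
        (TensorProduct.lid K V).toLinearMap := by
    rw [tensorAction_apply]
    induction comul (R := K) a with
    | zero => simp
    | tmul b c =>
      exact TensorProduct.ext' fun u v => by simp [trivialAction_apply, mul_smul]
    | add b c hb hc => simp only [map_add, comp_add, add_comp, hb, hc]
  rw [rTensor_counit_comul] at h
  simpa using LinearMap.congr_fun h x

theorem rid_tensorAction (a : H) (x : V ⊗[K] K) :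
    TensorProduct.rid K V (tensorAction ρV (trivialAction K H) a x) =
      ρV a (TensorProduct.rid K V x) := by
  have h : (TensorProduct.rid K V).toLinearMap ∘ₗ tensorAction ρV (trivialAction K H) a =
      ρV (TensorProduct.rid K H (counit.lTensor H (comul a))) ∘ₗ
        (TensorProduct.rid K V).toLinearMap := by
    rw [tensorAction_apply]
    induction comul (R := K) a with
    | zero => simp
    | tmul b c =>
      exact TensorProduct.ext' fun u v => by simp [trivialAction_apply, mul_smul]
    | add b c hb hc => simp only [map_add, comp_add, add_comp, hb, hc]
  rw [lTensor_counit_comul] at h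
  simpa using LinearMap.congr_fun h x

end Action

variable (K : Type v) (H : Type u) [Field K] [Ring H] [Bialgebra K H]

/-- A finite-dimensional representation of `H`: an object of `Rep(H)`. -/
structure HopfRep where
  carrier : Type v
  [addCommGroup : AddCommGroup carrier]
  [module : Module K carrier]
  [finiteDimensional : FiniteDimensional K carrier]
  ρ : H →ₐ[K] Module.End K carrier

attribute [instance] HopfRep.addCommGroup HopfRep.module HopfRep.finiteDimensional

namespace HopfRep

variable {K H}

/-- A morphism of representations: a linear map that commutes with the action of `H`. -/
@[ext]
structure Hom (V W : HopfRep K H) where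
  toLinearMap : V.carrier →ₗ[K] W.carrier
  comm : ∀ a : H, toLinearMap ∘ₗ V.ρ a = W.ρ a ∘ₗ toLinearMap

instance : Category (HopfRep K H) where
  Hom := Hom
  id V := ⟨LinearMap.id, fun _ => rfl⟩
  comp f g := ⟨g.toLinearMap ∘ₗ f.toLinearMap, fun a => by
    rw [LinearMap.comp_assoc, f.comm, ← LinearMap.comp_assoc, g.comm, LinearMap.comp_assoc]⟩

@[ext] theorem hom_ext {V W : HopfRep K H} {f g : V ⟶ W} (h : f.toLinearMap = g.toLinearMap) :
    f = g := Hom.ext h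

@[simp] theorem id_toLinearMap (V : HopfRep K H) : Hom.toLinearMap (𝟙 V) = LinearMap.id := rfl

@[simp] theorem comp_toLinearMap {U V W : HopfRep K H} (f : U ⟶ V) (g : V ⟶ W) :
    (f ≫ g).toLinearMap = g.toLinearMap ∘ₗ f.toLinearMap := rfl

section Preadditive

variable {V W : HopfRep K H}

instance : Zero (V ⟶ W) := ⟨⟨0, fun _ => by simp⟩⟩
instance : Add (V ⟶ W) := ⟨fun f g => ⟨f.toLinearMap + g.toLinearMap, fun a => by
  rw [add_comp, comp_add, f.comm, g.comm]⟩⟩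
instance : Neg (V ⟶ W) := ⟨fun f => ⟨-f.toLinearMap, fun a => by
  rw [neg_comp, comp_neg, f.comm]⟩⟩
instance : Sub (V ⟶ W) := ⟨fun f g => ⟨f.toLinearMap - g.toLinearMap, fun a => by
  rw [sub_comp, comp_sub, f.comm, g.comm]⟩⟩
instance : SMul ℕ (V ⟶ W) := ⟨fun n f => ⟨n • f.toLinearMap, fun a => by
  rw [smul_comp, comp_smul, f.comm]⟩⟩
instance : SMul ℤ (V ⟶ W) := ⟨fun n f => ⟨n • f.toLinearMap, fun a => by
  rw [smul_comp, comp_smul, f.comm]⟩⟩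

@[simp] theorem zero_toLinearMap : Hom.toLinearMap (0 : V ⟶ W) = 0 := rfl
@[simp] theorem add_toLinearMap (f g : V ⟶ W) :
    (f + g).toLinearMap = f.toLinearMap + g.toLinearMap := rfl

instance : AddCommGroup (V ⟶ W) :=
  Function.Injective.addCommGroup (fun f : V ⟶ W => f.toLinearMap) (fun _ _ h => hom_ext h)
    rfl (fun _ _ => rfl) (fun _ => rfl) (fun _ _ => rfl) (fun _ _ => rfl) (fun _ _ => rfl)

instance : Preadditive (HopfRep K H) where
  add_comp _ _ _ _ _ _ := hom_ext (LinearMap.comp_add _ _ _)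
  comp_add _ _ _ _ _ _ := hom_ext (LinearMap.add_comp _ _ _)

end Preadditive

/-- An `H`-equivariant linear equivalence is an isomorphism of representations. -/
def mkIso {V W : HopfRep K H} (e : V.carrier ≃ₗ[K] W.carrier)
    (h : ∀ a x, e (V.ρ a x) = W.ρ a (e x)) : V ≅ W where
  hom := ⟨e.toLinearMap, fun a => LinearMap.ext fun x => h a x⟩
  inv := ⟨e.symm.toLinearMap, fun a => LinearMap.ext fun x => by
    apply e.injective
    simp [h]⟩
  hom_inv_id := hom_ext (LinearMap.ext fun x => e.symm_apply_apply x)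
  inv_hom_id := hom_ext (LinearMap.ext fun x => e.apply_symm_apply x)

/-- Tensor product of representations. -/
noncomputable def tensorRep (V W : HopfRep K H) : HopfRep K H where
  carrier := V.carrier ⊗[K] W.carrier
  ρ := tensorAction V.ρ W.ρ

/-- The trivial one-dimensional representation. -/
noncomputable def unitRep : HopfRep K H where
  carrier := K
  ρ := trivialAction K H

/-- Tensor product of morphisms of representations. -/
noncomputable def tensorMap {V V' W W' : HopfRep K H} (f : V ⟶ V') (g : W ⟶ W') :
    tensorRep V W ⟶ tensorRep V' W' where
  toLinearMap := TensorProduct.map f.toLinearMap g.toLinearMap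
  comm := map_comp_tensorAction f.comm g.comm

noncomputable instance : MonoidalCategoryStruct (HopfRep K H) where
  tensorObj := tensorRep
  tensorUnit := unitRep
  tensorHom := tensorMap
  whiskerLeft V _ _ f := tensorMap (𝟙 V) f
  whiskerRight f V := tensorMap f (𝟙 V)
  associator U V W := mkIso (TensorProduct.assoc K _ _ _) (assoc_tensorAction U.ρ V.ρ W.ρ)
  leftUnitor V := mkIso (TensorProduct.lid K _) (lid_tensorAction V.ρ)
  rightUnitor V := mkIso (TensorProduct.rid K _) (rid_tensorAction V.ρ)

noncomputable instance : MonoidalCategory (HopfRep K H) := MonoidalCategory.ofTensorHom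
  (id_tensorHom_id := fun _ _ => hom_ext TensorProduct.map_id)
  (id_tensorHom := fun _ _ _ _ => rfl)
  (tensorHom_id := fun _ _ => rfl)
  (tensorHom_comp_tensorHom := fun _ _ _ _ => hom_ext (TensorProduct.map_comp _ _ _ _).symm)
  (associator_naturality := fun _ _ _ => hom_ext (TensorProduct.ext_threefold fun _ _ _ => rfl))
  (leftUnitor_naturality := fun f => hom_ext (TensorProduct.ext' fun x y => (f.toLinearMap.map_smul (x : K) y).symm))
  (rightUnitor_naturality := fun f => hom_ext (TensorProduct.ext' fun x y => (f.toLinearMap.map_smul (y : K) x).symm))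
  (pentagon := fun _ _ _ _ => hom_ext (TensorProduct.ext_fourfold fun _ _ _ _ => rfl))
  (triangle := fun _ _ => hom_ext (TensorProduct.ext_threefold
    fun x (r : K) y => (TensorProduct.smul_tmul r x y).symm))

instance : MonoidalPreadditive (HopfRep K H) where
  whiskerLeft_zero := hom_ext (TensorProduct.map_zero_right _)
  zero_whiskerRight := hom_ext (TensorProduct.map_zero_left _)
  whiskerLeft_add _ _ := hom_ext (TensorProduct.map_add_right _ _ _)
  add_whiskerRight _ _ := hom_ext (TensorProduct.map_add_left _ _ _)

end HopfRep

end Rep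

section Center

open CategoryTheory MonoidalCategory

variable {C : Type u} [Category.{v} C] [Preadditive C] [MonoidalCategory C] [MonoidalPreadditive C]

instance (X Y : Center C) : Zero (X ⟶ Y) := ⟨⟨0, fun U => by simp⟩⟩
instance (X Y : Center C) : Add (X ⟶ Y) := ⟨fun f g => ⟨f.f + g.f, fun U => by simp⟩⟩
instance (X Y : Center C) : Neg (X ⟶ Y) := ⟨fun f => ⟨-f.f, fun U => by
  have h1 := (tensorRight U).map_neg (f := f.f)
  have h2 := (tensorLeft U).map_neg (f := f.f)
  dsimp at h1 h2; rw [h1, h2]; simp⟩⟩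
instance (X Y : Center C) : Sub (X ⟶ Y) := ⟨fun f g => ⟨f.f - g.f, fun U => by
  have h1 := (tensorRight U).map_sub (f := f.f) (g := g.f)
  have h2 := (tensorLeft U).map_sub (f := f.f) (g := g.f)
  dsimp at h1 h2; rw [h1, h2]; simp⟩⟩
instance (X Y : Center C) : SMul ℕ (X ⟶ Y) := ⟨fun n f => ⟨n • f.f, fun U => by
  have h1 := (tensorRight U).map_nsmul (f := f.f) (n := n)
  have h2 := (tensorLeft U).map_nsmul (f := f.f) (n := n)
  dsimp at h1 h2; rw [h1, h2]; simp⟩⟩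
instance (X Y : Center C) : SMul ℤ (X ⟶ Y) := ⟨fun n f => ⟨n • f.f, fun U => by
  have h1 := (tensorRight U).map_zsmul (f := f.f) (r := n)
  have h2 := (tensorLeft U).map_zsmul (f := f.f) (r := n)
  dsimp at h1 h2; rw [h1, h2]; simp⟩⟩

instance centerHomAddCommGroup (X Y : Center C) : AddCommGroup (X ⟶ Y) :=
  Function.Injective.addCommGroup (fun f : X ⟶ Y => f.f) (fun _ _ h => Center.ext _ _ h)
    rfl (fun _ _ => rfl) (fun _ => rfl) (fun _ _ => rfl) (fun _ _ => rfl) (fun _ _ => rfl)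

instance centerPreadditive : Preadditive (Center C) where
  add_comp _ _ _ _ _ _ := Center.ext _ _ (Preadditive.add_comp _ _ _ _ _ _)
  comp_add _ _ _ _ _ _ := Center.ext _ _ (Preadditive.comp_add _ _ _ _ _ _)

/-- The double braiding `β² = β_{Y,X} ∘ β_{X,Y}` of `X ⊗ Y`. -/
def doubleBraiding {D : Type u} [Category.{v} D] [MonoidalCategory D] [BraidedCategory D]
    (X Y : D) : End (X ⊗ Y) :=
  End.of ((β_ X Y).hom ≫ (β_ Y X).hom)

end Center

/-- An element `x` of a ring is unipotent if `x - 1` is nilpotent. -/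
def IsUnipotent {R : Type u} [Ring R] (x : R) : Prop := IsNilpotent (x - 1)

/-- `N` is the quasi-exponent of the tensor category `C`: the smallest positive integer such that
`(β²)^N` is unipotent on `X ⊗ Y` for all objects `X`, `Y` of the Drinfeld center of `C`. -/
def IsQuasiExponent (C : Type u) [CategoryTheory.Category.{v} C] [CategoryTheory.Preadditive C]
    [CategoryTheory.MonoidalCategory C] [CategoryTheory.MonoidalPreadditive C] (N : ℕ) : Prop :=
  IsLeast {n : ℕ | 0 < n ∧
    ∀ X Y : CategoryTheory.Center C, IsUnipotent (doubleBraiding X Y ^ n)} N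

/-- `N` is the quasi-exponent of the finite-dimensional Hopf algebra `H`: the smallest positive
integer such that `u^N` is unipotent, where `u` is the Drinfeld element of `D(H)`. -/
def IsHopfQuasiExponent (K : Type v) (H : Type u) [Field K] [Ring H] [HopfAlgebra K H]
    [FiniteDimensional K H] (N : ℕ) : Prop :=
  IsLeast {n : ℕ | 0 < n ∧ IsUnipotent (DrinfeldDouble.drinfeldElement K H ^ n)} N

end HopfQuasi

/-! Write `u` for the Drinfeld element of `D(H)` and `M = R₂₁ R` for its monodromy element
(`monodromy`). Both quasi-exponents are compared with `M`: for each `n`, all `n`-th powers of double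
braidings are unipotent iff `Mⁿ` is unipotent iff `uⁿ` is unipotent. A separate argument shows that
some positive power of `u` is unipotent, so the common minimum exists.

Categorical side. A half-braiding is natural, hence determined by its value on the regular
representation, hence given by an element of `H ⊗ End(V)`. The hexagon axiom and `H`-linearity say
that the inverse of this element satisfies the relations of the canonical element `∑ hᵢ ⊗ hᵢ^*`,
which are the relations presenting `D(H)` (`IsDoublePair`). So objects of the center come from
`D(H)`-modules (`exists_isCenterObject`), and conversely (`toCenter`). The double braiding is then
the inverse of the action of `M`; testing on the regular `D(H)`-module, which is faithful, gives
`forall_isUnipotent_doubleBraiding_pow_iff`.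

Algebraic side. In a finite-dimensional quasitriangular Hopf algebra `Δ(u) M = u ⊗ u`
(`comul_drinfeld_mul`), and `M` commutes with every coproduct. If `uⁿ` is unipotent, then `Mⁿ =
Δ(u⁻ⁿ)(uⁿ ⊗ uⁿ)` is a product of commuting unipotents. Conversely, let `Mⁿ` be unipotent and let `s
= p(uⁿ)` be the semisimple part of `uⁿ`. Then `Δ(s)` and `s ⊗ s` are both the semisimple part of `uⁿ
⊗ uⁿ`, so they agree (`exists_isGroupLikeElem_aeval`). In `D(H) = H^* ⊗ H` an element is recovered
from its coproduct by the projections `f a ↦ ε(a) f` and `f a ↦ f(1) a` (`map_toDual_toHopf_comul`),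
and both projections send all powers of `u` to `1`. Hence `s` is the scalar `p(1)²`, the counit
forces `s = 1`, and `uⁿ` is unipotent (`isUnipotent_drinfeldElement_pow_iff`).

Existence. The element `u S(u)⁻¹` is group-like, so of finite order, while `S(u) u` is central;
hence a power `uᵏ` is central. Tensoring any module with the regular one gives a free module, and
comparing determinants through `Δ(u) M = u ⊗ u` and the hexagon relations yields `det ρ(u) ^ d² = 1`
for every module `ρ`, where `d` is the dimension of the algebra (`det_drinfeld_pow`). Applied to the
eigenspaces of `uᵏ` in the regular module, this makes all eigenvalues of `uᵏ` roots of unity of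
bounded order.

All of this requires `D(H)` to be a quasitriangular Hopf algebra. Its coproduct and counit are
obtained from its presentation by pairs, and identities are checked on `H` and on the canonical
element (`algHom_ext`, `isQuasitriangular_rMatrix`). -/

namespace HopfQuasi

open TensorProduct Coalgebra HopfAlgebra LinearMap

/-! ### Evaluating tensors along algebra homomorphisms. -/

section Ev

variable {K : Type*} [Field K] {A B E : Type*} [Ring A] [Algebra K A] [Ring B] [Algebra K B]
  [Semiring E] [Algebra K E]

/-- The linear map `a ⊗ b ↦ p(a) q(b)`. -/
noncomputable def ev (p : A →ₐ[K] E) (q : B →ₐ[K] E) : A ⊗[K] B →ₗ[K] E :=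
  LinearMap.mul' K E ∘ₗ TensorProduct.map p.toLinearMap q.toLinearMap

@[simp] theorem ev_tmul (p : A →ₐ[K] E) (q : B →ₐ[K] E) (a : A) (b : B) :
    ev p q (a ⊗ₜ b) = p a * q b := rfl

variable (K A B) in
/-- The homomorphism `a ↦ a ⊗ 1`. -/
noncomputable abbrev inl : A →ₐ[K] A ⊗[K] B := Algebra.TensorProduct.includeLeft

variable (K A B) in
/-- The homomorphism `b ↦ 1 ⊗ b`. -/
noncomputable abbrev inr : B →ₐ[K] A ⊗[K] B := Algebra.TensorProduct.includeRight

/-- Two algebra homomorphisms have commuting images. -/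
abbrev Comm (p : A →ₐ[K] E) (q : B →ₐ[K] E) : Prop := ∀ a b, Commute (p a) (q b)

theorem Comm.symm {p : A →ₐ[K] E} {q : B →ₐ[K] E} (h : Comm p q) : Comm q p :=
  fun a b => (h b a).symm

theorem Comm.comp_left {C : Type*} [Ring C] [Algebra K C] {p : A →ₐ[K] E} {q : B →ₐ[K] E}
    (h : Comm p q) (f : C →ₐ[K] A) : Comm (p.comp f) q := fun a b => h (f a) b

theorem Comm.comp_right {C : Type*} [Ring C] [Algebra K C] {p : A →ₐ[K] E} {q : B →ₐ[K] E}
    (h : Comm p q) (f : C →ₐ[K] B) : Comm p (q.comp f) := fun a b => h a (f b)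

theorem Comm.map {F : Type*} [Semiring F] [Algebra K F] {p : A →ₐ[K] E} {q : B →ₐ[K] E}
    (h : Comm p q) (f : E →ₐ[K] F) : Comm (f.comp p) (f.comp q) := fun a b => (h a b).map f

/-- `ev` carries no proof of commutation, so its arguments can be rewritten freely; `lift` supplies
the multiplicativity. -/
theorem lift_eq_ev {p : A →ₐ[K] E} {q : B →ₐ[K] E} (h : Comm p q) (t : A ⊗[K] B) :
    Algebra.TensorProduct.lift p q h t = ev p q t := by
  induction t with
  | zero => simp
  | tmul a b => rw [Algebra.TensorProduct.lift_tmul, ev_tmul]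
  | add a b ha hb => simp only [map_add, ha, hb]

theorem ev_mul {p : A →ₐ[K] E} {q : B →ₐ[K] E} (h : Comm p q) (s t : A ⊗[K] B) :
    ev p q (s * t) = ev p q s * ev p q t := by
  simp only [← lift_eq_ev h, map_mul]

@[simp] theorem ev_one (p : A →ₐ[K] E) (q : B →ₐ[K] E) : ev p q 1 = 1 := by
  rw [Algebra.TensorProduct.one_def]; simp

theorem ev_comm {p : A →ₐ[K] E} {q : B →ₐ[K] E} (h : Comm p q) (t : A ⊗[K] B) :
    ev q p (TensorProduct.comm K A B t) = ev p q t := by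
  induction t with
  | zero => simp
  | tmul a b => simpa using (h a b).symm.eq
  | add a b ha hb => simp only [map_add, ha, hb]

theorem algHom_ev {F : Type*} [Semiring F] [Algebra K F] (f : E →ₐ[K] F) (p : A →ₐ[K] E)
    (q : B →ₐ[K] E) (t : A ⊗[K] B) : f (ev p q t) = ev (f.comp p) (f.comp q) t := by
  induction t with
  | zero => simp
  | tmul a b => simp
  | add a b ha hb => simp only [map_add, ha, hb]

theorem ev_map {A' B' : Type*} [Ring A'] [Algebra K A'] [Ring B'] [Algebra K B']
    (p : A →ₐ[K] E) (q : B →ₐ[K] E) (f : A' →ₐ[K] A) (g : B' →ₐ[K] B) (t : A' ⊗[K] B') :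
    ev p q (Algebra.TensorProduct.map f g t) = ev (p.comp f) (q.comp g) t := by
  induction t with
  | zero => simp
  | tmul a b => simp
  | add a b ha hb => simp only [map_add, ha, hb]

theorem Comm.commute_ev {C : Type*} [Ring C] [Algebra K C] {p : A →ₐ[K] E} {q : B →ₐ[K] E}
    {r : C →ₐ[K] E} (hp : Comm p r) (hq : Comm q r) (t : A ⊗[K] B) (c : C) :
    Commute (ev p q t) (r c) := by
  induction t with
  | zero => simp
  | tmul a b => exact (hp a c).mul_left (hq b c)
  | add a b ha hb => rw [map_add]; exact ha.add_left hb

theorem Comm.commute_ev_ev {C D : Type*} [Ring C] [Algebra K C] [Ring D] [Algebra K D]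
    {p : A →ₐ[K] E} {q : B →ₐ[K] E} {r : C →ₐ[K] E} {s : D →ₐ[K] E}
    (hpr : Comm p r) (hqr : Comm q r) (hps : Comm p s) (hqs : Comm q s)
    (t : A ⊗[K] B) (t' : C ⊗[K] D) : Commute (ev p q t) (ev r s t') := by
  induction t' with
  | zero => simp
  | tmul a b => exact (hpr.commute_ev hqr t a).mul_right (hps.commute_ev hqs t b)
  | add a b ha hb => rw [map_add]; exact ha.add_right hb

theorem ev_inl_inr (t : A ⊗[K] B) :
    ev (inl K A B) (inr K A B) t = t := by
  induction t with
  | zero => simp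
  | tmul a b => simp
  | add a b ha hb => simp only [map_add, ha, hb]

theorem comm_inl_inr :
    Comm (inl K A B) (inr K A B) := fun a b => by
  simp [Commute, SemiconjBy]

end Ev

/-! ### Convolution of algebra homomorphisms with commuting images. -/

section Star

variable {K : Type*} [Field K] {A E : Type*} [Ring A] [Bialgebra K A] [Semiring E] [Algebra K E]

/-- The convolution `x ↦ ∑ p(x₁) q(x₂)` of algebra homomorphisms with commuting images. -/
noncomputable def star (p q : A →ₐ[K] E) (h : Comm p q) : A →ₐ[K] E :=
  (Algebra.TensorProduct.lift p q h).comp (Bialgebra.comulAlgHom K A)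

theorem star_apply {p q : A →ₐ[K] E} (h : Comm p q) (x : A) :
    star p q h x = ev p q (comul x) := lift_eq_ev h _

theorem Comm.star_left {B : Type*} [Ring B] [Algebra K B] {p q : A →ₐ[K] E} {r : B →ₐ[K] E}
    (h : Comm p q) (hp : Comm p r) (hq : Comm q r) : Comm (star p q h) r := fun a b => by
  rw [star_apply]; exact hp.commute_ev hq _ _

theorem Comm.star_right {B : Type*} [Ring B] [Algebra K B] {p q : A →ₐ[K] E} {r : B →ₐ[K] E}
    (h : Comm p q) (hp : Comm r p) (hq : Comm r q) : Comm r (star p q h) :=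
  (h.star_left hp.symm hq.symm).symm

/-- By coassociativity both sides send `x` to `∑ p(x₁) q(x₂) r(x₃)`. -/
theorem star_assoc {p q r : A →ₐ[K] E} (hpq : Comm p q) (hpr : Comm p r) (hqr : Comm q r) :
    star (star p q hpq) r (hpq.star_left hpr hqr) =
      star p (star q r hqr) (hqr.star_right hpq hpr) := by
  ext x
  have h1 : ∀ t : A ⊗[K] A, ev (star p q hpq) r t =
      (LinearMap.mul' K E ∘ₗ TensorProduct.map p.toLinearMap (ev q r))
        (TensorProduct.assoc K A A A (comul.rTensor A t)) := by
    intro t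
    induction t with
    | zero => simp
    | tmul a b =>
      rw [ev_tmul, star_apply, rTensor_tmul]
      induction comul (R := K) a with
      | zero => simp
      | tmul c d => simp [mul_assoc]
      | add c d hc hd => simp only [map_add, add_tmul, add_mul, hc, hd]
    | add a b ha hb => simp only [map_add, ha, hb]
  have h2 : ∀ t : A ⊗[K] A, ev p (star q r hqr) t =
      (LinearMap.mul' K E ∘ₗ TensorProduct.map p.toLinearMap (ev q r)) (comul.lTensor A t) := by
    intro t
    induction t with
    | zero => simp
    | tmul a b => simp [star_apply]
    | add a b ha hb => simp only [map_add, ha, hb]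
  rw [star_apply, star_apply, h1, h2, coassoc_apply]

end Star

/-! ### Antipode axioms for `S⁻¹`. -/

section AntipodeInv

variable {K : Type*} [Field K] {A : Type*} [Ring A] [HopfAlgebra K A] [FiniteDimensional K A]

/-- The injective antihomomorphism `S` turns `∑ S⁻¹(b₂) b₁` into `∑ S(b₁) b₂`. -/
theorem mul_antipodeInv_rTensor_comm_comul (b : A) :
    mul' K A ((antipodeInv K).rTensor A (TensorProduct.comm K A A (comul b))) =
      algebraMap K A (counit b) := by
  apply antipode_injective (K := K)
  rw [Algebra.algebraMap_eq_smul_one, map_smul, antipode_one, ← Algebra.algebraMap_eq_smul_one,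
    ← mul_antipode_rTensor_comul_apply (R := K) b]
  induction comul (R := K) b with
  | zero => simp
  | tmul c d => simp [antipode_mul_antidistrib]
  | add c d hc hd => simp only [map_add, hc, hd]

theorem mul_antipodeInv_lTensor_comm_comul (b : A) :
    mul' K A ((antipodeInv K).lTensor A (TensorProduct.comm K A A (comul b))) =
      algebraMap K A (counit b) := by
  apply antipode_injective (K := K)
  rw [Algebra.algebraMap_eq_smul_one, map_smul, antipode_one, ← Algebra.algebraMap_eq_smul_one,
    ← mul_antipode_lTensor_comul_apply (R := K) b]
  induction comul (R := K) b with
  | zero => simp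
  | tmul c d => simp [antipode_mul_antidistrib]
  | add c d hc hd => simp only [map_add, hc, hd]

end AntipodeInv

/-! ### Universal `R`-matrices: hexagon relations, Yang–Baxter equation, inverses. -/

section Quasitriangular

variable {K : Type*} [Field K] {A : Type*} [Ring A] [HopfAlgebra K A]

/-- `R` is a universal `R`-matrix of the Hopf algebra `A`. -/
structure IsQuasitriangular (R : A ⊗[K] A) : Prop where
  counit_left : TensorProduct.lid K A (counit.rTensor A R) = 1
  counit_right : TensorProduct.rid K A (counit.lTensor A R) = 1
  comul_left : Algebra.TensorProduct.map (Bialgebra.comulAlgHom K A) (AlgHom.id K A) R =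
    Algebra.TensorProduct.map (inl K A A) (AlgHom.id K A) R *
      Algebra.TensorProduct.map (inr K A A) (AlgHom.id K A) R
  comul_right : Algebra.TensorProduct.map (AlgHom.id K A) (Bialgebra.comulAlgHom K A) R =
    Algebra.TensorProduct.map (AlgHom.id K A) (inr K A A) R *
      Algebra.TensorProduct.map (AlgHom.id K A) (inl K A A) R
  mul_comul : ∀ x : A, R * comul x = TensorProduct.comm K A A (comul x) * R

namespace IsQuasitriangular

variable {R : A ⊗[K] A} (hR : IsQuasitriangular R) {E : Type*} [Semiring E] [Algebra K E]
  {p q r : A →ₐ[K] E}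

include hR

/-- The hexagon relation `(Δ ⊗ id)(R) = R₁₃ R₂₃` read in an arbitrary algebra containing three
commuting images of `A`; this avoids triple tensor products later. -/
theorem ev_star_left (hpq : Comm p q) (hpr : Comm p r) (hqr : Comm q r) :
    ev (star p q hpq) r R = ev p r R * ev q r R := by
  have hc : Comm (Algebra.TensorProduct.lift p q hpq) r := fun a b => by
    rw [lift_eq_ev]; exact hpr.commute_ev hqr a b
  have := congrArg (ev (Algebra.TensorProduct.lift p q hpq) r) hR.comul_left
  rw [ev_mul hc, ev_map, ev_map, ev_map] at this
  refine this.trans ?_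
  congr 2 <;> ext <;> simp

theorem ev_star_right (hpq : Comm p q) (hpr : Comm p r) (hqr : Comm q r) :
    ev p (star q r hqr) R = ev p r R * ev p q R := by
  have hc : Comm p (Algebra.TensorProduct.lift q r hqr) := fun a b => by
    rw [lift_eq_ev]; exact (hpq.symm.commute_ev hpr.symm b a).symm
  have := congrArg (ev p (Algebra.TensorProduct.lift q r hqr)) hR.comul_right
  rw [ev_mul hc, ev_map, ev_map, ev_map] at this
  refine this.trans ?_
  congr 2 <;> ext <;> simp

theorem ev_mul_star (hpq : Comm p q) (x : A) :
    ev p q R * star p q hpq x = star q p hpq.symm x * ev p q R := by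
  have := congrArg (ev p q) (hR.mul_comul x)
  rw [ev_mul hpq, ev_mul hpq] at this
  rw [star_apply, star_apply, this, ← ev_comm hpq.symm]

/-- Conjugation by `R₁₂` turns `(Δ ⊗ id)(R)` into `(Δᵒᵖ ⊗ id)(R)`; the hexagon relation expands both
into products of two factors. -/
theorem yangBaxter (hpq : Comm p q) (hpr : Comm p r) (hqr : Comm q r) :
    ev p q R * ev p r R * ev q r R = ev q r R * ev p r R * ev p q R := by
  rw [mul_assoc, ← hR.ev_star_left hpq hpr hqr, ← hR.ev_star_left hpq.symm hqr hpr]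
  have : ∀ t : A ⊗[K] A, ev p q R * ev (star p q hpq) r t =
      ev (star q p hpq.symm) r t * ev p q R := by
    intro t
    induction t with
    | zero => simp
    | tmul a b =>
      rw [ev_tmul, ev_tmul, ← mul_assoc, hR.ev_mul_star, mul_assoc, mul_assoc,
        (hpr.commute_ev hqr R b).eq]
    | add a b ha hb => simp only [map_add, add_mul, mul_add, ha, hb]
  exact this R

/-- Apply `a ⊗ b ⊗ c ↦ a S(b) ⊗ c` to `(Δ ⊗ id)(R) = R₁₃ R₂₃`. -/
theorem mul_antipode_left : R * (antipode K).rTensor A R = 1 := by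
  let Q : (A ⊗[K] A) ⊗[K] A →ₗ[K] A ⊗[K] A :=
    (LinearMap.mul' K A ∘ₗ (antipode K).lTensor A).rTensor A
  have h1 := congrArg Q hR.comul_left
  have h2 : ∀ t : A ⊗[K] A, Q (Algebra.TensorProduct.map (Bialgebra.comulAlgHom K A)
      (AlgHom.id K A) t) = 1 ⊗ₜ TensorProduct.lid K A (counit.rTensor A t) := by
    intro t
    induction t with
    | zero => simp
    | tmul a b => simp [Q, Algebra.algebraMap_eq_smul_one, TensorProduct.smul_tmul]
    | add a b ha hb => simp only [map_add, ha, hb, tmul_add]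
  have h3 : ∀ s t : A ⊗[K] A, Q (
    Algebra.TensorProduct.map (inl K A A) (AlgHom.id K A) s *
      Algebra.TensorProduct.map (inr K A A) (AlgHom.id K A) t) =
      s * (antipode K).rTensor A t := by
    intro s t
    induction s with
    | zero => simp
    | tmul a b =>
      induction t with
      | zero => simp
      | tmul c d => simp [Q]
      | add c d hc hd => simp only [map_add, mul_add, hc, hd]
    | add a b ha hb => simp only [map_add, add_mul, ha, hb]
  rw [h2, h3, hR.counit_left] at h1
  exact h1.symm

variable [FiniteDimensional K A]

/-- Apply `a ⊗ b ⊗ c ↦ a ⊗ S⁻¹(c) b` to `(id ⊗ Δ)(R) = R₁₃ R₁₂`. -/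
theorem antipodeInv_right_mul : (antipodeInv K).lTensor A R * R = 1 := by
  let Q : A ⊗[K] (A ⊗[K] A) →ₗ[K] A ⊗[K] A :=
    (LinearMap.mul' K A ∘ₗ (antipodeInv K).rTensor A ∘ₗ
      (TensorProduct.comm K A A).toLinearMap).lTensor A
  have h1 := congrArg Q hR.comul_right
  have h2 : ∀ t : A ⊗[K] A, Q (Algebra.TensorProduct.map (AlgHom.id K A)
      (Bialgebra.comulAlgHom K A) t) = TensorProduct.rid K A (counit.lTensor A t) ⊗ₜ 1 := by
    intro t
    induction t with
    | zero => simp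
    | tmul a b =>
      have := mul_antipodeInv_rTensor_comm_comul (K := K) b
      simp only [Q, Algebra.TensorProduct.map_tmul, lTensor_tmul, LinearMap.comp_apply,
        LinearEquiv.coe_coe, Bialgebra.comulAlgHom_apply, this]
      simp [Algebra.algebraMap_eq_smul_one, TensorProduct.smul_tmul]
    | add a b ha hb => simp only [map_add, ha, hb, add_tmul]
  have h3 : ∀ s t : A ⊗[K] A, Q (
    Algebra.TensorProduct.map (AlgHom.id K A) (inr K A A) s *
      Algebra.TensorProduct.map (AlgHom.id K A) (inl K A A) t) =
      (antipodeInv K).lTensor A s * t := by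
    intro s t
    induction s with
    | zero => simp
    | tmul a b =>
      induction t with
      | zero => simp
      | tmul c d => simp [Q]
      | add c d hc hd => simp only [map_add, mul_add, hc, hd]
    | add a b ha hb => simp only [map_add, add_mul, ha, hb]
  rw [h2, h3, hR.counit_right] at h1
  exact h1.symm

/-- One side is a right inverse of `R`, the other a left inverse. -/
theorem antipode_rTensor_eq : (antipode K).rTensor A R = (antipodeInv K).lTensor A R :=
  (left_inv_eq_right_inv hR.antipodeInv_right_mul hR.mul_antipode_left).symm

theorem map_antipode_antipode : TensorProduct.map (antipode K) (antipode K) R = R := by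
  have h := congrArg ((antipode K).lTensor A) hR.antipode_rTensor_eq
  have h1 : ∀ t : A ⊗[K] A, (antipode K).lTensor A ((antipodeInv K).lTensor A t) = t := by
    intro t
    induction t with
    | zero => simp
    | tmul a b => simp
    | add a b ha hb => simp only [map_add, ha, hb]
  have h2 : ∀ t : A ⊗[K] A, (antipode K).lTensor A ((antipode K).rTensor A t) =
      TensorProduct.map (antipode K) (antipode K) t := by
    intro t
    induction t with
    | zero => simp
    | tmul a b => simp
    | add a b ha hb => simp only [map_add, ha, hb]
  rw [h1, h2] at h
  exact h

end IsQuasitriangular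

end Quasitriangular

end HopfQuasi

namespace HopfQuasi

open TensorProduct Coalgebra HopfAlgebra LinearMap

/-! ### The Drinfeld element implements the square of the antipode. -/

section DrinfeldElement

variable {K : Type*} [Field K] {A : Type*} [Ring A] [HopfAlgebra K A]

variable (K A) in
/-- The linear map `a ⊗ b ↦ S(b) a`. -/
noncomputable def drinfeldMap : A ⊗[K] A →ₗ[K] A :=
  LinearMap.mul' K A ∘ₗ TensorProduct.map (antipode K) LinearMap.id ∘ₗ
    (TensorProduct.comm K A A).toLinearMap

@[simp] theorem drinfeldMap_tmul (a b : A) : drinfeldMap K A (a ⊗ₜ b) = antipode K b * a := rfl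

theorem drinfeldMap_mul_tmul (s : A ⊗[K] A) (c d : A) :
    drinfeldMap K A (s * (c ⊗ₜ d)) = antipode K d * drinfeldMap K A s * c := by
  induction s with
  | zero => simp
  | tmul a b => simp [antipode_mul_antidistrib, mul_assoc]
  | add a b ha hb => simp only [add_mul, mul_add, map_add, ha, hb]

/-- `∑ S(x₁ b) x₂ a = S(b) (∑ S(x₁) x₂) a`. -/
theorem drinfeldMap_comm_comul_mul (s : A ⊗[K] A) (x : A) :
    drinfeldMap K A (TensorProduct.comm K A A (comul x) * s) =
      counit (R := K) x • drinfeldMap K A s := by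
  induction s with
  | zero => simp
  | tmul a b =>
    have h := congrArg (fun z => antipode K b * z * a)
      (mul_antipode_rTensor_comul_apply (R := K) x)
    simp only [Algebra.algebraMap_eq_smul_one, mul_smul_comm, mul_one, smul_mul_assoc] at h
    rw [drinfeldMap_tmul, ← h]
    induction comul (R := K) x with
    | zero => simp
    | tmul c d => simp [antipode_mul_antidistrib, mul_assoc]
    | add c d hc hd => simp only [add_mul, mul_add, map_add, hc, hd]
  | add a b ha hb => simp only [mul_add, map_add, ha, hb, smul_add]

/-- Left multiplication by `antipode (antipode ·)` undoes right multiplication by a coproduct. -/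
theorem sum_antipode_sq_mul_drinfeldMap (s : A ⊗[K] A) (x : A) :
    TensorProduct.lift (LinearMap.mk₂ K (fun y z =>
      antipode K (antipode K z) * drinfeldMap K A (s * comul y))
        (by intros; simp [mul_add]) (by intros; simp) (by intros; simp [add_mul])
        (by intros; simp)) (comul x) = drinfeldMap K A s * x := by
  -- With `m` for `drinfeldMap`, `m(s Δ(x₁)) = S(x₂) m(s) x₁` after relabelling, so the sum is `∑
  -- S²(x₃) S(x₂) m(s) x₁`. `G` groups the first two factors as `S(x₂ S(x₃))`, which collapses to a
  -- counit.
  let G : A ⊗[K] (A ⊗[K] A) →ₗ[K] A := TensorProduct.lift (LinearMap.mk₂ K (fun y t =>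
      antipode K (mul' K A ((antipode K).lTensor A t)) * drinfeldMap K A s * y)
        (by intros; simp [mul_add]) (by intros; simp) (by intros; simp [add_mul])
        (by intros; simp))
  have hG : ∀ y c d, G (y ⊗ₜ (c ⊗ₜ d)) = antipode K (c * antipode K d) * drinfeldMap K A s * y :=
    fun _ _ _ => rfl
  have h1 : ∀ t : A ⊗[K] A, TensorProduct.lift (LinearMap.mk₂ K (fun y z =>
      antipode K (antipode K z) * drinfeldMap K A (s * comul y))
        (by intros; simp [mul_add]) (by intros; simp) (by intros; simp [add_mul])
        (by intros; simp)) t = G (TensorProduct.assoc K A A A (comul.rTensor A t)) := by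
    intro t
    induction t with
    | zero => simp
    | tmul y z =>
      rw [lift.tmul, mk₂_apply, rTensor_tmul]
      induction comul (R := K) y with
      | zero => simp
      | tmul c d => simp [hG, drinfeldMap_mul_tmul, antipode_mul_antidistrib, mul_assoc]
      | add c d hc hd => simp only [add_mul, mul_add, map_add, hc, hd, add_tmul]
    | add y z hy hz => simp only [map_add, hy, hz]
  rw [h1, coassoc_apply]
  have h2 : ∀ t : A ⊗[K] A, G (comul.lTensor A t) =
      drinfeldMap K A s * TensorProduct.rid K A (counit.lTensor A t) := by
    intro t
    induction t with
    | zero => simp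
    | tmul y z =>
      have : ∀ t, G (y ⊗ₜ t) = antipode K (mul' K A ((antipode K).lTensor A t)) *
        drinfeldMap K A s * y := fun _ => rfl
      rw [lTensor_tmul, this, mul_antipode_lTensor_comul_apply]
      simp [Algebra.algebraMap_eq_smul_one]
    | add y z hy hz => simp only [map_add, hy, hz, mul_add]
  rw [h2]
  simp

namespace IsQuasitriangular

variable {R : A ⊗[K] A} (hR : IsQuasitriangular R)

include hR

/-- In the previous identity with `s = R`, the axiom `R Δ(y) = Δᵒᵖ(y) R` makes the inner factor
`ε(y) u`, leaving `S²(x) u = u x`. -/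
theorem antipode_sq_mul (x : A) :
    antipode K (antipode K x) * drinfeldMap K A R = drinfeldMap K A R * x := by
  rw [← sum_antipode_sq_mul_drinfeldMap]
  have h : ∀ t : A ⊗[K] A, TensorProduct.lift (LinearMap.mk₂ K (fun y z =>
      antipode K (antipode K z) * drinfeldMap K A (R * comul y))
        (by intros; simp [mul_add]) (by intros; simp) (by intros; simp [add_mul])
        (by intros; simp)) t = antipode K (antipode K (TensorProduct.lid K A
          (counit.rTensor A t))) * drinfeldMap K A R := by
    intro t
    induction t with
    | zero => simp
    | tmul y z => simp [hR.mul_comul, drinfeldMap_comm_comul_mul]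
    | add y z hy hz => simp only [map_add, hy, hz, add_mul]
  rw [h]
  simp

theorem counit_drinfeld : counit (R := K) (drinfeldMap K A R) = 1 := by
  have h : ∀ t : A ⊗[K] A, counit (R := K) (drinfeldMap K A t) =
      counit (R := K) (TensorProduct.lid K A (counit.rTensor A t)) := by
    intro t
    induction t with
    | zero => simp
    | tmul y z => simp [mul_comm]
    | add y z hy hz => simp only [map_add, hy, hz]
  rw [h, hR.counit_left, Bialgebra.counit_one]

variable [FiniteDimensional K A]

/-- The relation `S²(d) u = u d` turns `u · ∑ S⁻¹(d) c` into `drinfeldMap (R t)` for `t = ∑ c ⊗ d`.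
Taking `t = R⁻¹ = (S ⊗ id)(R)` gives a right inverse, which suffices in an Artinian ring. -/
theorem isUnit_drinfeld : IsUnit (drinfeldMap K A R) := by
  have h : ∀ t : A ⊗[K] A, drinfeldMap K A R * mul' K A (TensorProduct.map (antipodeInv K)
      LinearMap.id (TensorProduct.comm K A A t)) = drinfeldMap K A (R * t) := by
    intro t
    induction t with
    | zero => simp
    | tmul c d =>
      rw [drinfeldMap_mul_tmul, comm_tmul, map_tmul, mul'_apply, ← mul_assoc, ← hR.antipode_sq_mul]
      simp
    | add y z hy hz => simp only [map_add, hy, hz, mul_add]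
  have h1 := h ((antipode K).rTensor A R)
  rw [hR.mul_antipode_left, Algebra.TensorProduct.one_def, drinfeldMap_tmul, antipode_one,
    mul_one] at h1
  have : IsArtinianRing A := IsArtinianRing.of_finite K A
  exact .of_mul_eq_one _ h1

theorem antipode_mul_drinfeld (x : A) :
    antipode K x * drinfeldMap K A R = drinfeldMap K A R * antipodeInv K x := by
  simpa using hR.antipode_sq_mul (antipodeInv K x)

end IsQuasitriangular

end DrinfeldElement

/-! ### The coproduct of the Drinfeld element. -/

section RightAction

open MulOpposite

variable (K : Type*) [Field K] (B : Type*) [Ring B] [Algebra K B]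

/-- Right multiplication as a homomorphism to the opposite of the endomorphism algebra. -/
noncomputable def rightMul : B →ₐ[K] (Module.End K B)ᵐᵒᵖ :=
  AlgHom.ofLinearMap ((opLinearEquiv K).toLinearMap ∘ₗ (LinearMap.mul K B).flip)
    (congrArg op (by ext; simp)) (fun _ _ => congrArg op (by ext; simp [mul_assoc]))

@[simp] theorem rightMul_apply (b z : B) : (rightMul K B b).unop z = z * b := rfl

variable {A : Type*} [Ring A] [HopfAlgebra K A] {K B}

/-- Left multiplication by `f (S(b))`, as a homomorphism to the opposite of the endomorphism
algebra. -/
noncomputable def leftMulAntipode (f : A →ₐ[K] B) : A →ₐ[K] (Module.End K B)ᵐᵒᵖ :=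
  AlgHom.ofLinearMap ((opLinearEquiv K).toLinearMap ∘ₗ LinearMap.mul K B ∘ₗ f.toLinearMap ∘ₗ
      antipode K)
    (congrArg op (by ext; simp))
    (fun _ _ => congrArg op (by ext; simp [mul_assoc, antipode_mul_antidistrib]))

@[simp] theorem leftMulAntipode_apply (f : A →ₐ[K] B) (b : A) (z : B) :
    (leftMulAntipode f b).unop z = f (antipode K b) * z := rfl

theorem unop_ext {x y : (Module.End K B)ᵐᵒᵖ} (h : ∀ z, x.unop z = y.unop z) : x = y :=
  unop_injective (LinearMap.ext h)

end RightAction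

section ComulDrinfeld

variable {K : Type*} [Field K] {A : Type*} [Ring A] [HopfAlgebra K A]
  {R : A ⊗[K] A} (hR : IsQuasitriangular R)

/-- The monodromy element `R₂₁ R`. -/
noncomputable def monodromy (R : A ⊗[K] A) : A ⊗[K] A := TensorProduct.comm K A A R * R

theorem comm_mul (s t : A ⊗[K] A) : TensorProduct.comm K A A (s * t) =
    TensorProduct.comm K A A s * TensorProduct.comm K A A t :=
  map_mul (Algebra.TensorProduct.comm K A A) s t

theorem comm_comm (s : A ⊗[K] A) : TensorProduct.comm K A A (TensorProduct.comm K A A s) = s :=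
  (TensorProduct.comm K A A).symm_apply_apply s

namespace IsQuasitriangular

include hR

/-- `R` carries `Δ(x)` to `Δᵒᵖ(x)`, and `R₂₁` carries it back. -/
theorem monodromy_commute (x : A) : Commute (monodromy R) (comul x) := by
  have h := congrArg (TensorProduct.comm K A A) (hR.mul_comul x)
  rw [comm_mul, comm_mul, comm_comm] at h
  rw [monodromy, Commute, SemiconjBy, mul_assoc, hR.mul_comul, ← mul_assoc, h, mul_assoc]

variable [FiniteDimensional K A]

set_option maxHeartbeats 1000000 in
-- `A ⊗ A` carries four commuting actions of `A`, by right multiplications and by left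
-- multiplications through `S`, except that the two right multiplications need separate tensor legs.
-- Evaluating `R` on pairs of these actions and rearranging by Yang–Baxter, two groups of factors
-- act trivially and the remaining one produces `u ⊗ u`.
theorem comul_drinfeld_mul : comul (drinfeldMap K A R) * monodromy R =
    drinfeldMap K A R ⊗ₜ drinfeldMap K A R := by
  -- The target is the opposite of the endomorphism algebra, so that a product acts by its left
  -- factor first.
  let j1 := (rightMul K (A ⊗[K] A)).comp (inl K A A)
  let j2 := (rightMul K (A ⊗[K] A)).comp (inr K A A)
  let j3 := leftMulAntipode (inl K A A)
  let j4 := leftMulAntipode (inr K A A)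
  have a1 : ∀ a z, (j1 a).unop z = z * (a ⊗ₜ 1) := fun _ _ => rfl
  have a2 : ∀ a z, (j2 a).unop z = z * (1 ⊗ₜ a) := fun _ _ => rfl
  have a3 : ∀ a z, (j3 a).unop z = (antipode K a ⊗ₜ 1) * z := fun _ _ => rfl
  have a4 : ∀ a z, (j4 a).unop z = (1 ⊗ₜ antipode K a) * z := fun _ _ => rfl
  have c12 : Comm j1 j2 := fun a b => unop_ext fun z => by simp [a1, a2, mul_assoc]
  have c43 : Comm j4 j3 := fun a b => unop_ext fun z => by simp [a3, a4, ← mul_assoc]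
  have c13 : Comm j1 j3 := fun a b => unop_ext fun z => by simp [a1, a3, ← mul_assoc]
  have c14 : Comm j1 j4 := fun a b => unop_ext fun z => by simp [a1, a4, ← mul_assoc]
  have c23 : Comm j2 j3 := fun a b => unop_ext fun z => by simp [a2, a3, ← mul_assoc]
  have c24 : Comm j2 j4 := fun a b => unop_ext fun z => by simp [a2, a4, ← mul_assoc]
  have e12 : ∀ t z, (ev j1 j2 t).unop z = z * t := by
    intro t z
    induction t with
    | zero => simp
    | tmul a b => simp [a1, a2, mul_assoc]
    | add a b ha hb => simp only [map_add, MulOpposite.unop_add, LinearMap.add_apply, mul_add, ha, hb]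
  have e21 : ∀ t z, (ev j2 j1 t).unop z = z * TensorProduct.comm K A A t := by
    intro t z
    rw [← e12, ← ev_comm c12.symm]
  -- the action of `Δ(a) ⊗ Δ^{op}(b)` is `z ↦ Δ(S(b)) z Δ(a)`
  have e1243 : ∀ t z, (∀ x, Commute z (comul (R := K) x)) →
      (ev (star j1 j2 c12) (star j4 j3 c43) t).unop z = comul (drinfeldMap K A t) * z := by
    intro t z hz
    have h43 : ∀ b z, (star j4 j3 c43 b).unop z = comul (R := K) (antipode K b) * z := by
      intro b z
      rw [star_apply, comul_antipode]
      induction comul (R := K) b with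
      | zero => simp
      | tmul a b => simp [a3, a4, ← mul_assoc]
      | add a b ha hb => simp only [map_add, MulOpposite.unop_add, LinearMap.add_apply, add_mul, ha, hb]
    induction t with
    | zero => simp
    | tmul a b =>
      rw [ev_tmul, MulOpposite.unop_mul, Module.End.mul_apply, h43, star_apply, e12, (hz a).eq]
      simp [mul_assoc]
    | add a b ha hb => simp only [map_add, MulOpposite.unop_add, LinearMap.add_apply, add_mul, ha, hb]
  -- The first factor sends `1` to `R₂₁`; the second cancels it by `(id ⊗ S⁻¹)(R) R = 1`.
  have e2123 : (ev j2 j1 R * ev j2 j3 R).unop 1 = 1 := by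
    rw [MulOpposite.unop_mul, Module.End.mul_apply, e21, one_mul]
    have h : ∀ s t : A ⊗[K] A, (ev j2 j3 t).unop (TensorProduct.comm K A A s) =
        TensorProduct.comm K A A ((antipode K).lTensor A ((antipodeInv K).lTensor A s * t)) := by
      intro s t
      induction s with
      | zero => simp
      | tmul a b =>
        induction t with
        | zero => simp
        | tmul c d => simp [a2, a3, antipode_mul_antidistrib]
        | add a b ha hb => simp only [map_add, MulOpposite.unop_add, LinearMap.add_apply, mul_add, ha, hb]
      | add a b ha hb => simp only [map_add, MulOpposite.unop_add, add_mul, ha, hb]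
    rw [h, hR.antipodeInv_right_mul]
    simp [Algebra.TensorProduct.one_def]
  have e1324 : (ev j1 j3 R * ev j2 j4 R).unop 1 = drinfeldMap K A R ⊗ₜ drinfeldMap K A R := by
    rw [MulOpposite.unop_mul, Module.End.mul_apply]
    have h13 : ∀ t, (ev j1 j3 t).unop 1 = drinfeldMap K A t ⊗ₜ 1 := by
      intro t
      induction t with
      | zero => simp
      | tmul c d => simp [a1, a3]
      | add a b ha hb => simp only [map_add, MulOpposite.unop_add, LinearMap.add_apply, add_tmul, ha, hb]
    have h24 : ∀ t y, (ev j2 j4 t).unop (y ⊗ₜ 1) = y ⊗ₜ drinfeldMap K A t := by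
      intro t y
      induction t with
      | zero => simp
      | tmul c d => simp [a2, a4]
      | add a b ha hb => simp only [map_add, MulOpposite.unop_add, LinearMap.add_apply, tmul_add, ha, hb]
    rw [h13, h24]
  -- Moving `S(d)` through `u` turns it into `S⁻¹(d)`, and then `(id ⊗ S⁻¹)(R) R = 1` cancels the
  -- two factors.
  have e1412 : (ev j1 j4 R * ev j1 j2 R).unop (drinfeldMap K A R ⊗ₜ drinfeldMap K A R) =
      drinfeldMap K A R ⊗ₜ drinfeldMap K A R := by
    rw [MulOpposite.unop_mul, Module.End.mul_apply, e12]
    have h : ∀ t, (ev j1 j4 t).unop (drinfeldMap K A R ⊗ₜ drinfeldMap K A R) =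
        (drinfeldMap K A R ⊗ₜ drinfeldMap K A R) * (antipodeInv K).lTensor A t := by
      intro t
      induction t with
      | zero => simp
      | tmul c d => simp [a1, a4, hR.antipode_mul_drinfeld]
      | add a b ha hb => simp only [map_add, MulOpposite.unop_add, LinearMap.add_apply, mul_add, ha, hb]
    rw [h, mul_assoc, hR.antipodeInv_right_mul, mul_one]
  -- The two hexagon relations expand the last factor into `R₁₃ R₁₄ R₂₃ R₂₄`. The middle factors
  -- commute, and Yang–Baxter, first for the legs `1, 2, 3` and then for `1, 2, 4`, moves `R₁₂` to
  -- the right end.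
  have key : ev j2 j1 R * ev j1 j2 R * ev (star j1 j2 c12) (star j4 j3 c43) R =
      (ev j2 j1 R * ev j2 j3 R) * ((ev j1 j3 R * ev j2 j4 R) * (ev j1 j4 R * ev j1 j2 R)) := by
    have y1 := hR.yangBaxter c12 c13 c23
    have y2 := hR.yangBaxter c12 c14 c24
    have y3 : Commute (ev j1 j4 R) (ev j2 j3 R) :=
      Comm.commute_ev_ev c12 c24.symm c13 c43 R R
    rw [hR.ev_star_left c12 (c43.star_right c14 c13) (c43.star_right c24 c23),
      hR.ev_star_right c14 c13 c43, hR.ev_star_right c24 c23 c43]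
    calc _ = ev j2 j1 R * (ev j1 j2 R * ev j1 j3 R * (ev j1 j4 R * ev j2 j3 R) * ev j2 j4 R) := by
          simp only [mul_assoc]
      _ = ev j2 j1 R * ((ev j1 j2 R * ev j1 j3 R * ev j2 j3 R) * (ev j1 j4 R * ev j2 j4 R)) := by
          rw [y3.eq]; simp only [mul_assoc]
      _ = ev j2 j1 R * (ev j2 j3 R * ev j1 j3 R * (ev j1 j2 R * ev j1 j4 R * ev j2 j4 R)) := by
          rw [y1]; simp only [mul_assoc]
      _ = _ := by rw [y2]; simp only [mul_assoc]
  have := congrArg (fun x => x.unop 1) key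
  simp only [MulOpposite.unop_mul (ev j2 j1 R * ev j2 j3 R),
    MulOpposite.unop_mul (ev j1 j3 R * ev j2 j4 R), Module.End.mul_apply, e2123, e1324, e1412] at this
  rw [← this, MulOpposite.unop_mul, Module.End.mul_apply, e1243, MulOpposite.unop_mul,
    Module.End.mul_apply, e21, e12, one_mul]
  · rfl
  · intro x
    rw [MulOpposite.unop_mul, Module.End.mul_apply, e21, e12, one_mul]
    exact hR.monodromy_commute x

theorem monodromy_commute_drinfeld :
    Commute (monodromy R) (drinfeldMap K A R ⊗ₜ drinfeldMap K A R) := by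
  rw [← hR.comul_drinfeld_mul]
  exact (hR.monodromy_commute _).mul_right (.refl _)

theorem isUnit_monodromy : IsUnit (monodromy R) := by
  have : IsArtinianRing (A ⊗[K] A) := IsArtinianRing.of_finite K _
  have h1 : IsUnit R := .of_mul_eq_one _ hR.mul_antipode_left
  exact (h1.map (Algebra.TensorProduct.comm K A A)).mul h1

end IsQuasitriangular

end ComulDrinfeld

end HopfQuasi

namespace HopfQuasi

open TensorProduct Coalgebra HopfAlgebra LinearMap

/-! ### A power of the Drinfeld element is central. -/

section CentralPower

variable {K : Type*} [Field K] {A : Type*} [Ring A] [HopfAlgebra K A]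

variable (K A) in
/-- The antihomomorphism `a ⊗ b ↦ S(b) ⊗ S(a)` of `A ⊗ A`. -/
noncomputable def swapAntipode : A ⊗[K] A →ₗ[K] A ⊗[K] A :=
  TensorProduct.map (antipode K) (antipode K) ∘ₗ (TensorProduct.comm K A A).toLinearMap

@[simp] theorem swapAntipode_tmul (a b : A) :
    swapAntipode K A (a ⊗ₜ b) = antipode K b ⊗ₜ antipode K a := rfl

theorem swapAntipode_mul (s t : A ⊗[K] A) :
    swapAntipode K A (s * t) = swapAntipode K A t * swapAntipode K A s := by
  induction s with
  | zero => simp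
  | tmul a b =>
    induction t with
    | zero => simp
    | tmul c d => simp [antipode_mul_antidistrib]
    | add c d hc hd => simp only [mul_add, add_mul, map_add, hc, hd]
  | add a b ha hb => simp only [mul_add, add_mul, map_add, ha, hb]

theorem swapAntipode_comm (t : A ⊗[K] A) : swapAntipode K A (TensorProduct.comm K A A t) =
    TensorProduct.comm K A A (swapAntipode K A t) := by
  induction t with
  | zero => simp
  | tmul a b => simp
  | add a b ha hb => simp only [map_add, ha, hb]

variable [FiniteDimensional K A]

/-- A group-like element of a finite-dimensional Hopf algebra has finite order. -/
theorem exists_pow_eq_one_of_isGroupLikeElem {g : A} (hg : IsGroupLikeElem K g) :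
    ∃ k, 0 < k ∧ g ^ k = 1 := by
  have hu : IsUnit g := by
    have h := mul_antipode_rTensor_comul_apply (R := K) g
    rw [hg.comul_eq_tmul_self, hg.counit_eq_one] at h
    have : IsArtinianRing A := IsArtinianRing.of_finite K A
    exact .of_mul_eq_one_right _ (by simpa using h)
  -- Distinct group-like elements are linearly independent, so two powers of `g` must coincide.
  have hfin : {a : A | IsGroupLikeElem K a}.Finite :=
    (linearIndepOn_isGroupLikeElem (R := K) (A := A)).linearIndependent.setFinite
  obtain ⟨i, -, j, -, hij, h⟩ := Set.infinite_univ.exists_lt_map_eq_of_mapsTo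
    (f := fun n : ℕ => g ^ n) (fun _ _ => hg.pow) hfin
  refine ⟨j - i, Nat.sub_pos_of_lt hij, (hu.pow i).mul_left_cancel ?_⟩
  rw [← pow_add, Nat.add_sub_cancel' hij.le, mul_one, h]

namespace IsQuasitriangular

variable {R : A ⊗[K] A} (hR : IsQuasitriangular R)

include hR

/-- `a ⊗ b ↦ S(b) ⊗ S(a)` exchanges `R` and `R₂₁`, because `(S ⊗ S)(R) = R`, and it reverses
products. -/
theorem swapAntipode_monodromy : swapAntipode K A (monodromy R) = monodromy R := by
  have h1 : swapAntipode K A (TensorProduct.comm K A A R) = R := by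
    simp only [swapAntipode, LinearMap.comp_apply, LinearEquiv.coe_coe, comm_comm]
    exact hR.map_antipode_antipode
  have h2 : swapAntipode K A R = TensorProduct.comm K A A R := by
    rw [← h1, swapAntipode_comm, comm_comm, ← swapAntipode_comm, h1]
  rw [monodromy, swapAntipode_mul, h1, h2]

/-- If `v` is inverse to the Drinfeld element `u`, then `u S(v)` is group-like. -/
theorem isGroupLikeElem_mul_antipode {v : A} (huv : drinfeldMap K A R * v = 1)
    (hvu : v * drinfeldMap K A R = 1) :
    IsGroupLikeElem K (drinfeldMap K A R * antipode K v) where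
  counit_eq_one := by
    have := congrArg (counit (R := K)) huv
    rw [Bialgebra.counit_mul, hR.counit_drinfeld, one_mul, Bialgebra.counit_one] at this
    rw [Bialgebra.counit_mul, hR.counit_drinfeld, counit_antipode, this, one_mul]
  comul_eq_tmul_self := by
    set u := drinfeldMap K A R
    -- Both sides invert `Δ(u)`, since `Δ(u) M = u ⊗ u`.
    have hcv : comul (R := K) v = monodromy R * (v ⊗ₜ v) := by
      refine (left_inv_eq_right_inv (a := comul (R := K) u) ?_ ?_)
      · rw [← Bialgebra.comul_mul, hvu, Bialgebra.comul_one]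
      · rw [← mul_assoc, hR.comul_drinfeld_mul, Algebra.TensorProduct.tmul_mul_tmul, huv,
          Algebra.TensorProduct.one_def]
    have hcS : comul (R := K) (antipode K v) = (antipode K v ⊗ₜ antipode K v) * monodromy R := by
      have := congrArg (swapAntipode K A) hcv
      rw [swapAntipode_mul, hR.swapAntipode_monodromy, swapAntipode_tmul] at this
      rw [← this, comul_antipode]
      rfl
    have hc : Commute (monodromy R) (v ⊗ₜ[K] v) := by
      refine (Commute.units_inv_right (u := ⟨u ⊗ₜ u, v ⊗ₜ v, ?_, ?_⟩)
        hR.monodromy_commute_drinfeld)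
      · rw [Algebra.TensorProduct.tmul_mul_tmul, huv, Algebra.TensorProduct.one_def]
      · rw [Algebra.TensorProduct.tmul_mul_tmul, hvu, Algebra.TensorProduct.one_def]
    have hc' := congrArg (swapAntipode K A) hc.eq
    -- Applying `swapAntipode` shows that `M` also commutes with `S(v) ⊗ S(v)`, so that `Δ(u S(v)) =
    -- Δ(u) M (S(v) ⊗ S(v))`.
    rw [swapAntipode_mul, swapAntipode_mul, hR.swapAntipode_monodromy, swapAntipode_tmul] at hc'
    rw [Bialgebra.comul_mul, hcS, hc', ← mul_assoc, hR.comul_drinfeld_mul,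
      Algebra.TensorProduct.tmul_mul_tmul]

/-- Some power of the Drinfeld element is central. -/
theorem exists_pow_drinfeld_central :
    ∃ k, 0 < k ∧ ∀ x : A, Commute (drinfeldMap K A R ^ k) x := by
  obtain ⟨⟨u, v, huv, hvu⟩, rfl : u = _⟩ := hR.isUnit_drinfeld
  obtain ⟨k, hk, hg⟩ := exists_pow_eq_one_of_isGroupLikeElem
    (hR.isGroupLikeElem_mul_antipode huv hvu)
  set u := drinfeldMap K A R
  have hSS : antipode K (antipode K u) = u := by
    have := hR.antipode_sq_mul u
    exact (Units.mk u v huv hvu).isUnit.mul_right_cancel this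
  have hc : Commute (antipode K u) u := by
    have := hR.antipode_sq_mul (antipode K u)
    rwa [hSS] at this
  have hS : antipode K v * antipode K u = 1 := by
    rw [← antipode_mul_antidistrib, huv, antipode_one]
  have hS' : antipode K u * antipode K v = 1 := by
    rw [← antipode_mul_antidistrib, hvu, antipode_one]
  have hcv : Commute u (antipode K v) :=
    Commute.units_inv_right (u := ⟨antipode K u, antipode K v, hS', hS⟩) hc.symm
  -- `1 = (u S(v))ᵏ = uᵏ S(v)ᵏ`, and `S(v)` is the inverse of `S(u)`.
  have hpow : u ^ k = antipode K u ^ k := by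
    rw [hcv.mul_pow] at hg
    refine left_inv_eq_right_inv hg ?_
    rw [← (Commute.mul_pow (by rw [Commute, SemiconjBy, hS, hS'])), hS, one_pow]
  -- Applying `S` to `S²(S⁻¹(x)) u = u S⁻¹(x)` gives `S(u) S²(x) = x S(u)`; combine it with `S²(x) u
  -- = u x`.
  have hcent : ∀ x, Commute (antipode K u * u) x := by
    intro x
    have h1 := congrArg (antipode K) (hR.antipode_sq_mul (antipodeInv K x))
    simp only [antipode_mul_antidistrib, antipode_antipodeInv] at h1
    rw [Commute, SemiconjBy, mul_assoc, ← hR.antipode_sq_mul, ← mul_assoc, h1, mul_assoc]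
  -- `u²ᵏ = S(u)ᵏ uᵏ = (S(u) u)ᵏ`.
  refine ⟨k + k, by omega, fun x => ?_⟩
  rw [pow_add]
  conv => enter [1, 1]; rw [hpow]
  rw [← hc.mul_pow]
  exact (hcent x).pow_left k

end IsQuasitriangular

end CentralPower

/-! ### The determinant of the Drinfeld element on a module is a root of unity. -/

section Determinant

variable {K : Type*} [Field K]

theorem det_lTensor {M N : Type*} [AddCommGroup M] [Module K M] [FiniteDimensional K M]
    [AddCommGroup N] [Module K N] [FiniteDimensional K N] (f : Module.End K N) :
    LinearMap.det (f.lTensor M) = LinearMap.det f ^ Module.finrank K M := by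
  classical
  let b := Module.finBasis K M
  let c := Module.finBasis K N
  rw [← LinearMap.det_toMatrix (b.tensorProduct c), LinearMap.lTensor, TensorProduct.toMatrix_map,
    Matrix.det_kronecker, LinearMap.toMatrix_id, Matrix.det_one, one_pow, one_mul,
    LinearMap.det_toMatrix, Fintype.card_fin]

variable {A : Type*} [Ring A] [HopfAlgebra K A] {V : Type*} [AddCommGroup V] [Module K V]

variable (A) in
/-- The action of `End V` on the second factor of `A ⊗ V`. -/
noncomputable abbrev onRight : Module.End K V →ₐ[K] Module.End K (A ⊗[K] V) :=
  Module.End.lTensorAlgHom K V A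

variable (K A V) in
/-- The action of `A` on the first factor of `A ⊗ V` by left multiplication. -/
noncomputable abbrev regLeft : A →ₐ[K] Module.End K (A ⊗[K] V) :=
  (Module.End.rTensorAlgHom K A V).comp (Algebra.lmul K A)

theorem comm_regLeft {C : Type*} [Ring C] [Algebra K C] (σ : C →ₐ[K] Module.End K V) :
    Comm (regLeft K A V) ((onRight A).comp σ) := fun _ _ =>
  TensorProduct.ext' fun _ _ => rfl

variable [FiniteDimensional K A] [FiniteDimensional K V]

/-- The tensor product of the regular module with a module `V` is isomorphic to the tensor
product of the regular module with the vector space `V`. -/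
theorem exists_regLeft_equiv (ρ : A →ₐ[K] Module.End K V) :
    ∃ e : (A ⊗[K] V) ≃ₗ[K] (A ⊗[K] V),
      (∀ x, e.conjAlgEquiv K (regLeft K A V x) =
        star (regLeft K A V) ((onRight A).comp ρ) (comm_regLeft ρ) x) ∧
      ∀ f : Module.End K V, (∀ x, Commute f (ρ x)) →
        e.conjAlgEquiv K (onRight A f) = onRight A f := by
  let s := star (regLeft K A V) ((onRight A).comp ρ) (comm_regLeft ρ)
  -- The isomorphism is `a ⊗ v ↦ ∑ a₁ ⊗ a₂ v`; surjectivity is enough by dimension, and `∑ a₁ ⊗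
  -- S(a₂) v` is a preimage of `a ⊗ v`.
  let Φ : A ⊗[K] V →ₗ[K] A ⊗[K] V := TensorProduct.lift (LinearMap.mk₂ K (fun a v => s a (1 ⊗ₜ v))
    (by intros; simp) (by intros; simp) (by intros; simp [tmul_add]) (by intros; simp))
  have hΦ : ∀ a v, Φ (a ⊗ₜ v) = s a (1 ⊗ₜ v) := fun _ _ => rfl
  have hs : ∀ a v, s a (1 ⊗ₜ v) = (ρ.toLinearMap.flip v).lTensor A (comul a) := by
    intro a v
    simp only [s, star_apply]
    induction comul (R := K) a with
    | zero => simp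
    | tmul c d => exact congrArg (· ⊗ₜ[K] ρ d v) (mul_one c)
    | add c d hc hd => simp only [map_add, LinearMap.add_apply, hc, hd]
  have hsurj : Function.Surjective Φ := by
    intro t
    induction t with
    | zero => exact ⟨0, map_zero _⟩
    | add a b ha hb =>
      obtain ⟨a', rfl⟩ := ha
      obtain ⟨b', rfl⟩ := hb
      exact ⟨a' + b', map_add _ _ _⟩
    | tmul a v =>
      let Q : A ⊗[K] A →ₗ[K] A ⊗[K] V := ((ρ.toLinearMap.flip v) ∘ₗ antipode K).lTensor A
      refine ⟨Q (comul a), ?_⟩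
      let G : A ⊗[K] (A ⊗[K] A) →ₗ[K] A ⊗[K] V :=
        (ρ.toLinearMap.flip v ∘ₗ mul' K A ∘ₗ (antipode K).lTensor A).lTensor A
      have h1 : ∀ t, Φ (Q t) = G (TensorProduct.assoc K A A A (comul.rTensor A t)) := by
        intro t
        induction t with
        | zero => simp
        | tmul c d =>
          simp only [Q, lTensor_tmul, hΦ, hs, rTensor_tmul]
          induction comul (R := K) c with
          | zero => simp
          | tmul c d => simp [G]
          | add c d hc hd => simp only [map_add, add_tmul, hc, hd]
        | add c d hc hd => simp only [map_add, hc, hd]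
      have h2 : ∀ t, G (comul.lTensor A t) = TensorProduct.rid K A (counit.lTensor A t) ⊗ₜ v := by
        intro t
        induction t with
        | zero => simp
        | tmul c d =>
          simp only [G, lTensor_tmul, LinearMap.comp_apply, mul_antipode_lTensor_comul_apply]
          simp [smul_tmul, Algebra.algebraMap_eq_smul_one]
        | add c d hc hd => simp only [map_add, add_tmul, hc, hd]
      rw [h1, coassoc_apply, h2]
      simp
  let e := LinearEquiv.ofBijective Φ ⟨LinearMap.injective_iff_surjective.2 hsurj, hsurj⟩
  have he : ∀ f g : Module.End K (A ⊗[K] V), Φ ∘ₗ f = g ∘ₗ Φ → e.conjAlgEquiv K f = g := by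
    intro f g h
    refine LinearMap.ext fun x => ?_
    exact (LinearMap.congr_fun h (e.symm x)).trans (congrArg g (e.apply_symm_apply x))
  refine ⟨e, fun x => he _ _ ?_, fun f hf => he _ _ ?_⟩
  · refine TensorProduct.ext' fun a v => ?_
    change Φ ((x * a) ⊗ₜ v) = s x (Φ (a ⊗ₜ v))
    rw [hΦ, hΦ, map_mul]; rfl
  · refine TensorProduct.ext' fun a v => ?_
    change Φ (a ⊗ₜ f v) = f.lTensor A (Φ (a ⊗ₜ v))
    rw [hΦ, hΦ, hs, hs]
    induction comul (R := K) a with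
    | zero => simp
    | tmul c d => simpa using congrArg (c ⊗ₜ[K] ·) (LinearMap.congr_fun (hf d).eq v).symm
    | add c d hc hd => simp only [map_add, hc, hd]

theorem det_regLeft_ne_zero {u : A} (hu : IsUnit u) :
    LinearMap.det (regLeft K A V u) ≠ 0 :=
  ((hu.map (regLeft K A V)).map LinearMap.det).ne_zero

variable {R : A ⊗[K] A} (hR : IsQuasitriangular R)

theorem det_conjAlgEquiv {M : Type*} [AddCommGroup M] [Module K M] (e : M ≃ₗ[K] M)
    (f : Module.End K M) : LinearMap.det (e.conjAlgEquiv K f) = LinearMap.det f :=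
  LinearMap.det_conj f e

namespace IsQuasitriangular

include hR

/-- Take determinants in `Δ(u) M = u ⊗ u` on `A ⊗ V`. There `Δ(u)` is conjugate to `u ⊗ 1`, so these
two determinants cancel and `det M = det (1 ⊗ ρ(u))`. -/
theorem det_ev_regLeft (ρ : A →ₐ[K] Module.End K V) :
    LinearMap.det (ev (regLeft K A V) ((onRight A).comp ρ) (monodromy R)) =
      LinearMap.det (ρ (drinfeldMap K A R)) ^ Module.finrank K A := by
  obtain ⟨e, he, -⟩ := exists_regLeft_equiv ρ
  have h1 := congrArg (ev (regLeft K A V) ((onRight A).comp ρ)) hR.comul_drinfeld_mul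
  rw [ev_mul (comm_regLeft ρ), ← star_apply (comm_regLeft ρ), ← he, ev_tmul] at h1
  have h2 := congrArg LinearMap.det h1
  rw [map_mul, map_mul, det_conjAlgEquiv] at h2
  rw [mul_left_cancel₀ (det_regLeft_ne_zero hR.isUnit_drinfeld) h2]
  exact det_lTensor _

/-- On `A ⊗ A ⊗ V`, the hexagon relations give `det (Δ ⊗ id)(M) = det M₁₃ · det M₂₃`. Absorbing the
second regular factor into the first makes the left side conjugate to `M₁₃`, so `det M₂₃ = 1`; and
`det M₂₃` is a power of the determinant of `M` on `A ⊗ V`. -/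
theorem det_ev_regLeft_pow (ρ : A →ₐ[K] Module.End K V) :
    LinearMap.det (ev (regLeft K A V) ((onRight A).comp ρ) (monodromy R)) ^
      Module.finrank K A = 1 := by
  let j1 := regLeft K A (A ⊗[K] V)
  let j2 := (onRight (V := A ⊗[K] V) A).comp (regLeft K A V)
  let j3 := (onRight (V := A ⊗[K] V) A).comp ((onRight A).comp ρ)
  have c12 : Comm j1 j2 := comm_regLeft _
  have c13 : Comm j1 j3 := comm_regLeft _
  have c23 : Comm j2 j3 := fun a b => (comm_regLeft ρ a b).map (onRight (V := A ⊗[K] V) A)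
  obtain ⟨e, he, he'⟩ := exists_regLeft_equiv (regLeft K A V)
  have hM : ∀ {p q : A →ₐ[K] Module.End K (A ⊗[K] (A ⊗[K] V))}, Comm p q →
      ev p q (monodromy R) = ev q p R * ev p q R := by
    intro p q h
    rw [monodromy, ev_mul h, ev_comm h.symm]
  have h1 : LinearMap.det (ev (star j1 j2 c12) j3 (monodromy R)) =
      LinearMap.det (ev j1 j3 (monodromy R)) := by
    rw [← det_conjAlgEquiv e (ev j1 j3 (monodromy R))]
    have e1 : star j1 j2 c12 = ((e.conjAlgEquiv K).toAlgHom.comp j1) :=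
      AlgHom.ext fun x => (he x).symm
    -- The isomorphism only uses the action on the second copy of `A`, hence commutes with the
    -- action on `V`.
    have e3 : j3 = (e.conjAlgEquiv K).toAlgHom.comp j3 :=
      AlgHom.ext fun x => (he' _ fun y => (comm_regLeft ρ y x).symm).symm
    rw [e1]
    conv_lhs => rw [e3]
    rw [← algHom_ev]
    rfl
  have h2 : LinearMap.det (ev (star j1 j2 c12) j3 (monodromy R)) =
      LinearMap.det (ev j1 j3 (monodromy R)) * LinearMap.det (ev j2 j3 (monodromy R)) := by
    rw [hM (c12.star_left c13 c23), hM c13, hM c23, hR.ev_star_left c12 c13 c23,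
      hR.ev_star_right c13.symm c23.symm c12]
    simp only [map_mul]
    ring
  have h3 : LinearMap.det (ev j1 j3 (monodromy R)) ≠ 0 := by
    rw [← lift_eq_ev c13]
    exact ((hR.isUnit_monodromy.map (Algebra.TensorProduct.lift j1 j3 c13)).map
      LinearMap.det).ne_zero
  rw [h1] at h2
  have h4 : LinearMap.det (ev j2 j3 (monodromy R)) = 1 :=
    mul_left_cancel₀ h3 (h2.symm.trans (mul_one _).symm)
  rw [← h4, ← algHom_ev]
  exact (det_lTensor _).symm

theorem det_drinfeld_pow (ρ : A →ₐ[K] Module.End K V) :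
    LinearMap.det (ρ (drinfeldMap K A R)) ^ (Module.finrank K A * Module.finrank K A) = 1 := by
  rw [pow_mul, ← hR.det_ev_regLeft, hR.det_ev_regLeft_pow]

end IsQuasitriangular

end Determinant

/-! ### Some power of the Drinfeld element is unipotent. -/

section Unipotent

open Polynomial

theorem prod_X_sub_C_dvd_pow {K : Type*} [Field K] (q : K[X]) (s : Multiset K)
    (h : ∀ a ∈ s, q.IsRoot a) : (s.map (X - C ·)).prod ∣ q ^ s.card := by
  induction s using Multiset.induction with
  | empty => simp
  | cons a s ih =>
    rw [Multiset.map_cons, Multiset.prod_cons, Multiset.card_cons, pow_succ']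
    exact mul_dvd_mul (dvd_iff_isRoot.2 (h a (by simp))) (ih fun b hb => h b (by simp [hb]))

/-- The minimal polynomial splits into factors `X - a` over eigenvalues `a`, each dividing `q`;
hence it divides a power of `q`. -/
theorem isNilpotent_aeval_of_isRoot {K V : Type*} [Field K] [IsAlgClosed K] [AddCommGroup V]
    [Module K V] [FiniteDimensional K V] (f : Module.End K V) (q : K[X])
    (h : ∀ a, f.HasEigenvalue a → q.IsRoot a) : IsNilpotent (aeval f q) := by
  refine ⟨(minpoly K f).roots.card, ?_⟩
  have h1 := prod_X_sub_C_dvd_pow q (minpoly K f).roots fun a ha =>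
    h a (Module.End.hasEigenvalue_of_isRoot (isRoot_of_mem_roots ha))
  rw [← (IsAlgClosed.splits (minpoly K f)).eq_prod_roots_of_monic
    (minpoly.monic (Algebra.IsIntegral.isIntegral f))] at h1
  obtain ⟨r, hr⟩ := h1
  rw [← map_pow, hr, map_mul, minpoly.aeval, zero_mul]

variable {K : Type*} [Field K] [IsAlgClosed K] {A : Type*} [Ring A] [HopfAlgebra K A]
  [FiniteDimensional K A] {R : A ⊗[K] A} (hR : IsQuasitriangular R)

include hR in
/-- Some power of the Drinfeld element is unipotent. -/
theorem IsQuasitriangular.exists_isNilpotent_drinfeld_pow_sub_one :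
    ∃ n, 0 < n ∧ IsNilpotent (drinfeldMap K A R ^ n - 1) := by
  obtain ⟨k, hk, hc⟩ := hR.exists_pow_drinfeld_central
  set u := drinfeldMap K A R
  have hA : 0 < Module.finrank K A := by
    have : Nontrivial A := by
      refine ⟨1, 0, fun h => ?_⟩
      have := congrArg (counit (R := K)) h
      simp at this
    exact Module.finrank_pos
  -- The factorial is a common multiple of all possible eigenspace dimensions; the square of the
  -- dimension is the exponent from `det_drinfeld_pow`.
  let N := (Module.finrank K A).factorial * (Module.finrank K A * Module.finrank K A)
  have hN : 0 < N := by positivity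
  have key : IsNilpotent (aeval (Algebra.lmul K A (u ^ k)) (X ^ N - 1 : K[X])) := by
    refine isNilpotent_aeval_of_isRoot _ _ fun a ha => ?_
    -- Since `uᵏ` is central, `W` is an `A`-submodule of the regular module, and comparing
    -- determinants on it gives `a ^ (dim W · d²) = 1`.
    let W := (Algebra.lmul K A (u ^ k)).eigenspace a
    have hW : ∀ x, ∀ w ∈ W, Algebra.lmul K A x w ∈ W := by
      intro x w hw
      rw [Module.End.mem_eigenspace_iff] at hw ⊢
      simp only [Algebra.coe_lmul_eq_mul, mul_apply'] at hw ⊢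
      rw [← mul_assoc, (hc x).eq, mul_assoc, hw, mul_smul_comm]
    let ρ : A →ₐ[K] Module.End K W := AlgHom.ofLinearMap
      { toFun := fun x => (Algebra.lmul K A x).restrict (hW x)
        map_add' := by intros; ext; simp [LinearMap.restrict_apply, add_mul]
        map_smul' := by intros; ext; simp [LinearMap.restrict_apply] }
      (by ext; simp [LinearMap.restrict_apply])
      (by intros; ext; simp [LinearMap.restrict_apply, mul_assoc])
    have hρ : ρ u ^ k = a • LinearMap.id := by
      rw [← map_pow]
      ext w
      exact Module.End.mem_eigenspace_iff.1 w.2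
    have h1 := congrArg (fun f => LinearMap.det f ^ (Module.finrank K A * Module.finrank K A)) hρ
    simp only [map_pow] at h1
    rw [← pow_mul, mul_comm k, pow_mul, hR.det_drinfeld_pow, one_pow, LinearMap.det_smul,
      LinearMap.det_id, mul_one] at h1
    have hpos : 0 < Module.finrank K W := by
      have : Nontrivial W := (Submodule.nontrivial_iff_ne_bot).2 ha
      exact Module.finrank_pos
    obtain ⟨m, hm⟩ := Nat.dvd_factorial hpos (Submodule.finrank_le W)
    have : a ^ N = 1 := by
      simp only [N, hm]
      rw [show Module.finrank K W * m * (Module.finrank K A * Module.finrank K A) =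
        Module.finrank K W * (Module.finrank K A * Module.finrank K A) * m by ring, pow_mul,
        pow_mul, ← h1, one_pow]
    simp [this]
  refine ⟨k * N, by positivity, ?_⟩
  have h2 : aeval (Algebra.lmul K A (u ^ k)) (X ^ N - 1 : K[X]) =
      Algebra.lmul K A (u ^ (k * N) - 1) := by
    simp only [map_sub, map_pow, aeval_X, map_one, pow_mul]
  rw [h2] at key
  exact (IsNilpotent.map_iff (Algebra.lmul_injective (R := K) (A := A))).1 key

end Unipotent

end HopfQuasi

namespace HopfQuasi

open TensorProduct Coalgebra HopfAlgebra LinearMap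

/-! ### Jordan–Chevalley decomposition and unipotent elements in algebras. -/

section Semisimple

open Polynomial

variable {K : Type*} [Field K] {A B : Type*} [Ring A] [Algebra K A] [Ring B] [Algebra K B]

variable (K) in
/-- An element of an algebra annihilated by a squarefree polynomial. -/
def IsSemisimpleElem (x : A) : Prop := ∃ q : K[X], Squarefree q ∧ aeval x q = 0

theorem IsSemisimpleElem.map {x : A} (h : IsSemisimpleElem K x) (f : A →ₐ[K] B) :
    IsSemisimpleElem K (f x) := by
  obtain ⟨q, hq, hx⟩ := h
  exact ⟨q, hq, by rw [aeval_algHom_apply, hx, map_zero]⟩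

/-- The regular representation is faithful, so an element and its left multiplication are
annihilated by the same polynomials. This transfers the theory of semisimple endomorphisms to
algebras. -/
theorem isSemisimpleElem_iff [FiniteDimensional K A] (x : A) :
    IsSemisimpleElem K x ↔ (Algebra.lmul K A x).IsSemisimple := by
  constructor
  · rintro ⟨q, hq, hx⟩
    exact Module.End.isSemisimple_of_squarefree_aeval_eq_zero hq
      (by rw [aeval_algHom_apply, hx, map_zero])
  · intro h
    refine ⟨_, h.minpoly_squarefree, Algebra.lmul_injective (R := K) ?_⟩
    rw [← aeval_algHom_apply, minpoly.aeval, map_zero]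

variable [PerfectField K] [FiniteDimensional K A]

theorem IsSemisimpleElem.mul {x y : A} (hx : IsSemisimpleElem K x) (hy : IsSemisimpleElem K y)
    (h : Commute x y) : IsSemisimpleElem K (x * y) := by
  rw [isSemisimpleElem_iff] at *
  rw [map_mul]
  exact hx.mul_of_commute (h.map (Algebra.lmul K A)) hy

/-- Uniqueness of the Jordan–Chevalley decomposition, applied to left multiplication by `x`. -/
theorem IsSemisimpleElem.eq_of_isNilpotent_sub {x s t : A} (hs : IsSemisimpleElem K s)
    (ht : IsSemisimpleElem K t) (hxs : IsNilpotent (x - s)) (hxt : IsNilpotent (x - t))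
    (hcs : Commute x s) (hct : Commute x t) : s = t := by
  rw [isSemisimpleElem_iff] at hs ht
  apply Algebra.lmul_injective (R := K) (A := A)
  refine (Module.End.isNilpotent_isSemisimple_unique (hxs.map (Algebra.lmul K A)) hs
    (hxt.map (Algebra.lmul K A)) ht ((hcs.sub_left (.refl s)).map (Algebra.lmul K A))
    ((hct.sub_left (.refl t)).map (Algebra.lmul K A)) ?_).2
  rw [← map_add, ← map_add, sub_add_cancel, sub_add_cancel]

theorem exists_isSemisimpleElem_aeval (x : A) :
    ∃ p : K[X], IsSemisimpleElem K (aeval x p) ∧ IsNilpotent (x - aeval x p) := by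
  obtain ⟨n, -, s, hs, hn, hss, h⟩ := (Algebra.lmul K A x).exists_isNilpotent_isSemisimple
  obtain ⟨p, rfl⟩ := Algebra.adjoin_singleton_eq_range_aeval K (Algebra.lmul K A x) ▸ hs
  refine ⟨p, (isSemisimpleElem_iff _).2 ?_, ?_⟩
  · rw [← aeval_algHom_apply]; exact hss
  · rw [← IsNilpotent.map_iff (Algebra.lmul_injective (R := K) (A := A)), map_sub,
      ← aeval_algHom_apply]
    rw [eq_sub_of_add_eq h.symm] at hn
    exact hn

end Semisimple

theorem IsUnipotent.mul {S : Type*} [Ring S] {x y : S} (hx : IsUnipotent x) (hy : IsUnipotent y)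
    (h : Commute x y) : IsUnipotent (x * y) := by
  have : x * y - 1 = (x - 1) * y + (y - 1) := by rw [sub_mul, one_mul, sub_add_sub_cancel]
  rw [IsUnipotent, this]
  have h1 : Commute (x - 1) y := h.sub_left (Commute.one_left y)
  have h2 : Commute (x - 1) (y - 1) := h1.sub_right (Commute.one_right _)
  exact Commute.isNilpotent_add (h2.mul_left ((Commute.refl y).sub_right (Commute.one_right y)))
    (h1.isNilpotent_mul_right hx) hy

theorem IsUnipotent.map {S T : Type*} [Ring S] [Ring T] {x : S} (hx : IsUnipotent x)
    (f : S →+* T) : IsUnipotent (f x) := by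
  have := IsNilpotent.map hx f
  rwa [map_sub, map_one] at this

/-- `x⁻¹ - 1 = (x - 1)(-x⁻¹)`, a product of commuting factors, one of them nilpotent. -/
theorem IsUnipotent.of_mul_eq_one {S : Type*} [Ring S] {x y : S} (hx : IsUnipotent x)
    (hxy : x * y = 1) (hyx : y * x = 1) : IsUnipotent y := by
  have h1 : y - 1 = (x - 1) * -y := by rw [sub_mul, mul_neg, hxy]; noncomm_ring
  have hc : Commute (x - 1) (-y) := by
    refine Commute.neg_right (Commute.sub_left ?_ (Commute.one_left y))
    rw [Commute, SemiconjBy, hxy, hyx]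
  rw [IsUnipotent, h1]
  exact hc.isNilpotent_mul_right hx

/-! ### Comparing powers of the Drinfeld element and of the monodromy. -/

section Comparison

variable {K : Type*} [Field K] {A : Type*} [Ring A] [HopfAlgebra K A] [FiniteDimensional K A]
  {R : A ⊗[K] A} (hR : IsQuasitriangular R)

namespace IsQuasitriangular

include hR

theorem comul_drinfeld_pow_mul (n : ℕ) : comul (drinfeldMap K A R ^ n) * monodromy R ^ n =
    (drinfeldMap K A R ^ n) ⊗ₜ (drinfeldMap K A R ^ n) := by
  rw [Bialgebra.comul_pow, ← (hR.monodromy_commute _).symm.mul_pow, hR.comul_drinfeld_mul,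
    Algebra.TensorProduct.tmul_pow]

/-- `Mⁿ = Δ(u⁻ⁿ)(uⁿ ⊗ uⁿ)` is a product of two commuting unipotent elements. -/
theorem isUnipotent_monodromy_pow {n : ℕ} (h : IsUnipotent (drinfeldMap K A R ^ n)) :
    IsUnipotent (monodromy R ^ n) := by
  obtain ⟨⟨u, v, huv, hvu⟩, hu : u = _⟩ := hR.isUnit_drinfeld
  have h1 := hR.comul_drinfeld_pow_mul n
  rw [← hu] at h h1
  have huv' : u ^ n * v ^ n = 1 := by
    rw [← (Commute.mul_pow (by rw [Commute, SemiconjBy, huv, hvu])), huv, one_pow]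
  have hvu' : v ^ n * u ^ n = 1 := by
    rw [← (Commute.mul_pow (by rw [Commute, SemiconjBy, huv, hvu])), hvu, one_pow]
  have h2 : IsUnipotent ((u ^ n) ⊗ₜ[K] (u ^ n)) := by
    have := (h.map (inl K A A).toRingHom).mul (h.map (inr K A A).toRingHom)
      (comm_inl_inr _ _)
    simpa using this
  have hv : IsUnipotent (comul (R := K) (v ^ n)) :=
    (h.of_mul_eq_one huv' hvu').map (Bialgebra.comulAlgHom K A).toRingHom
  have h3 : monodromy R ^ n = comul (R := K) (v ^ n) * ((u ^ n) ⊗ₜ[K] (u ^ n)) := by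
    rw [← h1, ← mul_assoc, ← Bialgebra.comul_mul, hvu', Bialgebra.comul_one, one_mul]
  rw [h3]
  refine hv.mul h2 ?_
  rw [← h1]
  refine Commute.mul_right ?_ ((hR.monodromy_commute _).symm.pow_right n)
  have : Commute (v ^ n) (u ^ n) := by rw [Commute, SemiconjBy, huv', hvu']
  exact this.map (Bialgebra.comulAlgHom K A)

open Polynomial in
/-- If `(R₂₁ R)ⁿ` is unipotent, then the semisimple part of `uⁿ` is group-like. -/
theorem exists_isGroupLikeElem_aeval [PerfectField K] {n : ℕ}
    (h : IsUnipotent (monodromy R ^ n)) : ∃ p : K[X],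
      IsNilpotent (drinfeldMap K A R ^ n - aeval (drinfeldMap K A R ^ n) p) ∧
      comul (R := K) (aeval (drinfeldMap K A R ^ n) p) =
        aeval (drinfeldMap K A R ^ n) p ⊗ₜ aeval (drinfeldMap K A R ^ n) p := by
  have h1 := hR.comul_drinfeld_pow_mul n
  set t := drinfeldMap K A R ^ n
  obtain ⟨p, hp, hn⟩ := exists_isSemisimpleElem_aeval (K := K) t
  refine ⟨p, hn, ?_⟩
  set s := aeval t p
  have hts : Commute t s := by
    have := (Commute.all (X : K[X]) p).map (aeval t)
    rwa [aeval_X] at this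
  have hM : ∀ x, Commute (monodromy R ^ n) (comul (R := K) x) := fun x =>
    (hR.monodromy_commute x).pow_left n
  -- `Δ(s)` and `s ⊗ s` are both semisimple, commute with `t ⊗ t = Δ(t) Mⁿ` and differ from it by
  -- nilpotents; the factor `Mⁿ` disturbs nothing because it is unipotent and commutes with all
  -- coproducts.
  refine IsSemisimpleElem.eq_of_isNilpotent_sub (K := K) (x := t ⊗ₜ t)
    (hp.map (Bialgebra.comulAlgHom K A)) ?_ ?_ ?_ ?_ ?_
  · have := (hp.map (inl K A A)).mul (hp.map (inr K A A)) (comm_inl_inr _ _)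
    simpa using this
  · have h2 : (t ⊗ₜ[K] t) - comul (R := K) s =
        comul t * (monodromy R ^ n - 1) + comul (R := K) (t - s) := by
      rw [← h1, map_sub, mul_sub, mul_one, sub_add_sub_cancel]
    rw [h2]
    have hM1 : ∀ x, Commute (comul (R := K) x) (monodromy R ^ n - 1) := fun x =>
      (hM x).symm.sub_right (Commute.one_right _)
    refine Commute.isNilpotent_add (Commute.mul_left ?_ (hM1 _).symm)
      ((hM1 t).isNilpotent_mul_left h) (hn.map (Bialgebra.comulAlgHom K A))
    exact ((Commute.refl t).sub_right hts).map (Bialgebra.comulAlgHom K A)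
  · have h2 : (t ⊗ₜ[K] t) - s ⊗ₜ s = inl K A A (t - s) * inr K A A t +
        inl K A A s * inr K A A (t - s) := by
      simp [sub_tmul, tmul_sub, sub_mul, mul_sub]
    rw [h2]
    have hc := comm_inl_inr (K := K) (A := A) (B := A)
    have c1 : Commute (inl K A A (t - s)) (inl K A A s) :=
      (hts.sub_left (.refl s)).map (inl K A A)
    have c2 : Commute (inr K A A t) (inr K A A (t - s)) :=
      ((Commute.refl t).sub_right hts).map (inr K A A)
    refine Commute.isNilpotent_add (((c1.mul_right (hc _ _)).mul_left
      ((hc _ _).symm.mul_right c2))) ((hc _ _).isNilpotent_mul_right (hn.map (inl K A A)))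
        ((hc _ _).isNilpotent_mul_left (hn.map (inr K A A)))
  · rw [← h1]
    exact Commute.mul_left (hts.map (Bialgebra.comulAlgHom K A)) (hM s)
  · rw [Commute, SemiconjBy, Algebra.TensorProduct.tmul_mul_tmul,
      Algebra.TensorProduct.tmul_mul_tmul, hts.eq]

end IsQuasitriangular

end Comparison

end HopfQuasi

namespace HopfQuasi

open TensorProduct Coalgebra HopfAlgebra LinearMap WithConv

/-! ### Homomorphisms out of the Drinfeld double. -/

section DoublePair

variable {K : Type v} {H : Type u} [Field K] [Ring H] [HopfAlgebra K H]

theorem map_eq_ev {A B A' B' : Type*} [Ring A] [Algebra K A] [Semiring B] [Algebra K B] [Ring A']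
    [Algebra K A'] [Ring B'] [Algebra K B'] (f : A' →ₐ[K] A) (g : B' →ₐ[K] B) (t : A' ⊗[K] B') :
    Algebra.TensorProduct.map f g t = ev ((Algebra.TensorProduct.includeLeft : A →ₐ[K] A ⊗[K] B).comp f)
      (Algebra.TensorProduct.includeRight.comp g) t := by
  induction t with
  | zero => simp
  | tmul a b => simp
  | add a b ha hb => simp only [map_add, ha, hb]

/-- The data of an algebra homomorphism from the Drinfeld double of `H` to `B`: a homomorphism
`φ : H → B` and an element `w` of `H ⊗ B`, the image of `∑ hᵢ ⊗ hᵢ^*`. -/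
structure IsDoublePair {B : Type w} [Semiring B] [Algebra K B] (φ : H →ₐ[K] B) (w : H ⊗[K] B) :
    Prop where
  map_counit : Algebra.TensorProduct.map (Bialgebra.counitAlgHom K H) (AlgHom.id K B) w = 1
  map_comul : Algebra.TensorProduct.map (Bialgebra.comulAlgHom K H) (AlgHom.id K B) w =
    Algebra.TensorProduct.map (inl K H H) (AlgHom.id K B) w *
      Algebra.TensorProduct.map (inr K H H) (AlgHom.id K B) w
  cross : ∀ a : H, w * Algebra.TensorProduct.map (AlgHom.id K H) φ (comul a) =
    Algebra.TensorProduct.map (AlgHom.id K H) φ (TensorProduct.comm K H H (comul a)) * w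

variable {B : Type w} [Semiring B] [Algebra K B]

/-- The map `f ↦ (f ⊗ 1) w`. -/
noncomputable def pairDual (w : H ⊗[K] B) : HopfDual K H →ₗ[K] B where
  toFun f := TensorProduct.lid K B (f.ofConv.rTensor B w)
  map_add' f g := by simp [LinearMap.rTensor_add]
  map_smul' r f := by simp [LinearMap.rTensor_smul]

theorem pairDual_apply (w : H ⊗[K] B) (f : HopfDual K H) :
    pairDual w f = TensorProduct.lid K B (f.ofConv.rTensor B w) := rfl

theorem pairDual_tmul (a : H) (b : B) (f : HopfDual K H) : pairDual (a ⊗ₜ b) f = f a • b := by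
  simp [pairDual_apply]

theorem pairDual_add (x y : H ⊗[K] B) (f : HopfDual K H) :
    pairDual (x + y) f = pairDual x f + pairDual y f := by
  simp [pairDual_apply]

theorem pairDual_zero (f : HopfDual K H) : pairDual (0 : H ⊗[K] B) f = 0 := by
  simp [pairDual_apply]

theorem algHom_pairDual {C : Type*} [Semiring C] [Algebra K C] (p : B →ₐ[K] C) (w : H ⊗[K] B)
    (f : HopfDual K H) :
    p (pairDual w f) = pairDual (Algebra.TensorProduct.map (AlgHom.id K H) p w) f := by
  induction w with
  | zero => simp [pairDual_zero]
  | tmul a b => simp [pairDual_tmul]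
  | add x y hx hy => simp only [pairDual_add, map_add, hx, hy]

theorem pairDual_one_tmul_mul (b : B) (w : H ⊗[K] B) (f : HopfDual K H) :
    pairDual ((1 ⊗ₜ b) * w) f = b * pairDual w f := by
  induction w with
  | zero => simp [pairDual_zero]
  | tmul a c => simp [pairDual_tmul]
  | add x y hx hy => simp only [pairDual_add, mul_add, hx, hy]

theorem pairDual_mul_one_tmul (b : B) (w : H ⊗[K] B) (f : HopfDual K H) :
    pairDual (w * (1 ⊗ₜ b)) f = pairDual w f * b := by
  induction w with
  | zero => simp [pairDual_zero]
  | tmul a c => simp [pairDual_tmul]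
  | add x y hx hy => simp only [pairDual_add, add_mul, hx, hy]

namespace IsDoublePair

variable {φ : H →ₐ[K] B} {w : H ⊗[K] B} (h : IsDoublePair φ w)

include h

theorem map {C : Type*} [Semiring C] [Algebra K C] (p : B →ₐ[K] C) :
    IsDoublePair (p.comp φ) (Algebra.TensorProduct.map (AlgHom.id K H) p w) where
  map_counit := by
    have := congrArg (Algebra.TensorProduct.map (AlgHom.id K K) p) h.map_counit
    rw [map_one] at this
    rw [← this, ← AlgHom.comp_apply, ← AlgHom.comp_apply, ← Algebra.TensorProduct.map_comp,
      ← Algebra.TensorProduct.map_comp]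
    rfl
  map_comul := by
    have := congrArg (Algebra.TensorProduct.map (AlgHom.id K (H ⊗[K] H)) p) h.map_comul
    rw [map_mul] at this
    simp only [← AlgHom.comp_apply, ← Algebra.TensorProduct.map_comp] at this ⊢
    exact this
  cross a := by
    have := congrArg (Algebra.TensorProduct.map (AlgHom.id K H) p) (h.cross a)
    rw [map_mul, map_mul] at this
    simp only [← AlgHom.comp_apply, ← Algebra.TensorProduct.map_comp] at this ⊢
    exact this

theorem pairDual_one : pairDual w 1 = 1 := by
  have h1 := congrArg (TensorProduct.lid K B) h.map_counit
  rw [Algebra.TensorProduct.one_def, lid_tmul, one_smul] at h1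
  rw [← h1]
  clear h1 h
  induction w with
  | zero => simp [pairDual_zero]
  | tmul a b => simp [pairDual_tmul]
  | add x y hx hy => simp only [pairDual_add, map_add, hx, hy]

/-- Pair the first two legs of `(Δ ⊗ id)(w) = w₁₃ w₂₃` with `f ⊗ g`. -/
theorem pairDual_mul (f g : HopfDual K H) : pairDual w (f * g) = pairDual w f * pairDual w g := by
  let Q : (H ⊗[K] H) ⊗[K] B →ₗ[K] B := (TensorProduct.lid K B).toLinearMap ∘ₗ
    (mul' K K ∘ₗ TensorProduct.map f.ofConv g.ofConv).rTensor B
  have h1 := congrArg Q h.map_comul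
  have h2 : ∀ t : H ⊗[K] B, Q (Algebra.TensorProduct.map (Bialgebra.comulAlgHom K H)
      (AlgHom.id K B) t) = pairDual t (f * g) := by
    intro t
    induction t with
    | zero => simp [pairDual_zero]
    | tmul a b => simp [Q, pairDual_tmul, convMul_apply]
    | add x y hx hy => simp only [pairDual_add, map_add, hx, hy]
  have h3 : ∀ s t : H ⊗[K] B, Q (Algebra.TensorProduct.map (inl K H H) (AlgHom.id K B) s *
      Algebra.TensorProduct.map (inr K H H) (AlgHom.id K B) t) = pairDual s f * pairDual t g := by
    intro s t
    induction s with
    | zero => simp [pairDual_zero]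
    | tmul a b =>
      induction t with
      | zero => simp [pairDual_zero]
      | tmul c d => simp [Q, pairDual_tmul, smul_smul, mul_comm]
      | add x y hx hy => simp only [pairDual_add, map_add, mul_add, hx, hy]
    | add x y hx hy => simp only [pairDual_add, map_add, add_mul, hx, hy]
  rw [h2, h3] at h1
  exact h1

variable [FiniteDimensional K H]

/-- This is the straightening relation of `D(H)` transported to `B`, obtained from the `cross` axiom
by multiplying with `S⁻¹(a₃)` on the left of the first leg. It is what makes `lift` multiplicative.
-/
theorem lift_doubleXZY (a : H) (g : HopfDual K H) :
    mul' K B (TensorProduct.map (pairDual w) φ.toLinearMap (doubleXZY K H a (g ⊗ₜ 1))) =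
      φ a * pairDual w g := by
  -- `G z m = (g ⊗ 1) ((S⁻¹(z) ⊗ 1) m)`
  let G : H →ₗ[K] H ⊗[K] B →ₗ[K] B := LinearMap.mk₂ K
    (fun z m => pairDual ((antipodeInv K z ⊗ₜ 1) * m) g)
    (by intros; simp [add_tmul, add_mul, pairDual_add])
    (by intros; simp [← smul_tmul', pairDual_apply])
    (by intros; simp [mul_add, pairDual_add]) (by intros; simp [pairDual_apply])
  have hG : ∀ z m, G z m = pairDual ((antipodeInv K z ⊗ₜ 1) * m) g := fun _ _ => rfl
  let Q : H ⊗[K] (H ⊗[K] H) →ₗ[K] B := TensorProduct.lift G.flip ∘ₗ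
    (LinearMap.mulLeft K w ∘ₗ (φ.toLinearMap).lTensor H).rTensor H ∘ₗ
    (TensorProduct.assoc K H H H).symm.toLinearMap
  have hQ : ∀ x y z, Q (x ⊗ₜ (y ⊗ₜ z)) = G z (w * (x ⊗ₜ φ y)) := fun _ _ _ => rfl
  let Q' : H ⊗[K] (H ⊗[K] H) →ₗ[K] B := TensorProduct.lift G.flip ∘ₗ
    (LinearMap.mulRight K w ∘ₗ (φ.toLinearMap).lTensor H ∘ₗ
      (TensorProduct.comm K H H).toLinearMap).rTensor H ∘ₗ
    (TensorProduct.assoc K H H H).symm.toLinearMap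
  have hQ' : ∀ x y z, Q' (x ⊗ₜ (y ⊗ₜ z)) = G z ((y ⊗ₜ φ x) * w) := fun _ _ _ => rfl
  have hw : ∀ (z x : H) (b : B) (w : H ⊗[K] B),
      pairDual w (dualRightTranslation K H x (dualLeftTranslation K H z g)) * b =
      pairDual ((antipodeInv K z ⊗ₜ 1) * (w * (x ⊗ₜ b))) g := by
    intro z x b w
    induction w with
    | zero => simp [pairDual_zero]
    | tmul c d => simp [pairDual_tmul]
    | add x y hx hy => simp only [pairDual_add, add_mul, mul_add, hx, hy]
  have h1 : mul' K B (TensorProduct.map (pairDual w) φ.toLinearMap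
      (doubleXZY K H a (g ⊗ₜ 1))) = Q (comul.lTensor H (comul a)) := by
    rw [doubleXZY_apply]
    induction comul (R := K) a with
    | zero => simp
    | tmul x d =>
      rw [Algebra.TensorProduct.lift_tmul, doubleZY_apply, lTensor_tmul]
      induction comul (R := K) d with
      | zero => simp
      | tmul y z =>
        rw [Algebra.TensorProduct.lift_tmul, hQ, hG, ← hw]
        simp
      | add y z hy hz => simp only [map_add, mul_add, LinearMap.add_apply, tmul_add, hy, hz]
    | add x y hx hy => simp only [map_add, LinearMap.add_apply, hx, hy]
  -- The `cross` axiom moves `w` past the coproduct of the first factor.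
  have h2 : ∀ t, Q (TensorProduct.assoc K H H H (comul.rTensor H t)) =
      Q' (TensorProduct.assoc K H H H (comul.rTensor H t)) := by
    intro t
    induction t with
    | zero => simp
    | tmul x z =>
      have e1 : ∀ s, Q (TensorProduct.assoc K H H H (s ⊗ₜ z)) =
          G z (w * Algebra.TensorProduct.map (AlgHom.id K H) φ s) := by
        intro s
        induction s with
        | zero => simp
        | tmul c d => simp [hQ]
        | add x y hx hy => simp only [map_add, add_tmul, mul_add, hx, hy]
      have e2 : ∀ s, Q' (TensorProduct.assoc K H H H (s ⊗ₜ z)) =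
          G z (Algebra.TensorProduct.map (AlgHom.id K H) φ (TensorProduct.comm K H H s) * w) := by
        intro s
        induction s with
        | zero => simp
        | tmul c d => simp [hQ']
        | add x y hx hy => simp only [map_add, add_tmul, add_mul, hx, hy]
      rw [rTensor_tmul, e1, e2, h.cross]
    | add x y hx hy => simp only [map_add, hx, hy]
  -- After regrouping, `∑ S⁻¹(a₃) a₂` collapses to a counit, and `φ(a₁)` is left outside `w`.
  have h3 : ∀ t, Q' (comul.lTensor H t) =
      φ (TensorProduct.rid K H (counit.lTensor H t)) * pairDual w g := by
    intro t
    induction t with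
    | zero => simp
    | tmul x y =>
      have e : ∀ s, Q' (x ⊗ₜ s) = pairDual ((mul' K H ((antipodeInv K).rTensor H
          (TensorProduct.comm K H H s)) ⊗ₜ φ x) * w) g := by
        intro s
        induction s with
        | zero => simp [pairDual_zero]
        | tmul c d => simp [hQ', hG, ← mul_assoc]
        | add x y hx hy => simp only [map_add, tmul_add, add_tmul, add_mul, pairDual_add, hx, hy]
      rw [lTensor_tmul, e, mul_antipodeInv_rTensor_comm_comul, Algebra.algebraMap_eq_smul_one,
        smul_tmul, pairDual_one_tmul_mul]
      simp
    | add x y hx hy => simp only [map_add, add_mul, hx, hy]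
  rw [h1, ← coassoc_apply, h2, coassoc_apply, h3]
  simp

/-- The homomorphism from the Drinfeld double given by a pair. -/
noncomputable def lift : DrinfeldDouble K H →ₐ[K] B :=
  AlgHom.ofLinearMap (mul' K B ∘ₗ TensorProduct.map (pairDual w) φ.toLinearMap ∘ₗ
      (DrinfeldDouble.equivTensor K H).toLinearMap)
    (by
      rw [DrinfeldDouble.one_def]
      simp [h.pairDual_one])
    (fun x y => by
      simp only [DrinfeldDouble.mul_def, LinearMap.comp_apply, LinearEquiv.coe_coe,
        LinearEquiv.apply_symm_apply]
      generalize DrinfeldDouble.equivTensor K H x = s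
      generalize DrinfeldDouble.equivTensor K H y = t
      induction s with
      | zero => simp
      | tmul f a =>
        induction t with
        | zero => simp
        | tmul g b =>
          have e1 : ∀ z, mul' K B (TensorProduct.map (pairDual w) φ.toLinearMap
              (doubleF K H f z)) = pairDual w f * mul' K B (TensorProduct.map (pairDual w)
                φ.toLinearMap z) := by
            intro z
            induction z with
            | zero => simp
            | tmul c d => simp [h.pairDual_mul, mul_assoc]
            | add x y hx hy => simp only [map_add, mul_add, hx, hy]
          have e2 : ∀ z, mul' K B (TensorProduct.map (pairDual w) φ.toLinearMap
              (lTensor _ (mulRight K b) z)) = mul' K B (TensorProduct.map (pairDual w)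
                φ.toLinearMap z) * φ b := by
            intro z
            induction z with
            | zero => simp
            | tmul c d => simp [mul_assoc]
            | add x y hx hy => simp only [map_add, add_mul, hx, hy]
          rw [doubleMul_tmul, Module.End.mul_apply, e1, doubleXZY_tmul, e2, h.lift_doubleXZY]
          simp [mul_assoc]
        | add x y hx hy => simp only [map_add, mul_add, hx, hy]
      | add x y hx hy => simp only [map_add, add_mul, LinearMap.add_apply, hx, hy])

theorem lift_ofHopf (a : H) : h.lift (DrinfeldDouble.ofHopf K H a) = φ a := by
  change mul' K B (TensorProduct.map (pairDual w) φ.toLinearMap (1 ⊗ₜ a)) = φ a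
  simp [h.pairDual_one]

theorem lift_ofDual (f : HopfDual K H) : h.lift (DrinfeldDouble.ofDual K H f) = pairDual w f := by
  change mul' K B (TensorProduct.map (pairDual w) φ.toLinearMap (f ⊗ₜ 1)) = pairDual w f
  simp

end IsDoublePair

end DoublePair

end HopfQuasi

namespace HopfQuasi

open TensorProduct Coalgebra HopfAlgebra LinearMap WithConv

/-! ### Intertwiners for convolutions. -/

section Intertwine

variable {K : Type*} [Field K] {A E : Type*} [Ring A] [Bialgebra K A] [Semiring E] [Algebra K E]

theorem mul_star_left {p q r : A →ₐ[K] E} (hpq : Comm p q) (hrq : Comm r q) (z : E)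
    (hz : ∀ x, z * p x = r x * z) (hzq : ∀ x, Commute z (q x)) (x : A) :
    z * star p q hpq x = star r q hrq x * z := by
  simp only [star_apply]
  induction comul (R := K) x with
  | zero => simp
  | tmul a b => rw [ev_tmul, ev_tmul, ← mul_assoc, hz, mul_assoc, (hzq b).eq, mul_assoc]
  | add a b ha hb => simp only [map_add, mul_add, add_mul, ha, hb]

theorem mul_star_right {p q r : A →ₐ[K] E} (hpq : Comm p q) (hpr : Comm p r) (z : E)
    (hz : ∀ x, z * q x = r x * z) (hzp : ∀ x, Commute z (p x)) (x : A) :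
    z * star p q hpq x = star p r hpr x * z := by
  simp only [star_apply]
  induction comul (R := K) x with
  | zero => simp
  | tmul a b => rw [ev_tmul, ev_tmul, ← mul_assoc, (hzp a).eq, mul_assoc, hz, ← mul_assoc]
  | add a b ha hb => simp only [map_add, mul_add, add_mul, ha, hb]

theorem algHom_star {F : Type*} [Semiring F] [Algebra K F] (f : E →ₐ[K] F) {p q : A →ₐ[K] E}
    (hpq : Comm p q) (hpq' : Comm (f.comp p) (f.comp q)) :
    f.comp (star p q hpq) = star (f.comp p) (f.comp q) hpq' := by
  ext x
  rw [AlgHom.comp_apply, star_apply, star_apply, algHom_ev]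

end Intertwine

/-! ### The canonical element of `H ⊗ D(H)` and its universal property. -/

namespace DrinfeldDouble

variable {K : Type v} {H : Type u} [Field K] [Ring H] [HopfAlgebra K H] [FiniteDimensional K H]

variable (K H) in
/-- The inclusion of `H` into `D(H)` as a homomorphism of algebras. -/
noncomputable def ofHopfHom : H →ₐ[K] DrinfeldDouble K H :=
  AlgHom.ofLinearMap (ofHopf K H) rfl fun a b => by
    change (equivTensor K H).symm (1 ⊗ₜ (a * b)) =
      (equivTensor K H).symm (doubleMul K H (1 ⊗ₜ a) (1 ⊗ₜ b))
    rw [doubleMul_tmul, map_one, one_mul, doubleXZY_tmul]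
    have := doubleMul_apply_one (K := K) (H := H) (1 ⊗ₜ a)
    rw [doubleMul_tmul, map_one, one_mul] at this
    rw [this]
    simp

@[simp] theorem ofHopfHom_apply (a : H) : ofHopfHom K H a = ofHopf K H a := rfl

theorem ofDual_one : ofDual K H 1 = 1 := rfl

theorem ofHopf_one : ofHopf K H 1 = 1 := rfl

theorem ofDual_mul (f g : HopfDual K H) : ofDual K H (f * g) = ofDual K H f * ofDual K H g := by
  change (equivTensor K H).symm ((f * g) ⊗ₜ 1) =
      (equivTensor K H).symm (doubleMul K H (f ⊗ₜ 1) (g ⊗ₜ 1))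
  simp

theorem ofHopf_mul_ofDual (a : H) (f : HopfDual K H) : ofHopf K H a * ofDual K H f =
    (equivTensor K H).symm (doubleXZY K H a (f ⊗ₜ 1)) := by
  change (equivTensor K H).symm (doubleMul K H (1 ⊗ₜ a) (f ⊗ₜ 1)) = _
  simp

/-- Every element of `D(H)` is a sum of products `f a`. -/
theorem induction_on {P : DrinfeldDouble K H → Prop} (x : DrinfeldDouble K H)
    (h0 : P 0) (h1 : ∀ f a, P (ofDual K H f * ofHopf K H a))
    (h2 : ∀ x y, P x → P y → P (x + y)) : P x := by
  rw [← (equivTensor K H).symm_apply_apply x]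
  induction equivTensor K H x with
  | zero => simpa using h0
  | tmul f a => rw [← ofDual_mul_ofHopf]; exact h1 f a
  | add x y hx hy => rw [map_add]; exact h2 _ _ hx hy

variable (K H) in
/-- The canonical element `∑ hᵢ ⊗ hᵢ^*` of `H ⊗ D(H)`. -/
noncomputable def canonical : H ⊗[K] DrinfeldDouble K H :=
  ∑ i, Module.finBasis K H i ⊗ₜ ofDual K H (cobasis i)

theorem pairDual_sum {B ι : Type*} [Semiring B] [Algebra K B] (s : Finset ι) (t : ι → H ⊗[K] B)
    (f : HopfDual K H) : pairDual (∑ i ∈ s, t i) f = ∑ i ∈ s, pairDual (t i) f := by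
  simp [pairDual_apply]

theorem pairDual_canonical (f : HopfDual K H) : pairDual (canonical K H) f = ofDual K H f := by
  rw [canonical, pairDual_sum]
  simp only [pairDual_tmul]
  conv_rhs => rw [← sum_apply_cobasis f]
  rw [map_sum]
  simp only [map_smul]

theorem ext_pairDual {B : Type*} [Semiring B] [Algebra K B] {s t : H ⊗[K] B}
    (h : ∀ f, pairDual s f = pairDual t f) : s = t := by
  have key : ∀ s : H ⊗[K] B, s = ∑ i, Module.finBasis K H i ⊗ₜ pairDual s (cobasis i) := by
    intro s
    induction s with
    | zero => simp [pairDual_zero]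
    | tmul a b =>
      conv_lhs => rw [← (Module.finBasis K H).sum_repr a, sum_tmul]
      simp only [pairDual_tmul, tmul_smul, smul_tmul']
      rfl
    | add x y hx hy => simp only [pairDual_add, tmul_add, Finset.sum_add_distrib, ← hx, ← hy]
  rw [key s, key t]
  simp only [h]

variable (K H) in
/-- The map `(f, c) ↦ f(c ?)`. -/
noncomputable def lTrans : HopfDual K H →ₗ[K] H →ₗ[K] HopfDual K H :=
  LinearMap.mk₂ K (fun f c => toConv (f.ofConv ∘ₗ mulLeft K c))
    (by intros; ext; simp) (by intros; ext; simp)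
    (by intros; ext; simp [add_mul]) (by intros; ext; simp)

@[simp] theorem lTrans_apply (f : HopfDual K H) (c x : H) : lTrans K H f c x = f (c * x) := rfl

theorem lTrans_one (f : HopfDual K H) : lTrans K H f 1 = f := by
  ext x; simp

theorem dualLeftTranslation_lTrans (f : HopfDual K H) (c z : H) :
    dualLeftTranslation K H z (lTrans K H f c) = lTrans K H f (c * antipodeInv K z) := by
  ext x; simp [mul_assoc]

/-- The map `b ⊗ c ↦ Y(b) (f(c ?) ⊗ 1)`. -/
noncomputable def leftTranslateLift (f : HopfDual K H)
    (Y : H →ₗ[K] Module.End K (HopfDual K H ⊗[K] H)) : H ⊗[K] H →ₗ[K] HopfDual K H ⊗[K] H :=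
  TensorProduct.lift (LinearMap.lcomp K _
    ((TensorProduct.mk K (HopfDual K H) H).flip 1 ∘ₗ lTrans K H f) ∘ₗ Y)

/-- The left side is `∑ f(y₃ S⁻¹(y₂) ?) ⊗ y₁`, in which `∑ y₃ S⁻¹(y₂)` collapses to a counit. -/
theorem sum_doubleZY (y : H) (f : HopfDual K H) :
    leftTranslateLift f (doubleZY K H).toLinearMap (comul y) = f ⊗ₜ y := by
  let N := leftTranslateLift f (doubleZY K H).toLinearMap
  let Q : H ⊗[K] (H ⊗[K] H) →ₗ[K] HopfDual K H ⊗[K] H := (TensorProduct.comm K _ _).toLinearMap ∘ₗ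
    (lTrans K H f ∘ₗ mul' K H ∘ₗ (antipodeInv K).lTensor H ∘ₗ
      (TensorProduct.comm K H H).toLinearMap).lTensor H
  have h1 : ∀ t, N t = Q (TensorProduct.assoc K H H H (comul.rTensor H t)) := by
    intro t
    induction t with
    | zero => simp
    | tmul d c =>
      have : N (d ⊗ₜ c) = doubleZY K H d (lTrans K H f c ⊗ₜ 1) := rfl
      rw [this, doubleZY_apply, rTensor_tmul]
      induction comul (R := K) d with
      | zero => simp
      | tmul y z => simp [Q, dualLeftTranslation_lTrans]
      | add x y hx hy => simp only [map_add, LinearMap.add_apply, add_tmul, hx, hy]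
    | add x y hx hy => simp only [map_add, hx, hy]
  have h2 : ∀ t, Q (comul.lTensor H t) = f ⊗ₜ TensorProduct.rid K H (counit.lTensor H t) := by
    intro t
    induction t with
    | zero => simp
    | tmul x y =>
      simp only [Q, LinearMap.comp_apply, lTensor_tmul, LinearEquiv.coe_coe,
        mul_antipodeInv_lTensor_comm_comul]
      simp [Algebra.algebraMap_eq_smul_one, lTrans_one, smul_tmul]
    | add x y hx hy => simp only [map_add, tmul_add, hx, hy]
  refine (h1 _).trans ?_
  rw [coassoc_apply, h2]
  simp

/-- The relation `∑ a₁ f(a₂ ?) = ∑ f(? a₁) a₂` of the double. -/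
theorem sum_doubleXZY (a : H) (f : HopfDual K H) :
    leftTranslateLift f (doubleXZY K H).toLinearMap (comul a) = (rTrans f).rTensor H (comul a) := by
  let N := leftTranslateLift f (doubleZY K H).toLinearMap
  let W : H ⊗[K] (H ⊗[K] H) →ₗ[K] HopfDual K H ⊗[K] H :=
    TensorProduct.lift (LinearMap.lcomp K _ N ∘ₗ (doubleX K H).toLinearMap)
  have h1 : ∀ t, leftTranslateLift f (doubleXZY K H).toLinearMap t =
      W (TensorProduct.assoc K H H H (comul.rTensor H t)) := by
    intro t
    induction t with
    | zero => simp
    | tmul b c =>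
      have : ∀ x d, W (x ⊗ₜ[K] (d ⊗ₜ[K] c)) =
        doubleX K H x (doubleZY K H d (lTrans K H f c ⊗ₜ 1)) := fun _ _ => rfl
      change doubleXZY K H b (lTrans K H f c ⊗ₜ 1) = _
      rw [doubleXZY_apply, rTensor_tmul]
      induction comul (R := K) b with
      | zero => simp
      | tmul y z => simp [this]
      | add x y hx hy => simp only [map_add, LinearMap.add_apply, add_tmul, hx, hy]
    | add x y hx hy => simp only [map_add, hx, hy]
  have h2 : ∀ t, W (comul.lTensor H t) = (rTrans f).rTensor H t := by
    intro t
    induction t with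
    | zero => simp
    | tmul x y =>
      change doubleX K H x (N (comul y)) = _
      rw [sum_doubleZY]
      rfl
    | add x y hx hy => simp only [map_add, hx, hy]
  rw [h1, coassoc_apply, h2]

/-- The three axioms encode the unit and the product of `H^*` and the commutation rule between `H`
and `H^*`; the last is checked by pairing the first leg with each functional. -/
theorem isDoublePair_canonical : IsDoublePair (ofHopfHom K H) (canonical K H) where
  map_counit := by
    have : Algebra.TensorProduct.map (Bialgebra.counitAlgHom K H) (AlgHom.id K _)
        (canonical K H) = 1 ⊗ₜ pairDual (canonical K H) 1 := by
      generalize canonical K H = w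
      induction w with
      | zero => simp [pairDual_zero]
      | tmul a b => simp [pairDual_tmul, smul_tmul', ← smul_tmul]
      | add x y hx hy => simp only [map_add, pairDual_add, tmul_add, hx, hy]
    rw [this, pairDual_canonical]
    rfl
  map_comul := by
    let G : HopfDual K H →ₗ[K] H →ₗ[K] H →ₗ[K] (H ⊗[K] H) ⊗[K] DrinfeldDouble K H :=
      (TensorProduct.lcurry (RingHom.id K) H H _) ∘ₗ
        (TensorProduct.mk K (H ⊗[K] H) _).flip ∘ₗ ofDual K H
    have hG : ∀ f c d, G f c d = (c ⊗ₜ d) ⊗ₜ ofDual K H f := fun _ _ _ => rfl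
    have h1 := contraction G
    have h2 : ∀ f t, TensorProduct.lift (G f) t = t ⊗ₜ ofDual K H f := by
      intro f t
      induction t with
      | zero => simp
      | tmul a b => simp [hG]
      | add x y hx hy => simp only [map_add, add_tmul, hx, hy]
    simp only [h2, hG] at h1
    simp only [canonical, map_sum, Finset.sum_mul_sum, Algebra.TensorProduct.map_tmul]
    refine h1.trans ?_
    simp [ofDual_mul]
  cross a := by
    refine ext_pairDual fun f => ?_
    have h1 := congrArg (equivTensor K H).symm (sum_doubleXZY a f)
    have e1 : ∀ t : H ⊗[K] H, pairDual (canonical K H * Algebra.TensorProduct.map (AlgHom.id K H)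
        (ofHopfHom K H) t) f = (equivTensor K H).symm ((rTrans f).rTensor H t) := by
      intro t
      induction t with
      | zero => simp [pairDual_zero]
      | tmul b c =>
        have : pairDual (canonical K H * (b ⊗ₜ ofHopf K H c)) f =
            pairDual (canonical K H) (rTrans f b) * ofHopf K H c := by
          generalize canonical K H = w
          induction w with
          | zero => simp [pairDual_zero]
          | tmul x y => simp [pairDual_tmul, rTrans]
          | add x y hx hy => simp only [add_mul, pairDual_add, hx, hy]
        rw [Algebra.TensorProduct.map_tmul, rTensor_tmul, ← ofDual_mul_ofHopf, ← pairDual_canonical]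
        exact this
      | add x y hx hy => simp only [map_add, mul_add, pairDual_add, hx, hy]
    have e2 : ∀ t : H ⊗[K] H, pairDual (Algebra.TensorProduct.map (AlgHom.id K H)
        (ofHopfHom K H) (TensorProduct.comm K H H t) * canonical K H) f =
        (equivTensor K H).symm (leftTranslateLift f (doubleXZY K H).toLinearMap t) := by
      intro t
      induction t with
      | zero => simp [pairDual_zero]
      | tmul b c =>
        have : pairDual ((c ⊗ₜ ofHopf K H b) * canonical K H) f =
            ofHopf K H b * pairDual (canonical K H) (lTrans K H f c) := by
          generalize canonical K H = w
          induction w with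
          | zero => simp [pairDual_zero]
          | tmul x y => simp [pairDual_tmul]
          | add x y hx hy => simp only [mul_add, pairDual_add, hx, hy]
        refine this.trans ?_
        rw [pairDual_canonical, ofHopf_mul_ofDual]
        rfl
      | add x y hx hy => simp only [map_add, add_mul, pairDual_add, hx, hy]
    rw [e1, e2, h1]

/-- `D(H)` is spanned by products `f a`, and each `f` is a contraction of the canonical element.
Identities of homomorphisms are therefore checked on `H` and on one tensor. -/
theorem algHom_ext {B : Type*} [Semiring B] [Algebra K B] {p q : DrinfeldDouble K H →ₐ[K] B}
    (h1 : p.comp (ofHopfHom K H) = q.comp (ofHopfHom K H))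
    (h2 : Algebra.TensorProduct.map (AlgHom.id K H) p (canonical K H) =
      Algebra.TensorProduct.map (AlgHom.id K H) q (canonical K H)) : p = q := by
  ext x
  induction x using induction_on with
  | h0 => simp
  | h1 f a =>
    rw [map_mul, map_mul, ← pairDual_canonical, algHom_pairDual, algHom_pairDual, h2]
    exact congrArg _ (DFunLike.congr_fun h1 a)
  | h2 x y hx hy => rw [map_add, map_add, hx, hy]

/-- The image of the canonical element under a homomorphism `p`. -/
noncomputable abbrev canon {E : Type*} [Semiring E] [Algebra K E] (p : DrinfeldDouble K H →ₐ[K] E) :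
    H ⊗[K] E := Algebra.TensorProduct.map (AlgHom.id K H) p (canonical K H)

theorem map_lift_canonical {B : Type*} [Semiring B] [Algebra K B] {φ : H →ₐ[K] B} {w : H ⊗[K] B}
    (h : IsDoublePair φ w) : canon h.lift = w :=
  ext_pairDual fun f => by rw [← algHom_pairDual, pairDual_canonical, h.lift_ofDual]

theorem lift_comp_ofHopfHom {B : Type*} [Semiring B] [Algebra K B] {φ : H →ₐ[K] B} {w : H ⊗[K] B}
    (h : IsDoublePair φ w) : h.lift.comp (ofHopfHom K H) = φ :=
  AlgHom.ext fun a => h.lift_ofHopf a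

theorem map_canon {E F : Type*} [Semiring E] [Algebra K E] [Semiring F] [Algebra K F]
    (f : E →ₐ[K] F) (p : DrinfeldDouble K H →ₐ[K] E) :
    Algebra.TensorProduct.map (AlgHom.id K H) f (canon p) = canon (f.comp p) := by
  simp only [canon, ← AlgHom.comp_apply, ← Algebra.TensorProduct.map_comp]
  rfl

section EvCanonical

variable {E : Type*} [Semiring E] [Algebra K E] {α β : H →ₐ[K] E} {p : DrinfeldDouble K H →ₐ[K] E}

theorem ev_star_canonical (hαβ : Comm α β) (hα : Comm α p) (hβ : Comm β p) :
    ev (star α β hαβ) p (canonical K H) = ev α p (canonical K H) * ev β p (canonical K H) := by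
  have hc : Comm (Algebra.TensorProduct.lift α β hαβ) p := fun a b => by
    rw [lift_eq_ev]; exact hα.commute_ev hβ a b
  have := congrArg (ev (Algebra.TensorProduct.lift α β hαβ) p)
    (isDoublePair_canonical (K := K) (H := H)).map_comul
  rw [ev_mul hc, ev_map, ev_map, ev_map] at this
  refine this.trans ?_
  congr 2 <;> ext <;> simp

theorem ev_canonical_mul_star (hα : Comm α p) (a : H) :
    ev α p (canonical K H) * star α (p.comp (ofHopfHom K H)) (hα.comp_right _) a =
      star (p.comp (ofHopfHom K H)) α (hα.comp_right _).symm a * ev α p (canonical K H) := by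
  have := congrArg (ev α p) ((isDoublePair_canonical (K := K) (H := H)).cross a)
  rw [ev_mul hα, ev_mul hα, ev_map, ev_map] at this
  rw [star_apply, star_apply]
  refine this.trans ?_
  congr 1
  exact (ev_comm (hα.comp_right (ofHopfHom K H)).symm _)

end EvCanonical

end DrinfeldDouble

end HopfQuasi

namespace HopfQuasi

open TensorProduct Coalgebra HopfAlgebra LinearMap WithConv

/-! ### The bialgebra structure of the Drinfeld double. -/

namespace DrinfeldDouble

variable {K : Type v} {H : Type u} [Field K] [Ring H] [HopfAlgebra K H] [FiniteDimensional K H]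

section Star

variable {E : Type*} [Semiring E] [Algebra K E]

theorem canon_eq_ev (p : DrinfeldDouble K H →ₐ[K] E) : canon p =
    ev (Algebra.TensorProduct.includeLeft : H →ₐ[K] H ⊗[K] E)
      ((Algebra.TensorProduct.includeRight : E →ₐ[K] H ⊗[K] E).comp p) (canonical K H) := by
  rw [canon, map_eq_ev]
  rfl

theorem comm_include {B : Type*} [Ring B] [Algebra K B] (p : B →ₐ[K] E) :
    Comm (Algebra.TensorProduct.includeLeft : H →ₐ[K] H ⊗[K] E)
      ((Algebra.TensorProduct.includeRight : E →ₐ[K] H ⊗[K] E).comp p) := fun a b => by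
  simp [Commute, SemiconjBy]

theorem map_comul_eq_star (φ : H →ₐ[K] E) (a : H) :
    Algebra.TensorProduct.map (AlgHom.id K H) φ (comul a) =
      star (Algebra.TensorProduct.includeLeft : H →ₐ[K] H ⊗[K] E)
        ((Algebra.TensorProduct.includeRight : E →ₐ[K] H ⊗[K] E).comp φ) (comm_include φ) a := by
  rw [star_apply, map_eq_ev]
  rfl

theorem map_comm_comul_eq_star (φ : H →ₐ[K] E) (a : H) :
    Algebra.TensorProduct.map (AlgHom.id K H) φ (TensorProduct.comm K H H (comul a)) =
      star ((Algebra.TensorProduct.includeRight : E →ₐ[K] H ⊗[K] E).comp φ)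
        (Algebra.TensorProduct.includeLeft : H →ₐ[K] H ⊗[K] E) (comm_include φ).symm a := by
  rw [star_apply, map_eq_ev]
  exact ev_comm (comm_include φ).symm _

/-- The pair defining the tensor product of two homomorphisms from `D(H)`. -/
theorem isDoublePair_star {p q : DrinfeldDouble K H →ₐ[K] E} (h : Comm p q) :
    IsDoublePair (star (p.comp (ofHopfHom K H)) (q.comp (ofHopfHom K H))
      ((h.comp_left _).comp_right _)) (canon q * canon p) where
  map_counit := by
    rw [map_mul, (isDoublePair_canonical.map p).map_counit,
      (isDoublePair_canonical.map q).map_counit, one_mul]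
  map_comul := by
    -- These two factors have distinct legs in `H ⊗ H` and commuting images in `E`; exchanging them
    -- is all that multiplicativity needs.
    have hc : Commute (Algebra.TensorProduct.map (inr K H H) (AlgHom.id K E) (canon q))
        (Algebra.TensorProduct.map (inl K H H) (AlgHom.id K E) (canon p)) := by
      simp only [canon, ← AlgHom.comp_apply, ← Algebra.TensorProduct.map_comp]
      rw [map_eq_ev, map_eq_ev]
      refine Comm.commute_ev_ev ?_ ?_ ?_ ?_ _ _
      · intro a b; simp [Commute, SemiconjBy]
      · intro a b; simp [Commute, SemiconjBy]
      · intro a b; simp [Commute, SemiconjBy]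
      · intro a b; simp [Commute, SemiconjBy, (h b a).eq]
    rw [map_mul, map_mul, map_mul, (isDoublePair_canonical.map p).map_comul,
      (isDoublePair_canonical.map q).map_comul]
    simp only [mul_assoc]
    congr 1
    simp only [← mul_assoc]
    rw [hc.eq]
  cross a := by
    have hpq : Comm (p.comp (ofHopfHom K H)) (q.comp (ofHopfHom K H)) :=
      (h.comp_left _).comp_right _
    rw [map_comul_eq_star, map_comm_comul_eq_star, canon_eq_ev, canon_eq_ev]
    let α : H →ₐ[K] H ⊗[K] E := Algebra.TensorProduct.includeLeft
    let ι : E →ₐ[K] H ⊗[K] E := Algebra.TensorProduct.includeRight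
    let p' := ι.comp p
    let q' := ι.comp q
    let φ := p'.comp (ofHopfHom K H)
    let ψ := q'.comp (ofHopfHom K H)
    have hαp : Comm α p' := comm_include p
    have hαq : Comm α q' := comm_include q
    have hpq' : Comm p' q' := h.map ι
    have hφψ : Comm φ ψ := (hpq'.comp_left _).comp_right _
    have hαφ : Comm α φ := hαp.comp_right _
    have hαψ : Comm α ψ := hαq.comp_right _
    have e1 : ι.comp (star (p.comp (ofHopfHom K H)) (q.comp (ofHopfHom K H)) hpq) =
        star φ ψ hφψ := algHom_star ι hpq hφψ
    change ev α q' (canonical K H) * ev α p' (canonical K H) * star α (ι.comp (star _ _ hpq)) _ a =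
      star (ι.comp (star _ _ hpq)) α _ a * (ev α q' (canonical K H) * ev α p' (canonical K H))
    simp only [e1]
    -- Associativity of `star` lets the triple convolution `α φ ψ` be reordered one neighbour at a
    -- time: `p'` swaps `α` with `φ`, then `q'` swaps `α` with `ψ`.
    have e2 : star α (star φ ψ hφψ) (hφψ.star_right hαφ hαψ) =
      star (star α φ hαφ) ψ (hαφ.star_left hαψ hφψ) := (star_assoc hαφ hαψ hφψ).symm
    have e3 : star (star φ α hαφ.symm) ψ (hαφ.symm.star_left hφψ hαψ) =
      star φ (star α ψ hαψ) (hαψ.star_right hαφ.symm hφψ) := star_assoc hαφ.symm hφψ hαψ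
    have e4 : star φ (star ψ α hαψ.symm) (hαψ.symm.star_right hφψ hαφ.symm) =
      star (star φ ψ hφψ) α (hφψ.star_left hαφ.symm hαψ.symm) :=
        (star_assoc hφψ hαφ.symm hαψ.symm).symm
    rw [e2, mul_assoc, mul_star_left (hαφ.star_left hαψ hφψ) (hαφ.symm.star_left hφψ hαψ)
      (ev α p' (canonical K H)) (ev_canonical_mul_star hαp)
      (hαψ.commute_ev (hpq'.comp_right _) _), e3, ← mul_assoc,
      mul_star_right (hαψ.star_right hαφ.symm hφψ) (hαψ.symm.star_right hφψ hαφ.symm)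
      (ev α q' (canonical K H)) (ev_canonical_mul_star hαq)
      (hαφ.commute_ev (hpq'.comp_left _).symm _), e4, mul_assoc]

end Star

variable (K H) in
/-- The inclusion of the first factor of `D(H) ⊗ D(H)`. -/
noncomputable abbrev inl₂ : DrinfeldDouble K H →ₐ[K] DrinfeldDouble K H ⊗[K] DrinfeldDouble K H :=
  inl K _ _

variable (K H) in
/-- The inclusion of the second factor of `D(H) ⊗ D(H)`. -/
noncomputable abbrev inr₂ : DrinfeldDouble K H →ₐ[K] DrinfeldDouble K H ⊗[K] DrinfeldDouble K H :=
  inr K _ _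

variable (K H) in
/-- The comultiplication of the Drinfeld double `H ⊗ H^{*cop}`. -/
noncomputable def comulHom :
    DrinfeldDouble K H →ₐ[K] DrinfeldDouble K H ⊗[K] DrinfeldDouble K H :=
  (isDoublePair_star (comm_inl_inr (K := K) (A := DrinfeldDouble K H)
    (B := DrinfeldDouble K H))).lift

theorem canon_comulHom : canon (comulHom K H) = canon (inr₂ K H) * canon (inl₂ K H) :=
  map_lift_canonical _

theorem canon_comp_comulHom {E : Type*} [Semiring E] [Algebra K E]
    (f : DrinfeldDouble K H ⊗[K] DrinfeldDouble K H →ₐ[K] E) :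
    canon (f.comp (comulHom K H)) = canon (f.comp (inr₂ K H)) * canon (f.comp (inl₂ K H)) := by
  rw [← map_canon, canon_comulHom, map_mul, map_canon, map_canon]

theorem comulHom_comp_ofHopfHom : (comulHom K H).comp (ofHopfHom K H) =
    (Algebra.TensorProduct.map (ofHopfHom K H) (ofHopfHom K H)).comp
      (Bialgebra.comulAlgHom K H) := by
  refine (lift_comp_ofHopfHom _).trans (AlgHom.ext fun a => ?_)
  rw [star_apply, AlgHom.comp_apply, map_eq_ev]
  rfl

/-- Both sides of the cross relation reduce to `a ⊗ 1` by the counit axioms. -/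
theorem isDoublePair_counit : IsDoublePair (Bialgebra.counitAlgHom K H) (1 : H ⊗[K] K) where
  map_counit := map_one _
  map_comul := by simp only [map_one, one_mul]
  cross a := by
    rw [one_mul, mul_one]
    have h1 : ∀ t : H ⊗[K] H, Algebra.TensorProduct.map (AlgHom.id K H)
        (Bialgebra.counitAlgHom K H) t = counit.lTensor H t := by
      intro t
      induction t with
      | zero => simp
      | tmul a b => simp
      | add x y hx hy => simp only [map_add, hx, hy]
    have h2 : ∀ t : H ⊗[K] H, counit.lTensor H (TensorProduct.comm K H H t) =
        TensorProduct.comm K K H (counit.rTensor H t) := by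
      intro t
      induction t with
      | zero => simp
      | tmul a b => simp
      | add x y hx hy => simp only [map_add, hx, hy]
    rw [h1, h1, h2, lTensor_counit_comul, rTensor_counit_comul]
    simp

variable (K H) in
/-- The counit of the Drinfeld double. -/
noncomputable def counitHom : DrinfeldDouble K H →ₐ[K] K := isDoublePair_counit.lift

theorem canon_counitHom : canon (counitHom K H) = 1 := map_lift_canonical _

theorem counitHom_comp_ofHopfHom :
    (counitHom K H).comp (ofHopfHom K H) = Bialgebra.counitAlgHom K H := lift_comp_ofHopfHom _

/-- On `H` this is coassociativity of `H`. On the canonical element, with `H` as leg `1`, both sides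
are `w₁₄ w₁₃ w₁₂`; the reversed order reflects the co-opposite coproduct of `H^*`. -/
theorem coassoc_comulHom : (Algebra.TensorProduct.assoc K K K _ _ _).toAlgHom.comp
      ((Algebra.TensorProduct.map (comulHom K H) (.id K _)).comp (comulHom K H)) =
    (Algebra.TensorProduct.map (.id K _) (comulHom K H)).comp (comulHom K H) := by
  refine algHom_ext ?_ ?_
  · simp only [AlgHom.comp_assoc, comulHom_comp_ofHopfHom]
    have h1 : (Algebra.TensorProduct.map (comulHom K H) (.id K _)).comp
        ((Algebra.TensorProduct.map (ofHopfHom K H) (ofHopfHom K H)).comp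
          (Bialgebra.comulAlgHom K H)) =
        ((Algebra.TensorProduct.map (Algebra.TensorProduct.map (ofHopfHom K H) (ofHopfHom K H))
          (ofHopfHom K H)).comp (Algebra.TensorProduct.map (Bialgebra.comulAlgHom K H)
            (.id K H))).comp (Bialgebra.comulAlgHom K H) := by
      rw [← AlgHom.comp_assoc, ← Algebra.TensorProduct.map_comp, ← Algebra.TensorProduct.map_comp,
        comulHom_comp_ofHopfHom]
      rfl
    have h2 : (Algebra.TensorProduct.map (.id K _) (comulHom K H)).comp
        ((Algebra.TensorProduct.map (ofHopfHom K H) (ofHopfHom K H)).comp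
          (Bialgebra.comulAlgHom K H)) =
        ((Algebra.TensorProduct.map (ofHopfHom K H) (Algebra.TensorProduct.map (ofHopfHom K H)
          (ofHopfHom K H))).comp (Algebra.TensorProduct.map
            (.id K H) (Bialgebra.comulAlgHom K H))).comp (Bialgebra.comulAlgHom K H) := by
      rw [← AlgHom.comp_assoc, ← Algebra.TensorProduct.map_comp, ← Algebra.TensorProduct.map_comp,
        comulHom_comp_ofHopfHom]
      rfl
    rw [h1, h2]
    ext a
    have h3 := congrArg (Algebra.TensorProduct.map (ofHopfHom K H) (Algebra.TensorProduct.map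
      (ofHopfHom K H) (ofHopfHom K H))) (coassoc_apply (R := K) a)
    refine Eq.trans ?_ h3
    change Algebra.TensorProduct.assoc K K K _ _ _ (Algebra.TensorProduct.map _ _
      (Algebra.TensorProduct.map _ _ (comul a))) = _
    induction comul (R := K) a with
    | zero => simp
    | tmul x y =>
      simp only [Algebra.TensorProduct.map_tmul, rTensor_tmul, Bialgebra.comulAlgHom_apply]
      induction comul (R := K) x with
      | zero => simp
      | tmul x y => simp
      | add x y hx hy => simp only [map_add, add_tmul, hx, hy]
    | add x y hx hy => simp only [map_add, hx, hy]
  · change canon _ = canon _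
    have h1 : (Algebra.TensorProduct.map (comulHom K H) (.id K _)).comp (inl₂ K H) =
        (inl K _ _).comp (comulHom K H) := by ext x; simp
    have h2 : (Algebra.TensorProduct.map (.id K _) (comulHom K H)).comp (inr₂ K H) =
        (inr K _ _).comp (comulHom K H) := by ext x; simp
    rw [← AlgHom.comp_assoc, canon_comp_comulHom, canon_comp_comulHom, h2, AlgHom.comp_assoc _ _ (inl₂ K H),
      h1, ← AlgHom.comp_assoc, canon_comp_comulHom, canon_comp_comulHom, mul_assoc]
    have k1 : ((Algebra.TensorProduct.assoc K K K _ _ _).toAlgHom.comp (inl K _ _)).comp (inl₂ K H) =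
        (Algebra.TensorProduct.map (.id K _) (comulHom K H)).comp (inl₂ K H) :=
      AlgHom.ext fun x => by simp [Algebra.TensorProduct.one_def]
    have k2 : ((Algebra.TensorProduct.assoc K K K _ _ _).toAlgHom.comp (inl K _ _)).comp (inr₂ K H) =
        (inr K (DrinfeldDouble K H) _).comp (inl₂ K H) :=
      AlgHom.ext fun x => by simp [Algebra.TensorProduct.one_def]
    have k3 : ((Algebra.TensorProduct.assoc K K K _ _ _).toAlgHom.comp
        (Algebra.TensorProduct.map (comulHom K H) (.id K _))).comp (inr₂ K H) =
        (inr K (DrinfeldDouble K H) _).comp (inr₂ K H) :=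
      AlgHom.ext fun x => by simp [Algebra.TensorProduct.one_def]
    rw [k1, k2, k3]

theorem canon_comp_counitHom {E : Type*} [Semiring E] [Algebra K E] (f : K →ₐ[K] E) :
    canon (f.comp (counitHom K H)) = 1 := by
  rw [← map_canon, canon_counitHom, map_one]

noncomputable instance : Bialgebra K (DrinfeldDouble K H) :=
  Bialgebra.ofAlgHom (comulHom K H) (counitHom K H) coassoc_comulHom
    (by
      refine algHom_ext ?_ ?_
      · rw [AlgHom.comp_assoc, comulHom_comp_ofHopfHom, ← AlgHom.comp_assoc,
          ← Algebra.TensorProduct.map_comp, counitHom_comp_ofHopfHom]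
        ext a
        have h := congrArg (Algebra.TensorProduct.map (AlgHom.id K K) (ofHopfHom K H))
          (rTensor_counit_comul (R := K) a)
        refine Eq.trans ?_ h
        change Algebra.TensorProduct.map _ _ (comul a) = _
        induction comul (R := K) a with
        | zero => simp
        | tmul x y => simp
        | add x y hx hy => simp only [map_add, hx, hy]
      · change canon _ = canon _
        have h1 : (Algebra.TensorProduct.map (counitHom K H) (.id K _)).comp (inl₂ K H) =
          (Algebra.TensorProduct.includeLeft).comp (counitHom K H) := by ext x; simp
        rw [canon_comp_comulHom, h1, canon_comp_counitHom, mul_one]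
        congr 1; ext x; simp)
    (by
      refine algHom_ext ?_ ?_
      · rw [AlgHom.comp_assoc, comulHom_comp_ofHopfHom, ← AlgHom.comp_assoc,
          ← Algebra.TensorProduct.map_comp, counitHom_comp_ofHopfHom]
        ext a
        have h := congrArg (Algebra.TensorProduct.map (ofHopfHom K H) (AlgHom.id K K))
          (lTensor_counit_comul (R := K) a)
        refine Eq.trans ?_ h
        change Algebra.TensorProduct.map _ _ (comul a) = _
        induction comul (R := K) a with
        | zero => simp
        | tmul x y => simp
        | add x y hx hy => simp only [map_add, hx, hy]
      · change canon _ = canon _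
        have h1 : (Algebra.TensorProduct.map (.id K _) (counitHom K H)).comp (inr₂ K H) =
          (Algebra.TensorProduct.includeRight).comp (counitHom K H) := by ext x; simp
        rw [canon_comp_comulHom, h1, canon_comp_counitHom, one_mul]
        congr 1; ext x; simp)

end DrinfeldDouble

end HopfQuasi

namespace HopfQuasi

open TensorProduct Coalgebra LinearMap WithConv

/-! ### The antipode of the Drinfeld double. -/

namespace DrinfeldDouble

variable {K : Type v} {H : Type u} [Field K] [Ring H] [HopfAlgebra K H] [FiniteDimensional K H]

theorem comulAlgHom_eq : Bialgebra.comulAlgHom K (DrinfeldDouble K H) = comulHom K H := rfl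

theorem comul_apply (x : DrinfeldDouble K H) : comul (R := K) x = comulHom K H x := rfl

theorem counit_apply (x : DrinfeldDouble K H) : counit (R := K) x = counitHom K H x := rfl

theorem ofHopf_mul (a b : H) : ofHopf K H (a * b) = ofHopf K H a * ofHopf K H b :=
  map_mul (ofHopfHom K H) a b

theorem comul_ofHopf (a : H) : comul (R := K) (ofHopf K H a) =
    TensorProduct.map (ofHopf K H) (ofHopf K H) (comul a) :=
  DFunLike.congr_fun (comulHom_comp_ofHopfHom (K := K) (H := H)) a

theorem counit_ofHopf (a : H) : counit (R := K) (ofHopf K H a) = counit (R := K) a :=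
  DFunLike.congr_fun (counitHom_comp_ofHopfHom (K := K) (H := H)) a

theorem counit_ofDual (f : HopfDual K H) : counit (R := K) (ofDual K H f) = f 1 := by
  rw [counit_apply, ← pairDual_canonical, algHom_pairDual]
  change pairDual (canon (counitHom K H)) f = _
  rw [canon_counitHom, Algebra.TensorProduct.one_def, pairDual_tmul]
  simp

variable (K H) in
/-- The coproduct of `H^{*cop}`: it maps `f` to the functional `x ⊗ y ↦ f(y x)`. -/
noncomputable def dualComul : HopfDual K H →ₗ[K] HopfDual K H ⊗[K] HopfDual K H where
  toFun f := ∑ i, ∑ j, f (Module.finBasis K H j * Module.finBasis K H i) • (cobasis i ⊗ₜ cobasis j)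
  map_add' f g := by simp [add_smul, Finset.sum_add_distrib]
  map_smul' r f := by simp [Finset.smul_sum, mul_smul]

theorem dualComul_apply (f : HopfDual K H) : dualComul K H f =
    ∑ i, ∑ j, f (Module.finBasis K H j * Module.finBasis K H i) • (cobasis i ⊗ₜ cobasis j) := rfl

theorem sum_apply_mul (f : HopfDual K H) (y z : H) :
    ∑ i, ∑ j, f (Module.finBasis K H j * Module.finBasis K H i) *
      (cobasis (K := K) i y * cobasis (K := K) j z) = f (z * y) := by
  have h1 : ∀ j, ∑ i, f (Module.finBasis K H j * Module.finBasis K H i) * cobasis (K := K) i y =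
      f (Module.finBasis K H j * y) := by
    intro j
    have := congrArg (fun g => g.ofConv y) (sum_apply_cobasis (lTrans K H f (Module.finBasis K H j)))
    simpa using this
  have h2 : ∑ j, f (Module.finBasis K H j * y) * cobasis (K := K) j z = f (z * y) := by
    have := congrArg (fun g => g.ofConv z) (sum_apply_cobasis (rTrans f y))
    simpa [rTrans] using this
  rw [Finset.sum_comm, ← h2]
  simp only [← h1, Finset.sum_mul, mul_assoc]

theorem comul_ofDual (f : HopfDual K H) : comul (R := K) (ofDual K H f) =
    TensorProduct.map (ofDual K H) (ofDual K H) (dualComul K H f) := by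
  rw [comul_apply, ← pairDual_canonical, algHom_pairDual]
  change pairDual (canon (comulHom K H)) f = _
  rw [canon_comulHom, dualComul_apply]
  simp only [canon, canonical, map_sum, Finset.sum_mul_sum, pairDual_sum]
  rw [Finset.sum_comm]
  simp [pairDual_tmul]

theorem dualAntipodeInv_ofConv (f : HopfDual K H) (x : H) :
    dualAntipodeInv K H f x = f (antipodeInv K x) := rfl

/-- Evaluated at `x`, the left side is `∑ f(x₂ S⁻¹(x₁)) = f(1) ε(x)`. -/
theorem mul_dualAntipodeInv_rTensor (f : HopfDual K H) :
    mul' K (HopfDual K H) ((dualAntipodeInv K H).rTensor _ (dualComul K H f)) = f 1 • 1 := by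
  ext x
  have h1 : ∀ s : H ⊗[K] H, ∑ i, ∑ j, f (Module.finBasis K H j * Module.finBasis K H i) *
      mul' K K (TensorProduct.map (dualAntipodeInv K H (cobasis i)).ofConv
        (cobasis (K := K) j).ofConv s) =
      f (mul' K H ((antipodeInv K).lTensor H (TensorProduct.comm K H H s))) := by
    intro s
    induction s with
    | zero => simp
    | tmul y z =>
      simp only [map_tmul, mul'_apply, comm_tmul, lTensor_tmul, dualAntipodeInv_ofConv]
      exact sum_apply_mul f _ _
    | add a b ha hb => simp only [map_add, mul_add, Finset.sum_add_distrib, ha, hb]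
  have h2 := h1 (comul x)
  rw [mul_antipodeInv_lTensor_comm_comul, Algebra.algebraMap_eq_smul_one] at h2
  rw [dualComul_apply]
  simp only [map_sum, map_smul, rTensor_tmul, mul'_apply, ofConv_sum, LinearMap.sum_apply,
    ofConv_smul, LinearMap.smul_apply, convMul_apply, smul_eq_mul]
  rw [h2]
  simp [mul_comm]

theorem mul_dualAntipodeInv_lTensor (f : HopfDual K H) :
    mul' K (HopfDual K H) ((dualAntipodeInv K H).lTensor _ (dualComul K H f)) = f 1 • 1 := by
  ext x
  have h1 : ∀ s : H ⊗[K] H, ∑ i, ∑ j, f (Module.finBasis K H j * Module.finBasis K H i) *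
      mul' K K (TensorProduct.map (cobasis (K := K) i).ofConv
        (dualAntipodeInv K H (cobasis j)).ofConv s) =
      f (mul' K H ((antipodeInv K).rTensor H (TensorProduct.comm K H H s))) := by
    intro s
    induction s with
    | zero => simp
    | tmul y z =>
      simp only [map_tmul, mul'_apply, comm_tmul, rTensor_tmul, dualAntipodeInv_ofConv]
      exact sum_apply_mul f _ _
    | add a b ha hb => simp only [map_add, mul_add, Finset.sum_add_distrib, ha, hb]
  have h2 := h1 (comul x)
  rw [mul_antipodeInv_rTensor_comm_comul, Algebra.algebraMap_eq_smul_one] at h2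
  rw [dualComul_apply]
  simp only [map_sum, map_smul, lTensor_tmul, mul'_apply, ofConv_sum, LinearMap.sum_apply,
    ofConv_smul, LinearMap.smul_apply, convMul_apply, smul_eq_mul]
  rw [h2]
  simp [mul_comm]

/-- In `∑ S(a₁) S(f₁) f₂ a₂` the two middle factors collapse first, leaving the antipode axiom of
`H`. -/
theorem mul_antipode_rTensor (f : HopfDual K H) (a : H) :
    mul' K (DrinfeldDouble K H) ((antipode K H).rTensor _
      (comul (ofDual K H f * ofHopf K H a))) = (f 1 * counit (R := K) a) • 1 := by
  have h1 : ∀ (s : HopfDual K H ⊗[K] HopfDual K H) (t : H ⊗[K] H),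
      mul' K (DrinfeldDouble K H) ((antipode K H).rTensor _
      (TensorProduct.map (ofDual K H) (ofDual K H) s *
        TensorProduct.map (ofHopf K H) (ofHopf K H) t)) =
      mul' K _ (TensorProduct.map (LinearMap.mulRight K (ofDual K H (mul' K (HopfDual K H)
        ((dualAntipodeInv K H).rTensor _ s))) ∘ₗ ofHopf K H ∘ₗ HopfAlgebra.antipode K)
          (ofHopf K H) t) := by
    intro s t
    induction s with
    | zero => simp
    | tmul f g =>
      induction t with
      | zero => simp
      | tmul a b => simp [antipode_ofDual_mul_ofHopf, ofDual_mul, mul_assoc]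
      | add x y hx hy => simp only [map_add, mul_add, hx, hy]
    | add x y hx hy =>
      rw [map_add, add_mul, map_add, map_add, hx, hy]
      clear hx hy
      induction t with
      | zero => simp
      | tmul a b => simp [mul_add, add_mul]
      | add x y hx hy => simp only [map_add] at hx hy ⊢; rw [add_add_add_comm, hx, hy]
  rw [Bialgebra.comul_mul, comul_ofDual, comul_ofHopf, h1, mul_dualAntipodeInv_rTensor, map_smul,
    ofDual_one]
  have h2 : ∀ t : H ⊗[K] H, mul' K _ (TensorProduct.map (LinearMap.mulRight K
      (f 1 • (1 : DrinfeldDouble K H)) ∘ₗ ofHopf K H ∘ₗ HopfAlgebra.antipode K)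
          (ofHopf K H) t) = f 1 • ofHopf K H (mul' K H ((HopfAlgebra.antipode K).rTensor H t)) := by
    intro t
    induction t with
    | zero => simp
    | tmul a b => simp [← ofHopfHom_apply]
    | add x y hx hy => simp only [map_add, smul_add, hx, hy]
  rw [h2, HopfAlgebra.mul_antipode_rTensor_comul_apply, Algebra.algebraMap_eq_smul_one, map_smul,
    ofHopf_one, mul_smul]

/-- In `∑ f₁ a₁ S(a₂) S(f₂)` the factors from `H` collapse first, leaving the antipode axiom of
`H^{*cop}`. -/
theorem mul_antipode_lTensor (f : HopfDual K H) (a : H) :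
    mul' K (DrinfeldDouble K H) ((antipode K H).lTensor _
      (comul (ofDual K H f * ofHopf K H a))) = (f 1 * counit (R := K) a) • 1 := by
  have h1 : ∀ (s : HopfDual K H ⊗[K] HopfDual K H) (t : H ⊗[K] H),
      mul' K (DrinfeldDouble K H) ((antipode K H).lTensor _
      (TensorProduct.map (ofDual K H) (ofDual K H) s *
        TensorProduct.map (ofHopf K H) (ofHopf K H) t)) =
      mul' K _ (TensorProduct.map (LinearMap.mulRight K (ofHopf K H (mul' K H
        ((HopfAlgebra.antipode K).lTensor _ t))) ∘ₗ ofDual K H)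
          (ofDual K H ∘ₗ dualAntipodeInv K H) s) := by
    intro s t
    induction t with
    | zero => simp
    | tmul a b =>
      induction s with
      | zero => simp
      | tmul f g => simp [antipode_ofDual_mul_ofHopf, ofHopf_mul, mul_assoc]
      | add x y hx hy => simp only [map_add, add_mul, hx, hy]
    | add x y hx hy =>
      rw [map_add, mul_add, map_add, map_add, hx, hy]
      clear hx hy
      induction s with
      | zero => simp
      | tmul a b => simp [mul_add, add_mul]
      | add x y hx hy => simp only [map_add] at hx hy ⊢; rw [add_add_add_comm, hx, hy]
  rw [Bialgebra.comul_mul, comul_ofDual, comul_ofHopf, h1,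
    HopfAlgebra.mul_antipode_lTensor_comul_apply, Algebra.algebraMap_eq_smul_one, map_smul,
    ofHopf_one]
  have h2 : ∀ s : HopfDual K H ⊗[K] HopfDual K H, mul' K _ (TensorProduct.map (LinearMap.mulRight K
      (counit (R := K) a • (1 : DrinfeldDouble K H)) ∘ₗ ofDual K H)
          (ofDual K H ∘ₗ dualAntipodeInv K H) s) =
      counit (R := K) a • ofDual K H (mul' K _ ((dualAntipodeInv K H).lTensor _ s)) := by
    intro t
    induction t with
    | zero => simp
    | tmul a b => simp [ofDual_mul]
    | add x y hx hy => simp only [map_add, smul_add, hx, hy]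
  rw [h2, mul_dualAntipodeInv_lTensor, map_smul, ofDual_one, smul_smul, mul_comm]

noncomputable instance : HopfAlgebra K (DrinfeldDouble K H) where
  antipode := antipode K H
  mul_antipode_rTensor_comul := by
    ext x
    induction x using induction_on with
    | h0 => simp
    | h1 f a =>
      simp only [LinearMap.comp_apply]
      rw [mul_antipode_rTensor, Bialgebra.counit_mul, counit_ofDual, counit_ofHopf,
        Algebra.linearMap_apply, Algebra.algebraMap_eq_smul_one]
    | h2 x y hx hy => rw [map_add, map_add, hx, hy]
  mul_antipode_lTensor_comul := by
    ext x
    induction x using induction_on with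
    | h0 => simp
    | h1 f a =>
      simp only [LinearMap.comp_apply]
      rw [mul_antipode_lTensor, Bialgebra.counit_mul, counit_ofDual, counit_ofHopf,
        Algebra.linearMap_apply, Algebra.algebraMap_eq_smul_one]
    | h2 x y hx hy => rw [map_add, map_add, hx, hy]

instance : FiniteDimensional K (HopfDual K H) :=
  Module.Finite.equiv (WithConv.linearEquiv K (Module.Dual K H)).symm

instance : FiniteDimensional K (DrinfeldDouble K H) :=
  Module.Finite.equiv (equivTensor K H).symm

/-! ### The universal `R`-matrix of the Drinfeld double. -/

theorem rMatrix_eq : rMatrix K H =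
    Algebra.TensorProduct.map (ofHopfHom K H) (AlgHom.id K _) (canonical K H) := by
  simp [rMatrix, canonical]

theorem ev_rMatrix {E : Type*} [Semiring E] [Algebra K E] (p q : DrinfeldDouble K H →ₐ[K] E) :
    ev p q (rMatrix K H) = ev (p.comp (ofHopfHom K H)) q (canonical K H) := by
  rw [rMatrix_eq, ev_map]
  rfl

theorem rMatrix_eq_ev : rMatrix K H =
    ev ((inl₂ K H).comp (ofHopfHom K H)) (inr₂ K H) (canonical K H) := by
  rw [← ev_rMatrix, ev_inl_inr]

/-- A Yang–Baxter equation with `α` in place of a full `D(H)`-action. Each side contains two factors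
ending in `p₂`, which merge into one evaluation along a convolution; the cross relation reverses
that convolution. -/
theorem ev_canonical_mul_ev_mul_ev {E : Type*} [Semiring E] [Algebra K E] {α : H →ₐ[K] E}
    {p₁ p₂ : DrinfeldDouble K H →ₐ[K] E} (hα1 : Comm α p₁) (hα2 : Comm α p₂) (h12 : Comm p₁ p₂) :
    ev (p₁.comp (ofHopfHom K H)) p₂ (canonical K H) *
      (ev α p₂ (canonical K H) * ev α p₁ (canonical K H)) =
    ev α p₁ (canonical K H) * ev α p₂ (canonical K H) *
      ev (p₁.comp (ofHopfHom K H)) p₂ (canonical K H) := by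
  have hk2 : Comm (p₁.comp (ofHopfHom K H)) p₂ := h12.comp_left _
  have hαk : Comm α (p₁.comp (ofHopfHom K H)) := hα1.comp_right _
  rw [← mul_assoc, mul_assoc (ev α p₁ _), ← ev_star_canonical hαk.symm hk2 hα2,
    ← ev_star_canonical hαk hα2 hk2]
  have key : ∀ t : H ⊗[K] DrinfeldDouble K H,
      ev (star (p₁.comp (ofHopfHom K H)) α hαk.symm) p₂ t * ev α p₁ (canonical K H) =
      ev α p₁ (canonical K H) * ev (star α (p₁.comp (ofHopfHom K H)) hαk) p₂ t := by
    intro t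
    induction t with
    | zero => simp
    | tmul a x =>
      rw [ev_tmul, ev_tmul, mul_assoc, ← (hα2.commute_ev h12 (canonical K H) x).eq, ← mul_assoc,
        ← ev_canonical_mul_star hα1, mul_assoc]
    | add x y hx hy => simp only [map_add, add_mul, mul_add, hx, hy]
  exact key _

theorem tmul_rMatrix_mul_canon :
    ((1 : H) ⊗ₜ rMatrix K H) * (canon (inr₂ K H) * canon (inl₂ K H)) =
      canon (inl₂ K H) * canon (inr₂ K H) * ((1 : H) ⊗ₜ rMatrix K H) := by
  let ι : DrinfeldDouble K H ⊗[K] DrinfeldDouble K H →ₐ[K] H ⊗[K] (DrinfeldDouble K H ⊗[K]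
    DrinfeldDouble K H) := Algebra.TensorProduct.includeRight
  have h1 : (1 : H) ⊗ₜ rMatrix K H =
      ev ((ι.comp (inl₂ K H)).comp (ofHopfHom K H)) (ι.comp (inr₂ K H)) (canonical K H) := by
    change ι (rMatrix K H) = _
    rw [rMatrix_eq_ev, algHom_ev]
    rfl
  rw [h1, canon_eq_ev, canon_eq_ev]
  exact ev_canonical_mul_ev_mul_ev (comm_include _) (comm_include _) (comm_inl_inr.map ι)

/-- Contract the `H`-leg of the preceding identity with `f`: the products of canonical elements
become `Δ(f)` and `Δᵒᵖ(f)`. -/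
theorem rMatrix_mul_comul_ofDual (f : HopfDual K H) :
    rMatrix K H * comul (R := K) (ofDual K H f) =
      TensorProduct.comm K _ _ (comul (R := K) (ofDual K H f)) * rMatrix K H := by
  let σ := (Algebra.TensorProduct.comm K (DrinfeldDouble K H) (DrinfeldDouble K H)).toAlgHom
  have h1 : comul (R := K) (ofDual K H f) = pairDual (canon (inr₂ K H) * canon (inl₂ K H)) f := by
    rw [← canon_comulHom, comul_apply, ← algHom_pairDual, pairDual_canonical]
  have h2 : TensorProduct.comm K _ _ (comul (R := K) (ofDual K H f)) =
      pairDual (canon (inl₂ K H) * canon (inr₂ K H)) f := by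
    change σ (comul (R := K) (ofDual K H f)) = _
    rw [h1, algHom_pairDual, map_mul, map_canon, map_canon]
    have e1 : σ.comp (inl₂ K H) = inr₂ K H := AlgHom.ext fun x => by simp [σ]
    have e2 : σ.comp (inr₂ K H) = inl₂ K H := AlgHom.ext fun x => by simp [σ]
    rw [e1, e2]
  rw [h2, h1, ← pairDual_one_tmul_mul, tmul_rMatrix_mul_canon, pairDual_mul_one_tmul]

theorem rMatrix_mul_comul_ofHopf (a : H) :
    rMatrix K H * comul (R := K) (ofHopf K H a) =
      TensorProduct.comm K _ _ (comul (R := K) (ofHopf K H a)) * rMatrix K H := by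
  have h1 := congrArg (Algebra.TensorProduct.map (ofHopfHom K H) (AlgHom.id K _))
    ((isDoublePair_canonical (K := K) (H := H)).cross a)
  rw [map_mul, map_mul, ← rMatrix_eq] at h1
  have h2 : ∀ t : H ⊗[K] H, Algebra.TensorProduct.map (ofHopfHom K H) (AlgHom.id K _)
      (Algebra.TensorProduct.map (AlgHom.id K H) (ofHopfHom K H) t) =
      TensorProduct.map (ofHopf K H) (ofHopf K H) t := by
    intro t
    induction t with
    | zero => simp
    | tmul a b => simp
    | add x y hx hy => simp only [map_add, hx, hy]
  rw [h2, h2] at h1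
  rw [comul_ofHopf, h1, TensorProduct.map_comm]

/-- `R` is the canonical element with its first leg moved into `D(H)`, so the hexagon relations are
images of the coproduct axiom of the canonical pair and of the formula defining `comulHom`.
Intertwining of `Δ` and `Δᵒᵖ` is checked on products `f a`. -/
theorem isQuasitriangular_rMatrix : IsQuasitriangular (rMatrix K H) where
  counit_left := by
    rw [rMatrix_eq]
    have h1 : ∀ t : H ⊗[K] DrinfeldDouble K H, TensorProduct.lid K _ (counit.rTensor _
        (Algebra.TensorProduct.map (ofHopfHom K H) (AlgHom.id K _) t)) = pairDual t 1 := by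
      intro t
      induction t with
      | zero => simp [pairDual_zero]
      | tmul a b => simp [pairDual_tmul, counit_ofHopf]
      | add x y hx hy => simp only [map_add, pairDual_add, hx, hy]
    rw [h1, pairDual_canonical, ofDual_one]
  counit_right := by
    have h1 : ∑ i, cobasis (K := K) i 1 • Module.finBasis K H i = (1 : H) :=
      (Module.finBasis K H).sum_repr 1
    simp only [rMatrix, map_sum, lTensor_tmul, counit_ofDual, rid_tmul, ← map_smul]
    rw [← map_sum, h1, ofHopf_one]
  comul_left := by
    have h1 := congrArg (Algebra.TensorProduct.map (Algebra.TensorProduct.map (ofHopfHom K H)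
      (ofHopfHom K H)) (AlgHom.id K (DrinfeldDouble K H)))
        (isDoublePair_canonical (K := K) (H := H)).map_comul
    rw [map_mul] at h1
    simp only [rMatrix_eq, ← AlgHom.comp_apply, ← Algebra.TensorProduct.map_comp] at h1 ⊢
    rw [← comulHom_comp_ofHopfHom] at h1
    rw [comulAlgHom_eq]
    refine h1.trans ?_
    congr 3
  comul_right := by
    have h1 := congrArg (Algebra.TensorProduct.map (ofHopfHom K H) (AlgHom.id K _))
      (canon_comulHom (K := K) (H := H))
    rw [map_mul] at h1
    simp only [canon, rMatrix_eq, ← AlgHom.comp_apply, ← Algebra.TensorProduct.map_comp] at h1 ⊢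
    exact h1
  mul_comul x := by
    induction x using induction_on with
    | h0 => simp
    | h1 f a =>
      rw [Bialgebra.comul_mul, ← mul_assoc, rMatrix_mul_comul_ofDual, mul_assoc,
        rMatrix_mul_comul_ofHopf, ← mul_assoc, comm_mul]
    | h2 x y hx hy => simp only [map_add, mul_add, add_mul, hx, hy]

theorem drinfeldElement_eq_drinfeldMap :
    drinfeldElement K H = drinfeldMap K (DrinfeldDouble K H) (rMatrix K H) := rfl

end DrinfeldDouble

end HopfQuasi

namespace HopfQuasi

open TensorProduct Coalgebra LinearMap WithConv Polynomial

/-! ### Semisimple parts of powers of the Drinfeld element are scalar when group-like. -/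

namespace DrinfeldDouble

variable {K : Type v} {H : Type u} [Field K] [Ring H] [HopfAlgebra K H] [FiniteDimensional K H]

variable (K H) in
/-- The map `f a ↦ ε(a) f`. -/
noncomputable def toDual : DrinfeldDouble K H →ₗ[K] HopfDual K H :=
  (TensorProduct.rid K _).toLinearMap ∘ₗ counit.lTensor _ ∘ₗ (equivTensor K H).toLinearMap

variable (K H) in
/-- The map `f a ↦ f(1) a`. -/
noncomputable def toHopf : DrinfeldDouble K H →ₗ[K] H :=
  (TensorProduct.lid K _).toLinearMap ∘ₗ
    (applyₗ (1 : H) ∘ₗ (WithConv.linearEquiv K (Module.Dual K H)).toLinearMap).rTensor _ ∘ₗ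
      (equivTensor K H).toLinearMap

@[simp] theorem toDual_ofDual_mul_ofHopf (f : HopfDual K H) (a : H) :
    toDual K H (ofDual K H f * ofHopf K H a) = counit (R := K) a • f := by
  simp [ofDual_mul_ofHopf, toDual]

@[simp] theorem toHopf_ofDual_mul_ofHopf (f : HopfDual K H) (a : H) :
    toHopf K H (ofDual K H f * ofHopf K H a) = f 1 • a := by
  simp [ofDual_mul_ofHopf, toHopf]

theorem toDual_one : toDual K H 1 = 1 := by
  have := toDual_ofDual_mul_ofHopf (K := K) 1 (1 : H)
  rw [ofDual_one, ofHopf_one, mul_one] at this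
  simpa using this

theorem toHopf_one : toHopf K H 1 = 1 := by
  have := toHopf_ofDual_mul_ofHopf (K := K) 1 (1 : H)
  rw [ofDual_one, ofHopf_one, mul_one] at this
  simpa using this

theorem toDual_mul_ofHopf (x : DrinfeldDouble K H) (a : H) :
    toDual K H (x * ofHopf K H a) = counit (R := K) a • toDual K H x := by
  induction x using induction_on with
  | h0 => simp
  | h1 f b => rw [mul_assoc, ← ofHopf_mul]; simp [mul_smul, mul_comm]
  | h2 x y hx hy => simp only [add_mul, map_add, hx, hy, smul_add]

theorem toHopf_ofDual_mul (f : HopfDual K H) (x : DrinfeldDouble K H) :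
    toHopf K H (ofDual K H f * x) = f 1 • toHopf K H x := by
  induction x using induction_on with
  | h0 => simp
  | h1 g b =>
    rw [← mul_assoc, ← ofDual_mul]
    simp [convMul_apply, Algebra.TensorProduct.one_def, mul_smul]
  | h2 x y hx hy => simp only [mul_add, map_add, hx, hy, smul_add]

theorem sum_counit_smul_cobasis :
    ∑ i, counit (R := K) (Module.finBasis K H i) • cobasis i = (1 : HopfDual K H) := by
  simpa using sum_apply_cobasis (1 : HopfDual K H)

theorem antipode_one : antipode K H 1 = 1 := HopfAlgebra.antipode_one (R := K)

theorem antipode_ofDual (f : HopfDual K H) :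
    antipode K H (ofDual K H f) = ofDual K H (dualAntipodeInv K H f) := by
  have := antipode_ofDual_mul_ofHopf f (1 : H)
  rwa [HopfAlgebra.antipode_one, ofHopf_one, mul_one, one_mul] at this

/-- In `u = ∑ S(hᵢ^*) hᵢ` the right factors become `ε(hᵢ)`, and `∑ ε(hᵢ) hᵢ^*` is the unit of `H^*`.
-/
theorem toDual_mul_drinfeldElement (x : DrinfeldDouble K H) :
    toDual K H (x * drinfeldElement K H) = toDual K H x := by
  have : ∑ i, counit (R := K) (Module.finBasis K H i) •
      toDual K H (x * antipode K H (ofDual K H (cobasis i))) = toDual K H x := by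
    simp only [← map_smul, ← mul_smul_comm]
    rw [← map_sum, ← Finset.mul_sum, ← map_sum, ← map_sum, sum_counit_smul_cobasis, ofDual_one,
      antipode_one, mul_one]
  rw [drinfeldElement_eq, Finset.mul_sum, map_sum]
  simpa only [← mul_assoc, toDual_mul_ofHopf] using this

/-- The left factors `S(hᵢ^*)` become their values `hᵢ^*(1)`, and `∑ hᵢ^*(1) hᵢ = 1`. -/
theorem toHopf_drinfeldElement_mul (x : DrinfeldDouble K H) :
    toHopf K H (drinfeldElement K H * x) = toHopf K H x := by
  have h : ∑ i, cobasis (K := K) i 1 • Module.finBasis K H i = (1 : H) :=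
    (Module.finBasis K H).sum_repr 1
  have : ∑ i, cobasis (K := K) i 1 • toHopf K H (ofHopf K H (Module.finBasis K H i) * x) =
      toHopf K H x := by
    simp only [← map_smul, ← smul_mul_assoc]
    rw [← map_sum, ← Finset.sum_mul, ← map_sum, h, ofHopf_one, one_mul]
  rw [drinfeldElement_eq, Finset.sum_mul, map_sum]
  simp only [antipode_ofDual, mul_assoc, toHopf_ofDual_mul, dualAntipodeInv_ofConv]
  have h1 : antipodeInv K (1 : H) = 1 := by
    apply antipode_injective (K := K); simp
  rw [h1]
  exact this

theorem toDual_aeval (n : ℕ) (p : K[X]) :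
    toDual K H (aeval (drinfeldElement K H ^ n) p) = p.eval 1 • 1 := by
  have h : ∀ m, toDual K H (drinfeldElement K H ^ m) = 1 := by
    intro m
    induction m with
    | zero => rw [pow_zero, toDual_one]
    | succ m ih => rw [pow_succ, toDual_mul_drinfeldElement, ih]
  rw [aeval_eq_sum_range, eval_eq_sum_range, map_sum, Finset.sum_smul]
  simp [← pow_mul, h]

theorem toHopf_aeval (n : ℕ) (p : K[X]) :
    toHopf K H (aeval (drinfeldElement K H ^ n) p) = p.eval 1 • 1 := by
  have h : ∀ m, toHopf K H (drinfeldElement K H ^ m) = 1 := by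
    intro m
    induction m with
    | zero => rw [pow_zero, toHopf_one]
    | succ m ih => rw [pow_succ', toHopf_drinfeldElement_mul, ih]
  rw [aeval_eq_sum_range, eval_eq_sum_range, map_sum, Finset.sum_smul]
  simp [← pow_mul, h]

theorem rid_lTensor_dualComul (f : HopfDual K H) : TensorProduct.rid K _
    ((applyₗ (1 : H) ∘ₗ (WithConv.linearEquiv K (Module.Dual K H)).toLinearMap).lTensor _
      (dualComul K H f)) = f := by
  have h1 : ∀ i, ∑ j, f (Module.finBasis K H j * Module.finBasis K H i) * cobasis (K := K) j 1 =
      f (Module.finBasis K H i) := by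
    intro i
    have := congrArg (fun g => g.ofConv 1) (sum_apply_cobasis (rTrans f (Module.finBasis K H i)))
    simpa [rTrans] using this
  conv_rhs => rw [← sum_apply_cobasis f]
  simp [dualComul_apply, ← h1, Finset.sum_smul, mul_smul]

/-- For `Δ(f a) = ∑ f₁ a₁ ⊗ f₂ a₂` the projections apply the counits to `a₁` and `f₂`, leaving `f ⊗
a`. -/
theorem map_toDual_toHopf_comul (x : DrinfeldDouble K H) :
    TensorProduct.map (toDual K H) (toHopf K H) (comul x) = equivTensor K H x := by
  induction x using induction_on with
  | h0 => simp
  | h1 f a =>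
    have h1 : ∀ (s : HopfDual K H ⊗[K] HopfDual K H) (t : H ⊗[K] H),
        TensorProduct.map (toDual K H) (toHopf K H) (TensorProduct.map (ofDual K H) (ofDual K H) s *
          TensorProduct.map (ofHopf K H) (ofHopf K H) t) =
        TensorProduct.rid K _ ((applyₗ (1 : H) ∘ₗ
          (WithConv.linearEquiv K (Module.Dual K H)).toLinearMap).lTensor _ s) ⊗ₜ
        TensorProduct.lid K _ (counit.rTensor _ t) := by
      intro s t
      induction s with
      | zero => simp
      | tmul f g =>
        induction t with
        | zero => simp
        | tmul a b => simp [smul_tmul', tmul_smul, smul_smul, mul_comm]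
        | add x y hx hy => simp only [map_add, mul_add, tmul_add, hx, hy]
      | add x y hx hy => simp only [map_add, add_mul, add_tmul, hx, hy]
    rw [Bialgebra.comul_mul, comul_ofDual, comul_ofHopf, h1, rid_lTensor_dualComul,
      rTensor_counit_comul, ofDual_mul_ofHopf]
    simp
  | h2 x y hx hy => simp only [map_add, hx, hy]

theorem isUnipotent_drinfeldElement_pow_iff [PerfectField K] (n : ℕ) :
    IsUnipotent (drinfeldElement K H ^ n) ↔ IsUnipotent (monodromy (rMatrix K H) ^ n) := by
  have hR := isQuasitriangular_rMatrix (K := K) (H := H)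
  refine ⟨hR.isUnipotent_monodromy_pow, fun h => ?_⟩
  obtain ⟨p, h1, h2⟩ := hR.exists_isGroupLikeElem_aeval h
  rw [← drinfeldElement_eq_drinfeldMap] at h1 h2
  have h3 := map_toDual_toHopf_comul (aeval (drinfeldElement K H ^ n) p)
  have hu : counit (R := K) (drinfeldElement K H) = 1 := hR.counit_drinfeld
  rw [h2, map_tmul, toDual_aeval, toHopf_aeval] at h3
  -- Since `Δ(s) = s ⊗ s`, the element `s` is the tensor of its two projections, each equal to
  -- `p(1)` times a unit.
  have h4 : aeval (drinfeldElement K H ^ n) p = (p.eval 1 * p.eval 1) • 1 := by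
    apply (equivTensor K H).injective
    rw [← h3, map_smul, one_def, LinearEquiv.apply_symm_apply, smul_tmul', tmul_smul, smul_tmul',
      smul_smul]
  -- The counit of `uⁿ - s` is a nilpotent scalar, namely `1 - p(1)²`, so the scalar `s` equals `1`.
  have h5 := h1.map (Bialgebra.counitAlgHom K (DrinfeldDouble K H))
  rw [h4] at h1 h5
  simp [hu, sub_eq_zero] at h5
  rwa [← h5, one_smul] at h1

end DrinfeldDouble

end HopfQuasi

namespace HopfQuasi

open TensorProduct Coalgebra LinearMap WithConv

/-! ### Elements of `A ⊗ End(V)` as operators. -/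

section ActEnd

variable {K : Type*} [Field K] {A U V : Type*} [Ring A] [Algebra K A]
  [AddCommGroup U] [Module K U] [AddCommGroup V] [Module K V]

/-- The action of `A ⊗ End(V)` on `U ⊗ V` when `A` acts on `U`. -/
noncomputable def actEnd (ρ : A →ₐ[K] Module.End K U) :
    A ⊗[K] Module.End K V →ₐ[K] Module.End K (U ⊗[K] V) :=
  (Module.endTensorEndAlgHom (R := K) (S := K) (A := K)).comp
    (Algebra.TensorProduct.map ρ (AlgHom.id K _))

@[simp] theorem actEnd_tmul (ρ : A →ₐ[K] Module.End K U) (a : A) (T : Module.End K V) :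
    actEnd ρ (a ⊗ₜ T) = TensorProduct.map (ρ a) T := rfl

/-- An element of `A ⊗ End(V)` is determined by its values on vectors. -/
theorem ext_lTensor_apply {s t : A ⊗[K] Module.End K V}
    (h : ∀ x : V, (applyₗ x).lTensor A s = (applyₗ x).lTensor A t) : s = t := by
  classical
  let b := Module.Basis.ofVectorSpace K A
  apply (TensorProduct.equivFinsuppOfBasisLeft b).injective
  have key : ∀ (s : A ⊗[K] Module.End K V) (x : V) i,
      TensorProduct.equivFinsuppOfBasisLeft b ((applyₗ x).lTensor A s) i =
      TensorProduct.equivFinsuppOfBasisLeft b s i x := by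
    intro s x i
    induction s with
    | zero => simp
    | tmul a T => simp
    | add x y hx hy => simp only [map_add, Finsupp.add_apply, LinearMap.add_apply, hx, hy]
  ext i x
  rw [← key, ← key, h]

theorem actEnd_apply_tmul (ρ : A →ₐ[K] Module.End K U) (t : A ⊗[K] Module.End K V) (y : U) (x : V) :
    actEnd ρ t (y ⊗ₜ x) = ((applyₗ y ∘ₗ ρ.toLinearMap).rTensor V) ((applyₗ x).lTensor A t) := by
  induction t with
  | zero => simp
  | tmul a T => simp
  | add x y hx hy => simp only [map_add, LinearMap.add_apply, hx, hy]

/-- The action is faithful when `U` is a copy of the regular representation. -/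
theorem actEnd_injective {ρ : A →ₐ[K] Module.End K U} (e : A ≃ₗ[K] U)
    (he : ∀ a, ρ a (e 1) = e a) :
    Function.Injective (actEnd (V := V) ρ) := by
  intro s t hst
  refine ext_lTensor_apply fun x => ?_
  have h1 : applyₗ (e 1) ∘ₗ ρ.toLinearMap = e.toLinearMap := LinearMap.ext fun a => he a
  have h2 := LinearMap.congr_fun hst (e 1 ⊗ₜ x)
  rw [actEnd_apply_tmul, actEnd_apply_tmul, h1] at h2
  exact (TensorProduct.congr e (LinearEquiv.refl K V)).injective h2

/-- Left multiplication by `b` is injective because `f b` has a left inverse in `C`; finite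
dimension of `B` makes it surjective. The inverse thus descends from operators to the tensor. -/
theorem exists_mul_eq_one_of_comp_eq_id {B : Type*} [Ring B] [Algebra K B] [FiniteDimensional K B]
    {C : Type*} [Ring C] [Algebra K C] (f : B →ₐ[K] C) (hf : Function.Injective f) (b : B) (c : C)
    (h : c * f b = 1) : ∃ b', b' * b = 1 ∧ b * b' = 1 := by
  have h1 : Function.Injective (mulLeft K b) := fun x y hxy => hf <| by
    have := congrArg (fun z => c * f z) hxy
    simpa [← mul_assoc, h] using this
  obtain ⟨b', hb'⟩ := LinearMap.injective_iff_surjective.1 h1 1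
  have hb' : b * b' = 1 := hb'
  refine ⟨b', h1 ?_, hb'⟩
  simp [← mul_assoc, hb']

end ActEnd

/-! ### Inverses of the tensor in a double pair. -/

section PairInverse

variable {K : Type v} {H : Type u} [Field K] [Ring H] [HopfAlgebra K H]
  {B : Type w} [Ring B] [Algebra K B] {φ : H →ₐ[K] B} {w w' : H ⊗[K] B}

/-- Apply `a ⊗ b ⊗ c ↦ S(a) b ⊗ c` to `(Δ ⊗ id)(w) = w₁₃ w₂₃`. -/
theorem IsDoublePair.antipode_mul (h : IsDoublePair φ w) :
    (HopfAlgebra.antipode K).rTensor B w * w = 1 := by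
  let Q : (H ⊗[K] H) ⊗[K] B →ₗ[K] H ⊗[K] B :=
    (LinearMap.mul' K H ∘ₗ (HopfAlgebra.antipode K).rTensor H).rTensor B
  have h1 := congrArg Q h.map_comul
  have h2 : ∀ t : H ⊗[K] B, Q (Algebra.TensorProduct.map (Bialgebra.comulAlgHom K H)
      (AlgHom.id K B) t) = 1 ⊗ₜ TensorProduct.lid K B (Algebra.TensorProduct.map
        (Bialgebra.counitAlgHom K H) (AlgHom.id K B) t) := by
    intro t
    induction t with
    | zero => simp
    | tmul a b => simp [Q, Algebra.algebraMap_eq_smul_one, TensorProduct.smul_tmul]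
    | add a b ha hb => simp only [map_add, ha, hb, tmul_add]
  have h3 : ∀ s t : H ⊗[K] B, Q (
    Algebra.TensorProduct.map (inl K H H) (AlgHom.id K B) s *
      Algebra.TensorProduct.map (inr K H H) (AlgHom.id K B) t) =
      (HopfAlgebra.antipode K).rTensor B s * t := by
    intro s t
    induction s with
    | zero => simp
    | tmul a b =>
      induction t with
      | zero => simp
      | tmul c d => simp [Q]
      | add c d hc hd => simp only [map_add, mul_add, hc, hd]
    | add a b ha hb => simp only [map_add, add_mul, ha, hb]
  rw [h2, h3, h.map_counit] at h1
  rw [← h1]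
  simp [Algebra.TensorProduct.one_def]

theorem inverse_relation {S : Type*} [Monoid S] {a b x y : S} (hab : a * b = 1) (hba : b * a = 1)
    (h : a * x = y * a) : b * y = x * b := by
  calc b * y = b * (y * a) * b := by rw [mul_assoc, mul_assoc, hab, mul_one]
    _ = x * b := by rw [← h, ← mul_assoc, hba, one_mul]

/-- Half-braidings supply relations for the inverse `w'`; inverting them gives those for `w`. The
counit axiom comes for free from invertibility. -/
theorem IsDoublePair.of_inverse (h1 : w * w' = 1) (h2 : w' * w = 1)
    (hc : Algebra.TensorProduct.map (Bialgebra.comulAlgHom K H) (AlgHom.id K B) w' =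
      Algebra.TensorProduct.map (inr K H H) (AlgHom.id K B) w' *
        Algebra.TensorProduct.map (inl K H H) (AlgHom.id K B) w')
    (hx : ∀ a : H, w' * Algebra.TensorProduct.map (AlgHom.id K H) φ
        (TensorProduct.comm K H H (comul a)) =
      Algebra.TensorProduct.map (AlgHom.id K H) φ (comul a) * w') : IsDoublePair φ w := by
  have key : Algebra.TensorProduct.map (Bialgebra.comulAlgHom K H) (AlgHom.id K B) w =
      Algebra.TensorProduct.map (inl K H H) (AlgHom.id K B) w *
        Algebra.TensorProduct.map (inr K H H) (AlgHom.id K B) w := by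
    refine left_inv_eq_right_inv (a := Algebra.TensorProduct.map (Bialgebra.comulAlgHom K H)
      (AlgHom.id K B) w') (by rw [← map_mul, h1, map_one]) ?_
    rw [hc, mul_assoc, ← mul_assoc (Algebra.TensorProduct.map (inl K H H) (AlgHom.id K B) w'),
      ← map_mul, h2, map_one, one_mul, ← map_mul, h2, map_one]
  refine ⟨?_, key, fun a => inverse_relation h2 h1 (hx a)⟩
  let ε := Bialgebra.counitAlgHom K H
  -- Applying `ε ⊗ ε` to the coproduct axiom makes `(ε ⊗ id)(w)` an idempotent; being invertible, it
  -- is `1`.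
  have h3 := congrArg (Algebra.TensorProduct.map ((Algebra.TensorProduct.lid K K).toAlgHom.comp
    (Algebra.TensorProduct.map ε ε)) (AlgHom.id K B)) key
  rw [map_mul] at h3
  simp only [← AlgHom.comp_apply, ← Algebra.TensorProduct.map_comp] at h3
  have e1 : ((Algebra.TensorProduct.lid K K).toAlgHom.comp
    (Algebra.TensorProduct.map ε ε)).comp (inl K H H) = ε := AlgHom.ext fun x => by simp [ε]
  have e2 : ((Algebra.TensorProduct.lid K K).toAlgHom.comp
    (Algebra.TensorProduct.map ε ε)).comp (inr K H H) = ε := AlgHom.ext fun x => by simp [ε]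
  have e3 : ((Algebra.TensorProduct.lid K K).toAlgHom.comp
      (Algebra.TensorProduct.map ε ε)).comp (Bialgebra.comulAlgHom K H) = ε := by
    ext a
    have h4 : ∀ t : H ⊗[K] H, (Algebra.TensorProduct.lid K K)
      (Algebra.TensorProduct.map ε ε t) = counit (R := K) (TensorProduct.lid K H
        (counit.rTensor H t)) := by
      intro t
      induction t with
      | zero => simp
      | tmul x y => simp [ε]
      | add x y hx hy => simp only [map_add, hx, hy]
    refine (h4 _).trans ?_
    change counit (R := K) (TensorProduct.lid K H (counit.rTensor H (comul a))) = counit a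
    rw [rTensor_counit_comul]
    simp
  rw [e1, e2, e3] at h3
  have h5 := congrArg (Algebra.TensorProduct.map ε (AlgHom.id K B)) h2
  rw [map_mul, map_one] at h5
  have h6 : ∀ x y : K ⊗[K] B, x = x * x → y * x = 1 → x = 1 := by
    intro x y hxx hyx
    calc x = y * (x * x) := by rw [← mul_assoc, hyx, one_mul]
      _ = 1 := by rw [← hxx, hyx]
  exact h6 _ _ h3 h5

theorem IsDoublePair.inverse_map_comul (h : IsDoublePair φ w) (h1 : w * w' = 1) (h2 : w' * w = 1) :
    Algebra.TensorProduct.map (Bialgebra.comulAlgHom K H) (AlgHom.id K B) w' =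
      Algebra.TensorProduct.map (inr K H H) (AlgHom.id K B) w' *
        Algebra.TensorProduct.map (inl K H H) (AlgHom.id K B) w' := by
  refine left_inv_eq_right_inv (a := Algebra.TensorProduct.map (Bialgebra.comulAlgHom K H)
      (AlgHom.id K B) w) (by rw [← map_mul, h2, map_one]) ?_
  rw [h.map_comul, mul_assoc, ← mul_assoc (Algebra.TensorProduct.map (inr K H H) (AlgHom.id K B) w),
    ← map_mul, h1, map_one, one_mul, ← map_mul, h1, map_one]

end PairInverse

end HopfQuasi

namespace HopfQuasi

open TensorProduct Coalgebra LinearMap CategoryTheory MonoidalCategory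

/-! ### Double braidings in the center as operators of the monodromy. -/

section Endomorphisms

variable {K : Type v} {H : Type u} [Field K] [Ring H] [Bialgebra K H]

/-- The linear map underlying an endomorphism of an object of the center. -/
def endToLinearMap (X : Center (HopfRep K H)) : End X →+* Module.End K X.1.carrier where
  toFun f := f.f.toLinearMap
  map_one' := rfl
  map_mul' _ _ := rfl
  map_zero' := rfl
  map_add' _ _ := rfl

theorem endToLinearMap_injective (X : Center (HopfRep K H)) :
    Function.Injective (endToLinearMap X) := fun _ _ h =>
  Center.ext _ _ (HopfRep.hom_ext h)

theorem isUnipotent_endToLinearMap_iff {X : Center (HopfRep K H)} (f : End X) :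
    IsUnipotent (endToLinearMap X f) ↔ IsUnipotent f := by
  rw [IsUnipotent, IsUnipotent, ← map_one (endToLinearMap X), ← map_sub]
  exact IsNilpotent.map_iff (endToLinearMap_injective X)

theorem endToLinearMap_doubleBraiding (X Y : Center (HopfRep K H)) :
    endToLinearMap _ (doubleBraiding X Y) =
      (Y.2.β X.1).hom.toLinearMap ∘ₗ (X.2.β Y.1).hom.toLinearMap := rfl

end Endomorphisms

namespace DrinfeldDouble

variable {K : Type v} {H : Type u} [Field K] [Ring H] [HopfAlgebra K H] [FiniteDimensional K H]

/-- The object `X` of the center is the `D(H)`-module given by `p`: the inverse of its half-braiding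
with `U` is the flip composed with the action of `R`. -/
structure IsCenterObject (X : Center (HopfRep K H))
    (p : DrinfeldDouble K H →ₐ[K] Module.End K X.1.carrier) : Prop where
  ρ_eq : X.1.ρ = p.comp (ofHopfHom K H)
  inv_eq : ∀ U : HopfRep K H, (X.2.β U).inv.toLinearMap =
    (TensorProduct.comm K U.carrier X.1.carrier).toLinearMap ∘ₗ actEnd U.ρ (canon p)

theorem actEnd_canon {V W : Type v} [AddCommGroup V] [Module K V] [AddCommGroup W] [Module K W]
    (p : DrinfeldDouble K H →ₐ[K] Module.End K V) (q : DrinfeldDouble K H →ₐ[K] Module.End K W) :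
    actEnd (q.comp (ofHopfHom K H)) (canon p) = tensorAct q p (rMatrix K H) := by
  rw [rMatrix_eq, canon]
  generalize canonical K H = t
  induction t with
  | zero => simp
  | tmul a x => simp
  | add x y hx hy => simp only [map_add, hx, hy]

theorem comm_comp_tensorAct {V W : Type v} [AddCommGroup V] [Module K V] [AddCommGroup W]
    [Module K W] (p : DrinfeldDouble K H →ₐ[K] Module.End K V)
    (q : DrinfeldDouble K H →ₐ[K] Module.End K W) (t : DrinfeldDouble K H ⊗[K] DrinfeldDouble K H) :
    (TensorProduct.comm K W V).toLinearMap ∘ₗ tensorAct q p t =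
      tensorAct p q (TensorProduct.comm K _ _ t) ∘ₗ (TensorProduct.comm K W V).toLinearMap := by
  induction t with
  | zero => simp
  | tmul a b => ext x y; simp
  | add x y hx hy => simp only [map_add, comp_add, add_comp, hx, hy]

variable {X Y : Center (HopfRep K H)} {p : DrinfeldDouble K H →ₐ[K] Module.End K X.1.carrier}
  {q : DrinfeldDouble K H →ₐ[K] Module.End K Y.1.carrier}

/-- Each inverse half-braiding is `R` followed by a flip; pulling the two flips together turns one
`R` into `R₂₁`. -/
theorem IsCenterObject.inv_comp_inv (hX : IsCenterObject X p) (hY : IsCenterObject Y q) :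
    (X.2.β Y.1).inv.toLinearMap ∘ₗ (Y.2.β X.1).inv.toLinearMap =
      tensorAct p q (monodromy (rMatrix K H)) := by
  rw [hX.inv_eq, hY.inv_eq, hX.ρ_eq, hY.ρ_eq, actEnd_canon, actEnd_canon, comm_comp_tensorAct,
    monodromy, map_mul]
  exact LinearMap.ext fun z => congrArg (tensorAct p q (TensorProduct.comm K _ _ (rMatrix K H)))
    ((TensorProduct.comm K X.1.carrier Y.1.carrier).symm_apply_apply
      (tensorAct p q (rMatrix K H) z))

/-- The double braiding and the action of the monodromy are mutually inverse, and inverses of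
unipotents are unipotent. -/
theorem IsCenterObject.isUnipotent_doubleBraiding_pow_iff (hX : IsCenterObject X p)
    (hY : IsCenterObject Y q) (n : ℕ) : IsUnipotent (doubleBraiding X Y ^ n) ↔
      IsUnipotent (tensorAct p q (monodromy (rMatrix K H) ^ n)) := by
  rw [← isUnipotent_endToLinearMap_iff, map_pow, map_pow, ← hX.inv_comp_inv hY,
    endToLinearMap_doubleBraiding]
  set b : Module.End K (X.1.carrier ⊗[K] Y.1.carrier) :=
    (Y.2.β X.1).hom.toLinearMap ∘ₗ (X.2.β Y.1).hom.toLinearMap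
  set c : Module.End K (X.1.carrier ⊗[K] Y.1.carrier) :=
    (X.2.β Y.1).inv.toLinearMap ∘ₗ (Y.2.β X.1).inv.toLinearMap
  have h1 : b * c = 1 := congrArg HopfRep.Hom.toLinearMap (X.2.β Y.1 ≪≫ Y.2.β X.1).inv_hom_id
  have h2 : c * b = 1 := congrArg HopfRep.Hom.toLinearMap (X.2.β Y.1 ≪≫ Y.2.β X.1).hom_inv_id
  have hc : Commute b c := by rw [Commute, SemiconjBy, h1, h2]
  have h3 : b ^ n * c ^ n = 1 := by rw [← hc.mul_pow, h1, one_pow]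
  have h4 : c ^ n * b ^ n = 1 := by rw [← hc.symm.mul_pow, h2, one_pow]
  exact ⟨fun h => IsUnipotent.of_mul_eq_one h h3 h4, fun h => IsUnipotent.of_mul_eq_one h h4 h3⟩

/-- Tensor products of injections over a field are injective, and `End(V) ⊗ End(V) → End(V ⊗ V)` is
an isomorphism in finite dimension. -/
theorem tensorAct_injective {V : Type v} [AddCommGroup V] [Module K V] [FiniteDimensional K V]
    {p : DrinfeldDouble K H →ₐ[K] Module.End K V} (hp : Function.Injective p) :
    Function.Injective (tensorAct p p) := by
  have h1 : Function.Injective (TensorProduct.map p.toLinearMap p.toLinearMap) :=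
    TensorProduct.map_injective_of_flat_flat _ _ hp hp
  have h2 : ∀ t, tensorAct p p t =
      homTensorHomEquiv K V V V V (TensorProduct.map p.toLinearMap p.toLinearMap t) := by
    intro t
    induction t with
    | zero => simp
    | tmul a b => simp
    | add x y hx hy => simp only [map_add, hx, hy]
  intro s t hst
  rw [h2, h2] at hst
  exact h1 ((homTensorHomEquiv K V V V V).injective hst)

theorem isUnipotent_tensorAct_iff {V : Type v} [AddCommGroup V] [Module K V] [FiniteDimensional K V]
    {p : DrinfeldDouble K H →ₐ[K] Module.End K V} (hp : Function.Injective p)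
    (t : DrinfeldDouble K H ⊗[K] DrinfeldDouble K H) :
    IsUnipotent (tensorAct p p t) ↔ IsUnipotent t := by
  rw [IsUnipotent, IsUnipotent, ← map_one (tensorAct p p), ← map_sub]
  exact IsNilpotent.map_iff (tensorAct_injective hp)

end DrinfeldDouble

end HopfQuasi

namespace HopfQuasi

open TensorProduct Coalgebra LinearMap CategoryTheory MonoidalCategory

/-! ### The regular representation. -/

section SmallRegular

variable (K : Type v) [Field K] (A : Type u) [Ring A] [Algebra K A] [FiniteDimensional K A]

/-- The regular representation of `A`, transported to the universe of `K`. -/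
noncomputable def smallRegular : A →ₐ[K] Module.End K (Fin (Module.finrank K A) → K) :=
  ((Module.finBasis K A).equivFun.conjAlgEquiv K).toAlgHom.comp (Algebra.lmul K A)

variable {K A}

theorem smallRegular_apply (a b : A) : smallRegular K A a ((Module.finBasis K A).equivFun b) =
    (Module.finBasis K A).equivFun (a * b) := by
  change (Module.finBasis K A).equivFun (a * (Module.finBasis K A).equivFun.symm
    ((Module.finBasis K A).equivFun b)) = _
  rw [LinearEquiv.symm_apply_apply]

theorem smallRegular_injective : Function.Injective (smallRegular K A) := fun a b h => by
  have := LinearMap.congr_fun h ((Module.finBasis K A).equivFun 1)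
  rw [smallRegular_apply, smallRegular_apply, mul_one, mul_one] at this
  exact (Module.finBasis K A).equivFun.injective this

variable {V : Type w} [AddCommGroup V] [Module K V]

theorem exists_lTensor_apply (F : V →ₗ[K] A ⊗[K] V) :
    ∃ t : A ⊗[K] Module.End K V, ∀ x, (applyₗ x).lTensor A t = F x := by
  refine ⟨∑ i, Module.finBasis K A i ⊗ₜ ((TensorProduct.lid K V).toLinearMap ∘ₗ
    ((Module.finBasis K A).coord i).rTensor V ∘ₗ F), fun x => ?_⟩
  rw [map_sum]
  simp only [lTensor_tmul, applyₗ_apply_apply, LinearMap.comp_apply]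
  generalize F x = s
  induction s with
  | zero => simp
  | tmul a y =>
    conv_rhs => rw [← (Module.finBasis K A).sum_repr a, sum_tmul]
    simp [smul_tmul]
  | add x y hx hy => simp only [map_add, tmul_add, Finset.sum_add_distrib, hx, hy]

end SmallRegular

/-! ### Half-braidings given by a tensor: linearity, hexagon, naturality. -/

section Hexagon

variable {K : Type v} {H : Type u} [Field K] [Ring H] [Bialgebra K H]
  {U U' V : Type v} [AddCommGroup U] [Module K U] [AddCommGroup U'] [Module K U']
  [AddCommGroup V] [Module K V] (ρ : H →ₐ[K] Module.End K U) (ρ' : H →ₐ[K] Module.End K U')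

theorem tensorAction_eq_actEnd (φ : H →ₐ[K] Module.End K V) (a : H) :
    tensorAction ρ φ a = actEnd ρ (Algebra.TensorProduct.map (AlgHom.id K H) φ (comul a)) := by
  rw [tensorAction_apply]
  induction comul (R := K) a with
  | zero => simp
  | tmul a b => simp
  | add x y hx hy => simp only [map_add, hx, hy]

theorem comm_comp_tensorAction (φ : H →ₐ[K] Module.End K V) (a : H) :
    (TensorProduct.comm K V U).toLinearMap ∘ₗ tensorAction φ ρ a =
      actEnd ρ (Algebra.TensorProduct.map (AlgHom.id K H) φ
        (TensorProduct.comm K H H (comul a))) ∘ₗ (TensorProduct.comm K V U).toLinearMap := by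
  rw [tensorAction_apply]
  induction comul (R := K) a with
  | zero => simp
  | tmul a b => ext x y; simp
  | add x y hx hy => simp only [map_add, comp_add, add_comp, hx, hy]

theorem actEnd_tensorAction (w : H ⊗[K] Module.End K V) :
    actEnd (tensorAction ρ ρ') w = actEnd (tensorAct ρ ρ')
      (Algebra.TensorProduct.map (Bialgebra.comulAlgHom K H) (AlgHom.id K _) w) := by
  induction w with
  | zero => simp
  | tmul a T => rfl
  | add x y hx hy => simp only [map_add, hx, hy]

/-- Translates the composite in the monoidality axiom of a half-braiding into a product in `H ⊗ H ⊗
End(V)`, so that the axiom becomes `(Δ ⊗ id)(w') = w'₂₃ w'₁₃`. -/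
theorem hexagon (s t : H ⊗[K] Module.End K V) :
    (TensorProduct.assoc K U U' V).symm.toLinearMap ∘ₗ
      TensorProduct.map LinearMap.id (actEnd ρ' t ∘ₗ (TensorProduct.comm K V U').toLinearMap) ∘ₗ
      (TensorProduct.assoc K U V U').toLinearMap ∘ₗ
      TensorProduct.map (actEnd ρ s ∘ₗ (TensorProduct.comm K V U).toLinearMap) LinearMap.id ∘ₗ
      (TensorProduct.assoc K V U U').symm.toLinearMap =
    actEnd (tensorAct ρ ρ') (Algebra.TensorProduct.map (inr K H H) (AlgHom.id K _) t *
      Algebra.TensorProduct.map (inl K H H) (AlgHom.id K _) s) ∘ₗ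
        (TensorProduct.comm K V (U ⊗[K] U')).toLinearMap := by
  induction s with
  | zero => simp
  | tmul a S =>
    induction t with
    | zero => simp
    | tmul b T =>
      apply TensorProduct.ext
      refine LinearMap.ext fun x => TensorProduct.ext' fun y z => ?_
      simp
    | add x y hx hy =>
      simp only [map_add, add_mul, add_comp, TensorProduct.map_add_right, comp_add, hx, hy]
  | add x y hx hy =>
    simp only [map_add, mul_add, add_comp, TensorProduct.map_add_left, comp_add, hx, hy]

theorem actEnd_naturality {f : U →ₗ[K] U'} (hf : ∀ a, f ∘ₗ ρ a = ρ' a ∘ₗ f)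
    (w : H ⊗[K] Module.End K V) :
    actEnd ρ' w ∘ₗ TensorProduct.map f LinearMap.id =
      TensorProduct.map f LinearMap.id ∘ₗ actEnd ρ w := by
  induction w with
  | zero => simp
  | tmul a T =>
    rw [actEnd_tmul, actEnd_tmul, ← TensorProduct.map_comp, ← TensorProduct.map_comp, hf]
    rfl
  | add x y hx hy => simp only [map_add, add_comp, comp_add, hx, hy]

end Hexagon

namespace DrinfeldDouble

variable {K : Type v} {H : Type u} [Field K] [Ring H] [HopfAlgebra K H] [FiniteDimensional K H]

theorem mul_eq_one_of_mul_eq_one {B : Type*} [Ring B] [Algebra K B] [FiniteDimensional K B]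
    {b c : B} (h : c * b = 1) : b * c = 1 := by
  obtain ⟨b', h1, h2⟩ := exists_mul_eq_one_of_comp_eq_id (AlgHom.id K B)
    Function.injective_id b c h
  rwa [left_inv_eq_right_inv h h2]

/-! ### From modules over the double to the center. -/

section OfModule

variable {V : Type v} [AddCommGroup V] [Module K V] [FiniteDimensional K V]

theorem canon_mul_antipode (p : DrinfeldDouble K H →ₐ[K] Module.End K V) :
    canon p * (HopfAlgebra.antipode K).rTensor _ (canon p) = 1 :=
  mul_eq_one_of_mul_eq_one (K := K) (isDoublePair_canonical.map p).antipode_mul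

variable (p : DrinfeldDouble K H →ₐ[K] Module.End K V)

/-- The representation of `H` underlying a `D(H)`-module. -/
noncomputable def restrict : HopfRep K H where
  carrier := V
  ρ := p.comp (ofHopfHom K H)

/-- The flip of `V ⊗ U` followed by the action of the inverse of the canonical element. -/
noncomputable def halfBraidingEquiv {U : Type v} [AddCommGroup U] [Module K U]
    (ρ : H →ₐ[K] Module.End K U) : V ⊗[K] U ≃ₗ[K] U ⊗[K] V :=
  LinearEquiv.ofLinearMap
    (actEnd ρ ((HopfAlgebra.antipode K).rTensor _ (canon p)) ∘ₗ
      (TensorProduct.comm K V U).toLinearMap)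
    ((TensorProduct.comm K U V).toLinearMap ∘ₗ actEnd ρ (canon p))
    (by
      have := congrArg (actEnd ρ) (isDoublePair_canonical.map p).antipode_mul
      rw [map_mul, map_one] at this
      refine LinearMap.ext fun x => ?_
      simpa using LinearMap.congr_fun this x)
    (by
      have := congrArg (actEnd ρ) (canon_mul_antipode p)
      rw [map_mul, map_one] at this
      refine LinearMap.ext fun x => ?_
      have h := LinearMap.congr_fun this (TensorProduct.comm K V U x)
      simpa using congrArg (TensorProduct.comm K U V) h)

theorem halfBraidingEquiv_toLinearMap {U : Type v} [AddCommGroup U] [Module K U]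
    (ρ : H →ₐ[K] Module.End K U) : (halfBraidingEquiv p ρ).toLinearMap =
    actEnd ρ ((HopfAlgebra.antipode K).rTensor _ (canon p)) ∘ₗ
      (TensorProduct.comm K V U).toLinearMap := rfl

theorem halfBraidingEquiv_tensorAction {U : Type v} [AddCommGroup U] [Module K U]
    (ρ : H →ₐ[K] Module.End K U) (a : H) :
    (halfBraidingEquiv p ρ).toLinearMap ∘ₗ tensorAction (p.comp (ofHopfHom K H)) ρ a =
      tensorAction ρ (p.comp (ofHopfHom K H)) a ∘ₗ (halfBraidingEquiv p ρ).toLinearMap := by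
  -- The half-braiding uses the inverse of the canonical element, so the inverted cross relation is
  -- the one needed.
  have h1 := inverse_relation (canon_mul_antipode p) (isDoublePair_canonical.map p).antipode_mul
    ((isDoublePair_canonical.map p).cross a)
  have h2 := congrArg (actEnd ρ) h1
  rw [map_mul, map_mul] at h2
  rw [halfBraidingEquiv_toLinearMap, LinearMap.comp_assoc, comm_comp_tensorAction,
    ← LinearMap.comp_assoc, ← LinearMap.comp_assoc, tensorAction_eq_actEnd]
  exact congrArg (fun f => f ∘ₗ _) h2

theorem halfBraidingEquiv_hexagon {U U' : Type v} [AddCommGroup U] [Module K U]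
    [AddCommGroup U'] [Module K U'] (ρ : H →ₐ[K] Module.End K U) (ρ' : H →ₐ[K] Module.End K U') :
    (halfBraidingEquiv p (tensorAction ρ ρ')).toLinearMap =
    (TensorProduct.assoc K U U' V).symm.toLinearMap ∘ₗ
      TensorProduct.map LinearMap.id (halfBraidingEquiv p ρ').toLinearMap ∘ₗ
      (TensorProduct.assoc K U V U').toLinearMap ∘ₗ
      TensorProduct.map (halfBraidingEquiv p ρ).toLinearMap LinearMap.id ∘ₗ
      (TensorProduct.assoc K V U U').symm.toLinearMap := by
  simp only [halfBraidingEquiv_toLinearMap]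
  rw [hexagon, ← (isDoublePair_canonical.map p).inverse_map_comul (canon_mul_antipode p)
    (isDoublePair_canonical.map p).antipode_mul, ← actEnd_tensorAction]

/-- The object of the center given by a `D(H)`-module. -/
noncomputable def toCenter : Center (HopfRep K H) :=
  ⟨restrict p,
    { β := fun U => HopfRep.mkIso (halfBraidingEquiv p U.ρ) fun a x =>
        LinearMap.congr_fun (halfBraidingEquiv_tensorAction p U.ρ a) x
      monoidal := fun U U' => by
        exact HopfRep.hom_ext (halfBraidingEquiv_hexagon p U.ρ U'.ρ)
      naturality := fun {U U'} f => by
        refine HopfRep.hom_ext ?_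
        have h := actEnd_naturality U.ρ U'.ρ f.comm
          ((HopfAlgebra.antipode K).rTensor _ (canon p))
        refine LinearMap.ext fun x => ?_
        refine Eq.trans ?_ (LinearMap.congr_fun h (TensorProduct.comm K V U.carrier x))
        refine congrArg (actEnd U'.ρ _) ?_
        exact (TensorProduct.map_comm f.toLinearMap LinearMap.id x).symm }⟩

theorem isCenterObject_toCenter : IsCenterObject (toCenter p) p where
  ρ_eq := rfl
  inv_eq _ := rfl

end OfModule

/-! ### From the center to modules over the double. -/

section OfCenter

variable (X : Center (HopfRep K H))

variable (K H) in
/-- The regular representation of `H`. -/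
noncomputable def regularRep : HopfRep K H where
  carrier := Fin (Module.finrank K H) → K
  ρ := smallRegular K H

/-- The half-braiding is given by an element of `H ⊗ End(V)`. -/
theorem exists_hom_eq : ∃ w : H ⊗[K] Module.End K X.1.carrier, ∀ U : HopfRep K H,
    (X.2.β U).hom.toLinearMap =
      actEnd U.ρ w ∘ₗ (TensorProduct.comm K X.1.carrier U.carrier).toLinearMap := by
  let e := (Module.finBasis K H).equivFun
  -- `w` records the half-braiding with the regular representation on the vectors `x ⊗ 1`.
  obtain ⟨w, hw⟩ := exists_lTensor_apply (K := K) (A := H)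
    ((e.symm.toLinearMap.rTensor X.1.carrier) ∘ₗ (X.2.β (regularRep K H)).hom.toLinearMap ∘ₗ
      (TensorProduct.mk K X.1.carrier (Fin (Module.finrank K H) → K)).flip (e 1))
  refine ⟨w, fun U => TensorProduct.ext' fun x y => ?_⟩
  -- The morphism `h ↦ h y` sends `1` to `y`, so naturality along it determines the half-braiding
  -- with `U` on `x ⊗ y`.
  let g : regularRep K H ⟶ U := ⟨(applyₗ y ∘ₗ U.ρ.toLinearMap) ∘ₗ e.symm.toLinearMap, fun a => by
    refine LinearMap.ext fun z => ?_
    obtain ⟨b, rfl⟩ := e.surjective z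
    change U.ρ (e.symm (smallRegular K H a (e b))) y = U.ρ a (U.ρ (e.symm (e b)) y)
    rw [smallRegular_apply, LinearEquiv.symm_apply_apply, LinearEquiv.symm_apply_apply, map_mul]
    rfl⟩
  have h1 : g.toLinearMap (e 1) = y := by
    change U.ρ (e.symm (e 1)) y = y
    rw [LinearEquiv.symm_apply_apply, map_one]
    rfl
  have h2 := LinearMap.congr_fun (congrArg HopfRep.Hom.toLinearMap (X.2.naturality g)) (x ⊗ₜ e 1)
  change (X.2.β U).hom.toLinearMap (x ⊗ₜ g.toLinearMap (e 1)) =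
    (g.toLinearMap.rTensor X.1.carrier) ((X.2.β (regularRep K H)).hom.toLinearMap (x ⊗ₜ e 1)) at h2
  rw [h1] at h2
  refine h2.trans ?_
  change _ = actEnd U.ρ w (y ⊗ₜ x)
  rw [actEnd_apply_tmul, hw]
  change ((applyₗ y ∘ₗ U.ρ.toLinearMap) ∘ₗ e.symm.toLinearMap).rTensor X.1.carrier _ = _
  rw [LinearMap.rTensor_comp]
  rfl

theorem actEnd_smallRegular_injective {V : Type v} [AddCommGroup V] [Module K V] :
    Function.Injective (actEnd (V := V) (smallRegular K H)) :=
  actEnd_injective (Module.finBasis K H).equivFun fun a => by rw [smallRegular_apply, mul_one]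

theorem actEnd_tensorAct_smallRegular_injective {V : Type v} [AddCommGroup V] [Module K V] :
    Function.Injective (actEnd (V := V) (tensorAct (smallRegular K H) (smallRegular K H))) := by
  let e := (Module.finBasis K H).equivFun
  refine actEnd_injective (TensorProduct.congr e e) fun t => ?_
  induction t with
  | zero => simp
  | tmul a b =>
    rw [tensorAct_tmul, Algebra.TensorProduct.one_def, TensorProduct.congr_tmul,
      TensorProduct.congr_tmul, TensorProduct.map_tmul, smallRegular_apply, smallRegular_apply,
      mul_one, mul_one]
  | add x y hx hy => simp only [map_add, LinearMap.add_apply, hx, hy]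

theorem comp_comm_injective {U V W : Type*} [AddCommGroup U] [Module K U] [AddCommGroup V]
    [Module K V] [AddCommGroup W] [Module K W] {f g : V ⊗[K] U →ₗ[K] W}
    (h : f ∘ₗ (TensorProduct.comm K U V).toLinearMap = g ∘ₗ (TensorProduct.comm K U V).toLinearMap) :
    f = g := by
  refine LinearMap.ext fun z => ?_
  simpa using LinearMap.congr_fun h (TensorProduct.comm K V U z)

/-- All the relations are read off from the half-braiding with the regular representation `L` and
with `L ⊗ L`, on which `H ⊗ End(V)` and `H ⊗ H ⊗ End(V)` act faithfully. -/
theorem exists_isDoublePair : ∃ w w' : H ⊗[K] Module.End K X.1.carrier,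
    IsDoublePair X.1.ρ w ∧ w' * w = 1 ∧ ∀ U : HopfRep K H, (X.2.β U).hom.toLinearMap =
      actEnd U.ρ w' ∘ₗ (TensorProduct.comm K X.1.carrier U.carrier).toLinearMap := by
  obtain ⟨w', hw'⟩ := exists_hom_eq X
  let L := regularRep K H
  let ρ : H →ₐ[K] Module.End K L.carrier := L.ρ
  have inj : Function.Injective (actEnd (V := X.1.carrier) ρ) := actEnd_smallRegular_injective
  let f : X.1.carrier ⊗[K] L.carrier →ₗ[K] L.carrier ⊗[K] X.1.carrier :=
    (X.2.β L).hom.toLinearMap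
  let g : L.carrier ⊗[K] X.1.carrier →ₗ[K] X.1.carrier ⊗[K] L.carrier :=
    (X.2.β L).inv.toLinearMap
  have hgf : g ∘ₗ f = LinearMap.id := congrArg HopfRep.Hom.toLinearMap (X.2.β L).hom_inv_id
  have hf : f = actEnd ρ w' ∘ₗ (TensorProduct.comm K X.1.carrier L.carrier).toLinearMap := hw' L
  have hlin : ∀ a, f ∘ₗ tensorAction X.1.ρ ρ a = tensorAction ρ X.1.ρ a ∘ₗ f :=
    (X.2.β L).hom.comm
  have hmon : actEnd (tensorAction ρ ρ) w' ∘ₗ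
      (TensorProduct.comm K X.1.carrier (L.carrier ⊗[K] L.carrier)).toLinearMap =
      (TensorProduct.assoc K L.carrier L.carrier X.1.carrier).symm.toLinearMap ∘ₗ
      TensorProduct.map LinearMap.id f ∘ₗ
      (TensorProduct.assoc K L.carrier X.1.carrier L.carrier).toLinearMap ∘ₗ
      TensorProduct.map f LinearMap.id ∘ₗ
      (TensorProduct.assoc K X.1.carrier L.carrier L.carrier).symm.toLinearMap :=
    (hw' (L ⊗ L)).symm.trans (congrArg HopfRep.Hom.toLinearMap (X.2.monoidal L L))
  clear_value f g
  -- Invertibility of the half-braiding gives a left inverse of the operator of `w'`, which makes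
  -- `w'` itself invertible.
  have hc : ((TensorProduct.comm K X.1.carrier L.carrier).toLinearMap ∘ₗ g) * actEnd ρ w' = 1 := by
    apply comp_comm_injective
    have h := congrArg (fun h => (TensorProduct.comm K X.1.carrier L.carrier).toLinearMap ∘ₗ h) hgf
    rw [hf] at h
    exact h
  obtain ⟨w, h1, h2⟩ := exists_mul_eq_one_of_comp_eq_id (actEnd ρ) inj w' _ hc
  refine ⟨w, w', IsDoublePair.of_inverse h1 h2 ?_ ?_, h2, hw'⟩
  · have inj₂ : Function.Injective (actEnd (V := X.1.carrier) (tensorAct ρ ρ)) :=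
      actEnd_tensorAct_smallRegular_injective
    rw [hf, hexagon, actEnd_tensorAction] at hmon
    exact inj₂ (comp_comm_injective hmon)
  · intro a
    apply inj
    apply comp_comm_injective
    have h := hlin a
    rw [hf, LinearMap.comp_assoc, comm_comp_tensorAction, tensorAction_eq_actEnd] at h
    rw [map_mul, map_mul]
    exact h

theorem exists_isCenterObject : ∃ p, IsCenterObject X p := by
  obtain ⟨w, w', hw, h1, hw'⟩ := exists_isDoublePair X
  refine ⟨hw.lift, (lift_comp_ofHopfHom hw).symm, fun U => ?_⟩
  rw [map_lift_canonical]
  let f : X.1.carrier ⊗[K] U.carrier →ₗ[K] U.carrier ⊗[K] X.1.carrier :=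
    (X.2.β U).hom.toLinearMap
  let g : U.carrier ⊗[K] X.1.carrier →ₗ[K] X.1.carrier ⊗[K] U.carrier :=
    (X.2.β U).inv.toLinearMap
  have hgf : g ∘ₗ f = LinearMap.id := congrArg HopfRep.Hom.toLinearMap (X.2.β U).hom_inv_id
  have hf : f = actEnd U.ρ w' ∘ₗ (TensorProduct.comm K X.1.carrier U.carrier).toLinearMap := hw' U
  change g = _
  clear_value f g
  have h2 : f ∘ₗ ((TensorProduct.comm K U.carrier X.1.carrier).toLinearMap ∘ₗ actEnd U.ρ w) =
      LinearMap.id := by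
    have := congrArg (actEnd U.ρ) h1
    rw [map_mul, map_one] at this
    refine LinearMap.ext fun x => ?_
    rw [hf]
    simpa using LinearMap.congr_fun this x
  -- The operator built from `w` is a right inverse of the half-braiding, hence equal to its
  -- two-sided inverse.
  calc g = g ∘ₗ (f ∘ₗ ((TensorProduct.comm K U.carrier X.1.carrier).toLinearMap ∘ₗ
        actEnd U.ρ w)) := by rw [h2, LinearMap.comp_id]
    _ = _ := by rw [← LinearMap.comp_assoc, hgf, LinearMap.id_comp]

end OfCenter

/-- The double braidings of the center are unipotent exactly when `R₂₁ R` is. -/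
theorem forall_isUnipotent_doubleBraiding_pow_iff (n : ℕ) :
    (∀ X Y : Center (HopfRep K H), IsUnipotent (doubleBraiding X Y ^ n)) ↔
      IsUnipotent (monodromy (rMatrix K H) ^ n) := by
  constructor
  · intro h
    -- The regular module of `D(H)` is faithful, so one object of the center detects unipotence of
    -- the monodromy itself.
    have hp := smallRegular_injective (K := K) (A := DrinfeldDouble K H)
    have hX := isCenterObject_toCenter (smallRegular K (DrinfeldDouble K H))
    exact (isUnipotent_tensorAct_iff hp _).1
      ((hX.isUnipotent_doubleBraiding_pow_iff hX n).1 (h _ _))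
  · intro h X Y
    obtain ⟨p, hp⟩ := exists_isCenterObject X
    obtain ⟨q, hq⟩ := exists_isCenterObject Y
    exact (hp.isUnipotent_doubleBraiding_pow_iff hq n).2 (h.map (tensorAct p q).toRingHom)

end DrinfeldDouble

end HopfQuasi

/-- For a finite-dimensional complex Hopf algebra `H`, the quasi-exponents of the tensor category
`Rep(H)` and of `H` exist and coincide. -/
theorem mainTheorem4 (H : Type u) [Ring H] [HopfAlgebra ℂ H] [FiniteDimensional ℂ H] :
    ∃ N : ℕ, HopfQuasi.IsQuasiExponent (HopfQuasi.HopfRep ℂ H) N ∧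
      HopfQuasi.IsHopfQuasiExponent ℂ H N := by
  classical
  obtain ⟨n, hn, hu⟩ := (HopfQuasi.DrinfeldDouble.isQuasitriangular_rMatrix
    (K := ℂ) (H := H)).exists_isNilpotent_drinfeld_pow_sub_one
  have h : ∃ n : ℕ, 0 < n ∧
    HopfQuasi.IsUnipotent (HopfQuasi.DrinfeldDouble.drinfeldElement ℂ H ^ n) := ⟨n, hn, hu⟩
  have hleast : HopfQuasi.IsHopfQuasiExponent ℂ H (Nat.find h) :=
    ⟨Nat.find_spec h, fun m hm => Nat.find_min' h hm⟩
  refine ⟨Nat.find h, ?_, hleast⟩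
  rw [HopfQuasi.IsQuasiExponent]
  -- Both defining sets of exponents coincide, through the powers of the monodromy.
  simp only [HopfQuasi.DrinfeldDouble.forall_isUnipotent_doubleBraiding_pow_iff,
    ← HopfQuasi.DrinfeldDouble.isUnipotent_drinfeldElement_pow_iff]
  exact hleast
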